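/- Work with formal power series in $q$ with integer coefficients, and let $c(g;n)$ denote the coefficient of $q^n$ in $g(q)$. For $n \ge 0$ put $(a;b)_n=\prod_{k=0}^{n-1}(1-ab^k)$ and $(a;b)_\infty=\prod_{k\ge 0}(1-ab^k)$, and let $J_m=(q^m;q^m)_\infty$ for $m\ge 1$. Consider the sixth order mock theta functions $$\lambda^{(6)}(q)=\sum_{n=0}^\infty \frac{(-1)^n q^n (q;q^2)_n}{(-q;q)_n},\qquad \psi^{(6)}(q)=\sum_{n=0}^\infty \frac{(-1)^n q^{(n+1)^2}(q;q^2)_n}{(-q;q)_{2n+1}}.$$ Then $$\sum_{n=0}^\infty c(\lambda^{(6)};2n)\,q^n=\frac{J_2^3J_3^2}{J_1^3J_6},\qquad \sum_{n=1}^\infty\bigl(2c(\psi^{(6)};n)-c(\lambda^{(6)};2n-1)\bigr)q^n=3q\,\frac{J_6^3}{J_1J_2}.$$ Furthermore, $c(\lambda^{(6)};2n-1)\equiv c(\psi^{(6)};n)\pmod 2$ for every integer $n\ge 1$, and, for every integer $n\ge 0$, the coefficient $c(\lambda^{(6)};2n)$ is odd if and only if $n=k(k+1)/2$ for some integer $k$.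 -/

import Mathlib

namespace MockTheta

open PowerSeries

/-- The finite `q`-Pochhammer symbol `(a; b)_n = ∏_{k=0}^{n-1} (1 - a b^k)`, for formal power
series `a`, `b` in `q = X` with integer coefficients. -/
noncomputable def qPoch (a b : ℤ⟦X⟧) (n : ℕ) : ℤ⟦X⟧ :=
  ∏ k ∈ Finset.range n, (1 - a * b ^ k)

open scoped PowerSeries.WithPiTopology in
/-- The infinite `q`-Pochhammer symbol `(a; b)_∞ = ∏_{k ≥ 0} (1 - a b^k)`, the product being
taken in `ℤ⟦X⟧` with the topology of coefficientwise convergence. -/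
noncomputable def qPochInf (a b : ℤ⟦X⟧) : ℤ⟦X⟧ :=
  ∏' k : ℕ, (1 - a * b ^ k)

/-- The quotient `f / g` in `ℤ⟦X⟧`; it is used only for `g` with constant term `1`
(see `qDiv_mul_cancel`). -/
noncomputable def qDiv (f g : ℤ⟦X⟧) : ℤ⟦X⟧ := f * invOfUnit g 1

/-- `J m = J_m = (q^m; q^m)_∞`. -/
noncomputable def J (m : ℕ) : ℤ⟦X⟧ := qPochInf (X ^ m) (X ^ m)

/-- The `n`-th term `(-1)^n q^n (q; q²)_n / (-q; q)_n`. -/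
noncomputable def lambdaTerm (n : ℕ) : ℤ⟦X⟧ :=
  qDiv ((-1) ^ n * X ^ n * qPoch X (X ^ 2) n) (qPoch (-X) X n)

/-- The `n`-th term `(-1)^n q^((n+1)²) (q; q²)_n / (-q; q)_{2n+1}`. -/
noncomputable def psiTerm (n : ℕ) : ℤ⟦X⟧ :=
  qDiv ((-1) ^ n * X ^ (n + 1) ^ 2 * qPoch X (X ^ 2) n) (qPoch (-X) X (2 * n + 1))

open scoped PowerSeries.WithPiTopology in
/-- Ramanujan's sixth order mock theta function `λ^(6)(q)`, as a formal power series. -/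
noncomputable def lambda6 : ℤ⟦X⟧ := ∑' n : ℕ, lambdaTerm n

open scoped PowerSeries.WithPiTopology in
/-- Ramanujan's sixth order mock theta function `ψ^(6)(q)`, as a formal power series. -/
noncomputable def psi6 : ℤ⟦X⟧ := ∑' n : ℕ, psiTerm n

/-- `c g n` is the coefficient of `q^n` in `g`. -/
noncomputable def c (g : ℤ⟦X⟧) (n : ℕ) : ℤ := coeff n g

/-! The facts below show that the products, sums and quotients above are genuine. -/

theorem qDiv_mul_cancel (f g : ℤ⟦X⟧) (hg : constantCoeff g = 1) : qDiv f g * g = f := by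
  rw [qDiv, mul_assoc, invOfUnit_mul g 1 (by simpa using hg), mul_one]

theorem constantCoeff_qPoch (a b : ℤ⟦X⟧) (ha : constantCoeff a = 0) (n : ℕ) :
    constantCoeff (qPoch a b n) = 1 := by
  simp [qPoch, map_prod, ha]

open scoped PowerSeries.WithPiTopology in
theorem multipliable_J (m : ℕ) (hm : 0 < m) :
    Multipliable fun k : ℕ => (1 - X ^ m * (X ^ m) ^ k : ℤ⟦X⟧) := by
  simp_rw [sub_eq_add_neg]
  apply WithPiTopology.multipliable_one_add_of_tendsto_order_atTop_nhds_top
  refine ENat.tendsto_nhds_top_iff_natCast_lt.mpr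
    (fun n => Filter.eventually_atTop.mpr ⟨n, fun k hk => ?_⟩)
  rw [order_neg, ← pow_succ', ← pow_mul, order_X_pow]
  norm_cast
  nlinarith

open scoped PowerSeries.WithPiTopology in
theorem constantCoeff_J (m : ℕ) (hm : 0 < m) : constantCoeff (J m) = 1 := by
  rw [J, qPochInf, (multipliable_J m hm).map_tprod _ (WithPiTopology.continuous_constantCoeff ℤ)]
  simp [hm.ne']

open scoped PowerSeries.WithPiTopology in
theorem summable_of_X_pow_dvd (f : ℕ → ℤ⟦X⟧) (h : ∀ n, X ^ n ∣ f n) : Summable f := by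
  apply WithPiTopology.summable_of_tendsto_order_atTop_nhds_top
  refine ENat.tendsto_nhds_top_iff_natCast_lt.mpr
    (fun n => Filter.eventually_atTop.mpr ⟨n + 1, fun k hk => ?_⟩)
  refine lt_of_lt_of_le ?_ (nat_le_order _ k (X_pow_dvd_iff.mp (h k)))
  exact_mod_cast hk

open scoped PowerSeries.WithPiTopology in
theorem summable_lambdaTerm : Summable lambdaTerm :=
  summable_of_X_pow_dvd _ fun n =>
    ⟨(-1) ^ n * qPoch X (X ^ 2) n * invOfUnit (qPoch (-X) X n) 1, by
      rw [lambdaTerm, qDiv]; ring⟩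

open scoped PowerSeries.WithPiTopology in
theorem summable_psiTerm : Summable psiTerm :=
  summable_of_X_pow_dvd _ fun n =>
    ⟨(-1) ^ n * X ^ (n ^ 2 + n + 1) * qPoch X (X ^ 2) n *
        invOfUnit (qPoch (-X) X (2 * n + 1)) 1, by
      rw [psiTerm, qDiv]; ring⟩

end MockTheta

/-! All identities are proved at a point `q`, `0 < ‖q‖ < 1`, of a complete ultrametric field. There
a family is summable as soon as its terms tend to zero, and products `(z; q)_∞` with `‖z‖ < 1` have
norm one. An injective continuous embedding of `ℤ⟦X⟧` into `LaurentSeries ℚ`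
(`exists_ultrametric_model`) carries them back to formal series.

Bailey pairs and q-Gauss sums turn both mock theta functions into Hecke-type series with the same
prefactor (`lambdaSum_eq`, `psiSum_eq`). Rearranging these lattice sums expresses them through
Appell-Lerch sums: `psiSum_mul_theta` gives `ψ(q)` as one such sum over a theta function, and
`theta_sq_mul_lambdaSum` gives `λ(q)` as a combination of two. A theta identity with the same
coefficients (`theta_sq_mul_theta`) shows that in `qλ(q) - 2ψ(q²)` only the difference of two
normalised Appell-Lerch sums to the base `q⁶` survives.

Such a difference is a difference of pole sums `P(z) = ∑ y/(1+y)²`, `y = zQⁿ` (`appell_sub`), and a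
difference of pole sums is a theta quotient (`poleSum_sub_poleSum_neg`), much like the factorisation
of `℘(a) - ℘(b)`. This gives `(q⁶;q⁶)³ (qλ(q) - 2ψ(q²)) = P(q) - P(q²)`. Relations under doubling
the base split the right side into `P(q) - P(-q)`, odd in `q`, and `P(q²) - P(-q²)`, even in `q`;
each is an eta quotient. Comparing odd and even coefficients (`X_mul_lambda6_eq`) yields both
generating functions.

For the parities, `J (2m) ≡ (J m)²` modulo 2. The even quotient becomes `(J 1)³ ≡ (J 2)² / J 1`, the
triangular series (`red_lambda6_quotient`). In the Hecke-type series of `ψ` only the central terms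
are odd, so `ψ` is congruent to the eta quotient in the second identity (`red_psi6`). -/

namespace MockTheta
open Filter Topology

/-! ### Summation in complete ultrametric fields. -/

section Summation

variable {K : Type*} [NormedField K]

theorem tendsto_cofinite_atTop_of_abs_le {e : ℤ → ℤ} (c : ℤ) (h : ∀ n, |n| ≤ e n + c) :
    Tendsto e cofinite atTop := by
  rw [tendsto_atTop]
  intro b
  rw [eventually_cofinite]
  refine (Set.finite_Icc (-(b + c)) (b + c)).subset ?_
  intro n hn
  have h1 : e n < b := not_le.mp hn
  have h2 := abs_le.mp ((h n).trans (by linarith : e n + c ≤ b + c))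
  exact ⟨h2.1, h2.2⟩

theorem tendsto_cofinite_atTop_of_abs_add_abs_le {e : ℤ × ℤ → ℤ} (c : ℤ)
    (h : ∀ m n, |m| + |n| ≤ e (m, n) + c) : Tendsto e cofinite atTop := by
  rw [tendsto_atTop]
  intro b
  rw [eventually_cofinite]
  refine ((Set.finite_Icc (-(b + c)) (b + c)).prod (Set.finite_Icc (-(b + c)) (b + c))).subset ?_
  rintro ⟨m, n⟩ hn
  have h1 : e (m, n) < b := not_le.mp hn
  have h0 := h m n
  have h3 := abs_nonneg m
  have h4 := abs_nonneg n
  have h5 := abs_le.mp (show |m| ≤ b + c by linarith)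
  have h6 := abs_le.mp (show |n| ≤ b + c by linarith)
  exact ⟨⟨h5.1, h5.2⟩, ⟨h6.1, h6.2⟩⟩

theorem tendsto_cofinite_atTop_of_natCast_le {e : ℕ → ℤ} (c : ℤ) (h : ∀ n : ℕ, (n : ℤ) ≤ e n + c) :
    Tendsto e cofinite atTop := by
  rw [Nat.cofinite_eq_atTop]
  refine tendsto_atTop_mono (f := fun n : ℕ => (n : ℤ) - c) (fun n => by linarith [h n]) ?_
  exact tendsto_atTop_add_const_right _ _ tendsto_natCast_atTop_atTop

theorem tendsto_zpow_atTop_zero {r : ℝ} (hr0 : 0 < r) (hr1 : r < 1) :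
    Tendsto (fun n : ℤ => r ^ n) atTop (𝓝 0) := by
  have h1 : Tendsto (fun n : ℤ => n.toNat) atTop atTop :=
    tendsto_atTop_mono (f := fun n : ℤ => n.toNat) (fun n => le_rfl) (by
      rw [tendsto_atTop]
      intro b
      filter_upwards [eventually_ge_atTop (b : ℤ)] with n hn
      omega)
  refine ((tendsto_pow_atTop_nhds_zero_of_lt_one hr0.le hr1).comp h1).congr' ?_
  filter_upwards [eventually_ge_atTop 0] with n hn
  simp only [Function.comp]
  rw [← zpow_natCast, Int.toNat_of_nonneg hn]

variable [IsUltrametricDist K]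

theorem norm_tsum_le_one {ι : Type*} {f : ι → K} (hf : ∀ i, ‖f i‖ ≤ 1) : ‖∑' i, f i‖ ≤ 1 :=
  IsUltrametricDist.norm_tsum_le_of_forall_le_of_nonneg zero_le_one hf

variable [CompleteSpace K]

/-- Terms tending to zero along the cofinite filter are already summable here, so only the
divergence of the exponent matters, not its rate. -/
theorem summable_of_norm_le_zpow {ι : Type*} {f : ι → K} {r : ℝ} (hr0 : 0 < r) (hr1 : r < 1)
    (C : ℝ) (e : ι → ℤ) (he : Tendsto e cofinite atTop) (hf : ∀ i, ‖f i‖ ≤ C * r ^ e i) :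
    Summable f := by
  apply NonarchimedeanAddGroup.summable_of_tendsto_cofinite_zero
  apply squeeze_zero_norm hf
  simpa using ((tendsto_zpow_atTop_zero hr0 hr1).comp he).const_mul C

theorem summable_zpow_mul {ι : Type*} {q : K} (hq0 : q ≠ 0) (hq1 : ‖q‖ < 1) (e : ι → ℤ)
    (he : Tendsto e cofinite atTop) (u : ι → K) (hu : ∀ i, ‖u i‖ ≤ 1) :
    Summable fun i => q ^ e i * u i := by
  refine summable_of_norm_le_zpow (norm_pos_iff.mpr hq0) hq1 1 e he fun i => ?_
  rw [norm_mul, norm_zpow, one_mul]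
  exact mul_le_of_le_one_right (by positivity) (hu i)

theorem summable_zpow {ι : Type*} {q : K} (hq0 : q ≠ 0) (hq1 : ‖q‖ < 1) (e : ι → ℤ)
    (he : Tendsto e cofinite atTop) : Summable fun i => q ^ e i := by
  simpa using summable_zpow_mul hq0 hq1 e he (fun _ => 1) (by simp)

/-- An ultrametric form of Tannery's theorem. -/
theorem tendsto_tsum_of_norm_le {ι α : Type*} {l : Filter α} [l.NeBot] {f : α → ι → K} {g : ι → K}
    {b : ι → ℝ} (hb : Tendsto b cofinite (𝓝 0)) (hf : ∀ a i, ‖f a i‖ ≤ b i)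
    (hg : ∀ i, Tendsto (fun a => f a i) l (𝓝 (g i))) :
    Tendsto (fun a => ∑' i, f a i) l (𝓝 (∑' i, g i)) := by
  have hgb : ∀ i, ‖g i‖ ≤ b i := fun i =>
    le_of_tendsto (hg i).norm (Eventually.of_forall fun a => hf a i)
  have hsf : ∀ a, Summable (f a) := fun a =>
    NonarchimedeanAddGroup.summable_of_tendsto_cofinite_zero (squeeze_zero_norm (hf a) hb)
  have hsg : Summable g :=
    NonarchimedeanAddGroup.summable_of_tendsto_cofinite_zero (squeeze_zero_norm hgb hb)
  rw [Metric.tendsto_nhds]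
  intro ε hε
  -- Only finitely many indices have a bound as large as `ε / 2`. They are treated pointwise; the
  -- ultrametric inequality disposes of all the others at once.
  have h1 : {i | ¬ b i < ε / 2}.Finite := hb.eventually (gt_mem_nhds (half_pos hε))
  have h2 : ∀ᶠ a in l, ∀ i ∈ h1.toFinset, ‖f a i - g i‖ ≤ ε / 2 := by
    rw [Filter.eventually_all_finset]
    intro i _
    have := (Metric.tendsto_nhds.mp (hg i)) (ε / 2) (half_pos hε)
    filter_upwards [this] with a ha
    rw [dist_eq_norm] at ha
    exact ha.le
  filter_upwards [h2] with a ha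
  rw [dist_eq_norm, ← (hsf a).tsum_sub hsg]
  refine lt_of_le_of_lt
    (IsUltrametricDist.norm_tsum_le_of_forall_le_of_nonneg (half_pos hε).le fun i => ?_)
    (half_lt_self hε)
  by_cases hi : b i < ε / 2
  · rw [sub_eq_add_neg]
    refine (IsUltrametricDist.norm_add_le_max _ _).trans ?_
    rw [norm_neg]
    exact max_le ((hf a i).trans hi.le) ((hgb i).trans hi.le)
  · exact ha i (by simpa using hi)

end Summation

/-! ### Triangular numbers of integers. -/

/-- The triangular number `n (n - 1) / 2` of an integer. -/
def tri (n : ℤ) : ℤ := n * (n - 1) / 2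

theorem two_mul_tri (n : ℤ) : 2 * tri n = n * (n - 1) := by
  have h : (2 : ℤ) ∣ n * (n - 1) := by
    rcases Int.even_or_odd n with h | h
    · exact (h.mul_right _).two_dvd
    · exact ((h.sub_odd odd_one).mul_left _).two_dvd
  rw [tri]; exact Int.mul_ediv_cancel' h

theorem tri_add (m n : ℤ) : tri (m + n) = tri m + tri n + m * n := by
  have h1 := two_mul_tri (m + n); have h2 := two_mul_tri m; have h3 := two_mul_tri n
  linarith

@[simp] theorem tri_zero : tri 0 = 0 := rfl
@[simp] theorem tri_one : tri 1 = 0 := rfl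

theorem tri_add_one (n : ℤ) : tri (n + 1) = tri n + n := by
  rw [tri_add]; simp

theorem tri_one_sub (n : ℤ) : tri (1 - n) = tri n := by
  have h1 := two_mul_tri (1 - n); have h2 := two_mul_tri n
  linarith

theorem tri_neg (n : ℤ) : tri (-n) = tri n + n := by
  have h1 := two_mul_tri (-n); have h2 := two_mul_tri n
  linarith

theorem tri_sub (m n : ℤ) : tri (m - n) = tri m + tri n + n - m * n := by
  rw [sub_eq_add_neg, tri_add, tri_neg]; ring

theorem tri_nonneg (n : ℤ) : 0 ≤ tri n := by
  have h := two_mul_tri n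
  rcases le_or_gt n 0 with h1 | h1 <;> nlinarith

/-- Quadratic growth beats any linear function. The constant comes from the square of `|n| - (B +
1)` and is not optimal; linear lower bounds on exponents are all that summability requires. -/
theorem mul_abs_le_tri (B n : ℤ) : B * |n| ≤ tri n + (B + 1) ^ 2 := by
  have h := two_mul_tri n
  have h2 : |n| ^ 2 = n ^ 2 := sq_abs n
  have h3 := le_abs_self n
  nlinarith [sq_nonneg (|n| - (B + 1)), sq_nonneg (B + 1), abs_nonneg n]

/-! ### Partial theta functions at integer powers of `q`. -/

section PartialTheta

variable {K : Type*} [NormedField K]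

/-- The partial theta function `∑_{i ≥ 0} (-1)^i q^(i(i+1)/2 + M i)`, continued to negative `M`. -/
noncomputable def partialTheta (q : K) (M : ℤ) : K :=
  if 0 ≤ M then ∑' i : ℕ, (-1) ^ i * q ^ (tri (i + 1) + M * i)
  else q ^ (-M) * ∑' i : ℕ, (-1) ^ i * q ^ (tri (i + 1) + (-M) * i)

/-- For `M < 0` the first `-2M` terms of the series cancel in pairs and what remains is the second
branch of the definition. Building this in gives the reflection at once and keeps every exponent
nonnegative. -/
theorem partialTheta_neg {q : K} (hq0 : q ≠ 0) (M : ℤ) :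
    partialTheta q (-M) = q ^ M * partialTheta q M := by
  rcases lt_trichotomy M 0 with h | h | h
  · rw [partialTheta, partialTheta, if_pos (by omega), if_neg (by omega), ← mul_assoc,
      ← zpow_add₀ hq0]
    simp
  · subst h; simp
  · rw [partialTheta, partialTheta, if_neg (by omega), if_pos (by omega), neg_neg]

variable [IsUltrametricDist K]

theorem norm_partialTheta_le {q : K} (hq1 : ‖q‖ < 1) (M : ℤ) : ‖partialTheta q M‖ ≤ 1 := by
  have key : ∀ N : ℤ, 0 ≤ N → ‖∑' i : ℕ, (-1) ^ i * q ^ (tri (i + 1) + N * i)‖ ≤ 1 := by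
    intro N hN
    refine norm_tsum_le_one fun i => ?_
    have h1 : 0 ≤ tri (i + 1) + N * i := by have := tri_nonneg (i + 1); positivity
    lift tri (i + 1) + N * i to ℕ using h1 with e
    rw [norm_mul, norm_pow, norm_neg, norm_one, one_pow, one_mul, zpow_natCast, norm_pow]
    exact pow_le_one₀ (norm_nonneg _) hq1.le
  rw [partialTheta]
  split_ifs with h
  · exact key M h
  · rw [norm_mul]
    have h1 : 0 ≤ -M := by omega
    refine mul_le_one₀ ?_ (norm_nonneg _) (key (-M) h1)
    lift -M to ℕ using h1 with e
    rw [zpow_natCast, norm_pow]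
    exact pow_le_one₀ (norm_nonneg _) hq1.le

variable [CompleteSpace K]

theorem summable_partialTheta {q : K} (hq0 : q ≠ 0) (hq1 : ‖q‖ < 1) {M : ℤ} (hM : 0 ≤ M) :
    Summable fun i : ℕ => (-1) ^ i * q ^ (tri (i + 1) + M * i) := by
  simp_rw [mul_comm ((-1 : K) ^ _)]
  refine summable_zpow_mul hq0 hq1 _ (tendsto_cofinite_atTop_of_natCast_le 0 fun n => ?_) _ ?_
  · have h := tri_nonneg n
    rw [tri_add_one]
    nlinarith [mul_nonneg hM (Int.natCast_nonneg n)]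
  · simp

/-- For `M ≥ 0` this splits off the first term. For `M < 0` it is the same relation at `-(M + 1)`,
reflected. Its validity on all of `ℤ` is what lets bilateral sums be formed from a one-sided series.
-/
theorem partialTheta_step {q : K} (hq0 : q ≠ 0) (hq1 : ‖q‖ < 1) (M : ℤ) :
    partialTheta q M = 1 - q ^ (M + 1) * partialTheta q (M + 1) := by
  have key : ∀ N : ℤ, 0 ≤ N → partialTheta q N = 1 - q ^ (N + 1) * partialTheta q (N + 1) := by
    intro N hN
    rw [partialTheta, if_pos hN, partialTheta, if_pos (by omega),
      (summable_partialTheta hq0 hq1 hN).tsum_eq_zero_add, ← tsum_mul_left, sub_eq_add_neg,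
      ← tsum_neg]
    congr 1
    · simp
    · refine tsum_congr fun i => ?_
      rw [pow_succ, mul_left_comm, ← zpow_add₀ hq0]
      push_cast
      rw [tri_add_one]
      ring_nf
  rcases le_or_gt 0 M with h | h
  · exact key M h
  · have h1 := key (-(M + 1)) (by omega)
    rw [show -(M + 1) + 1 = -M by ring, partialTheta_neg hq0, partialTheta_neg hq0, ← mul_assoc,
      ← zpow_add₀ hq0] at h1
    simp at h1
    linear_combination h1

end PartialTheta

end MockTheta

/-! ### Finite q-products and Gaussian binomials. -/

namespace MockTheta
open Filter Topology

/-- The finite product `(a; p)_n`. -/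
def poch {R : Type*} [CommRing R] (a p : R) (n : ℕ) : R := ∏ k ∈ Finset.range n, (1 - a * p ^ k)

@[simp] theorem poch_zero {R : Type*} [CommRing R] (a p : R) : poch a p 0 = 1 := by simp [poch]

theorem poch_succ {R : Type*} [CommRing R] (a p : R) (n : ℕ) :
    poch a p (n + 1) = poch a p n * (1 - a * p ^ n) := by
  rw [poch, Finset.prod_range_succ, poch]

theorem poch_succ' {R : Type*} [CommRing R] (a p : R) (n : ℕ) :
    poch a p (n + 1) = (1 - a) * poch (a * p) p n := by
  rw [poch, Finset.prod_range_succ', poch, mul_comm]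
  congr 1
  · simp
  · exact Finset.prod_congr rfl fun k _ => by ring

theorem poch_self_succ {R : Type*} [CommRing R] (p : R) (n : ℕ) :
    poch p p (n + 1) = poch p p n * (1 - p ^ (n + 1)) := by
  rw [poch_succ, pow_succ']

theorem poch_add {R : Type*} [CommRing R] (a p : R) (m n : ℕ) :
    poch a p (m + n) = poch a p m * poch (a * p ^ m) p n := by
  rw [poch, Finset.prod_range_add, poch, poch]
  congr 1
  exact Finset.prod_congr rfl fun k _ => by ring

/-- The Gaussian binomial coefficient. -/
def gaussBinom {R : Type*} [CommRing R] (p : R) : ℕ → ℕ → R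
  | _, 0 => 1
  | 0, _ + 1 => 0
  | m + 1, i + 1 => gaussBinom p m (i + 1) + p ^ (m - i) * gaussBinom p m i

section GaussBinom

variable {R : Type*} [CommRing R] (p : R)

@[simp] theorem gaussBinom_zero_right (m : ℕ) : gaussBinom p m 0 = 1 := by
  cases m <;> rfl

theorem gaussBinom_succ_succ (m i : ℕ) :
    gaussBinom p (m + 1) (i + 1) = gaussBinom p m (i + 1) + p ^ (m - i) * gaussBinom p m i := rfl

theorem gaussBinom_eq_zero {m i : ℕ} (h : m < i) : gaussBinom p m i = 0 := by
  induction m generalizing i with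
  | zero => cases i with
    | zero => omega
    | succ i => rfl
  | succ m ih => cases i with
    | zero => omega
    | succ i => rw [gaussBinom_succ_succ, ih (by omega), ih (by omega)]; simp

/-- The product formula is kept free of division so that it holds in any commutative ring. The
induction is on the total `i + b`, both Pascal terms being instances of the hypothesis. -/
theorem gaussBinom_mul_poch (i b : ℕ) :
    gaussBinom p (i + b) i * poch p p i * poch p p b = poch p p (i + b) := by
  obtain ⟨m, hm⟩ : ∃ m, m = i + b := ⟨_, rfl⟩
  rw [← hm]
  induction m generalizing i b with
  | zero =>
    obtain ⟨rfl, rfl⟩ : i = 0 ∧ b = 0 := by omega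
    simp
  | succ m ih =>
    cases i with
    | zero =>
      obtain rfl : b = m + 1 := by omega
      simp
    | succ i =>
      rw [gaussBinom_succ_succ]
      cases b with
      | zero =>
        obtain rfl : i = m := by omega
        have h1 := ih i 0 rfl
        rw [gaussBinom_eq_zero p (Nat.lt_succ_self i), poch_self_succ]
        simp only [poch_zero] at h1 ⊢
        rw [Nat.sub_self]
        linear_combination (1 - p ^ (i + 1)) * h1
      | succ b =>
        have h1 := ih (i + 1) b (by omega)
        have h2 := ih i (b + 1) (by omega)
        have h3 : m - i = b + 1 := by omega
        have h4 : p ^ (m + 1) = p ^ (b + 1) * p ^ (i + 1) := by rw [← pow_add]; congr 1; omega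
        rw [h3, poch_self_succ p m, h4]
        rw [poch_self_succ p i] at h1 ⊢
        rw [poch_self_succ p b] at h2 ⊢
        linear_combination (1 - p ^ (b + 1)) * h1 + p ^ (b + 1) * (1 - p ^ (i + 1)) * h2

/-- Pascal's rule summed against an arbitrary weight. It drives the inductions on `m` for the finite
summation formulas. -/
theorem sum_gaussBinom_succ (m : ℕ) (g : ℕ → R) :
    ∑ i ∈ Finset.range (m + 2), gaussBinom p (m + 1) i * g i =
      ∑ i ∈ Finset.range (m + 1), gaussBinom p m i * g i +
        ∑ i ∈ Finset.range (m + 1), p ^ (m - i) * gaussBinom p m i * g (i + 1) := by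
  rw [Finset.sum_range_succ', Finset.sum_congr rfl fun i _ => by
    rw [gaussBinom_succ_succ, add_mul], Finset.sum_add_distrib,
    Finset.sum_range_succ (fun i => gaussBinom p m (i + 1) * g (i + 1)),
    gaussBinom_eq_zero p (Nat.lt_succ_self m), Finset.sum_range_succ' (fun i => gaussBinom p m i * g i)]
  simp only [gaussBinom_zero_right]
  ring

theorem choose_succ_two (i : ℕ) : (i + 1).choose 2 = i.choose 2 + i := by
  rw [Nat.choose_succ_succ' i 1, Nat.choose_one_right, add_comm]

theorem tri_natCast (i : ℕ) : tri i = (i.choose 2 : ℕ) := by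
  induction i with
  | zero => simp
  | succ i ih => rw [Nat.cast_succ, tri_add_one, ih, choose_succ_two]; push_cast; ring

/-- The `q`-binomial theorem. -/
theorem poch_eq_sum_gaussBinom (m : ℕ) (y : R) :
    poch (-y) p m = ∑ i ∈ Finset.range (m + 1), gaussBinom p m i * (p ^ i.choose 2 * y ^ i) := by
  induction m with
  | zero => simp
  | succ m ih =>
    rw [sum_gaussBinom_succ, poch_succ, ih, mul_sub, mul_one, Finset.sum_mul, sub_eq_add_neg,
      ← Finset.sum_neg_distrib]
    congr 1
    refine Finset.sum_congr rfl fun i hi => ?_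
    obtain ⟨b, rfl⟩ := Nat.exists_eq_add_of_le (Nat.lt_succ_iff.mp (Finset.mem_range.mp hi))
    rw [choose_succ_two, Nat.add_sub_cancel_left]
    ring

end GaussBinom

/-! ### Infinite products in an ultrametric field. -/

section Products

variable {K : Type*} [NormedField K]

/-- The infinite product `(z; Q)_∞`. -/
noncomputable def eulerProd (z Q : K) : K := ∏' k : ℕ, (1 - z * Q ^ k)

variable [CompleteSpace K]

theorem multipliable_eulerProd {Q : K} (hQ : ‖Q‖ < 1) (z : K) :
    Multipliable fun k : ℕ => 1 - z * Q ^ k := by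
  have : Summable fun k : ℕ => ‖-(z * Q ^ k)‖ := by
    simp_rw [norm_neg, norm_mul, norm_pow]
    exact (summable_geometric_of_lt_one (norm_nonneg _) hQ).mul_left _
  simpa [sub_eq_add_neg] using multipliable_one_add_of_summable this

theorem tendsto_poch {Q : K} (hQ : ‖Q‖ < 1) (z : K) :
    Tendsto (poch z Q) atTop (𝓝 (eulerProd z Q)) :=
  (multipliable_eulerProd hQ z).hasProd.tendsto_prod_nat

theorem eulerProd_eq_poch_mul {Q : K} (hQ : ‖Q‖ < 1) (z : K) (n : ℕ) :
    eulerProd z Q = poch z Q n * eulerProd (z * Q ^ n) Q := by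
  refine tendsto_nhds_unique (tendsto_poch hQ z) ?_
  have h := (tendsto_poch hQ (z * Q ^ n)).const_mul (poch z Q n)
  rw [← tendsto_add_atTop_iff_nat n]
  refine h.congr fun m => ?_
  rw [← poch_add, add_comm]

theorem eulerProd_eq_mul {Q : K} (hQ : ‖Q‖ < 1) (z : K) :
    eulerProd z Q = (1 - z) * eulerProd (z * Q) Q := by
  simpa [poch] using eulerProd_eq_poch_mul hQ z 1

variable [IsUltrametricDist K]

theorem norm_one_sub_of_norm_lt {x : K} (hx : ‖x‖ < 1) : ‖1 - x‖ = 1 := by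
  have h := IsUltrametricDist.norm_add_eq_max_of_norm_ne_norm (x := (1 : K)) (y := -x)
    (by rw [norm_one, norm_neg]; exact hx.ne')
  rw [norm_one, norm_neg, max_eq_left hx.le] at h
  rwa [sub_eq_add_neg]

theorem norm_one_add_of_norm_lt {x : K} (hx : ‖x‖ < 1) : ‖1 + x‖ = 1 := by
  have := norm_one_sub_of_norm_lt (x := -x) (by rwa [norm_neg])
  rwa [sub_neg_eq_add] at this

/-- Each factor is `1` minus something of norm less than one, hence has norm one. Nonvanishing of
the finite and infinite products therefore comes for free. -/
theorem norm_poch {Q : K} (hQ : ‖Q‖ < 1) {z : K} (hz : ‖z‖ < 1) (n : ℕ) : ‖poch z Q n‖ = 1 := by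
  rw [poch, norm_prod]
  refine Finset.prod_eq_one fun k _ => norm_one_sub_of_norm_lt ?_
  rw [norm_mul, norm_pow]
  exact mul_lt_one_of_nonneg_of_lt_one_left (norm_nonneg _) hz (pow_le_one₀ (norm_nonneg _) hQ.le)

theorem norm_eulerProd {Q : K} (hQ : ‖Q‖ < 1) {z : K} (hz : ‖z‖ < 1) : ‖eulerProd z Q‖ = 1 := by
  refine tendsto_nhds_unique (tendsto_poch hQ z).norm ?_
  simp_rw [norm_poch hQ hz]
  exact tendsto_const_nhds

theorem poch_ne_zero {Q : K} (hQ : ‖Q‖ < 1) {z : K} (hz : ‖z‖ < 1) (n : ℕ) : poch z Q n ≠ 0 :=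
  norm_ne_zero_iff.mp (by rw [norm_poch hQ hz]; exact one_ne_zero)

theorem eulerProd_ne_zero {Q : K} (hQ : ‖Q‖ < 1) {z : K} (hz : ‖z‖ < 1) : eulerProd z Q ≠ 0 :=
  norm_ne_zero_iff.mp (by rw [norm_eulerProd hQ hz]; exact one_ne_zero)

end Products

/-! ### Theta series and their quasi-periodicity. -/

section Theta

variable {K : Type*} [NormedField K]

/-- The theta function `∑_{n ∈ ℤ} Q^(n(n-1)/2) z^n`. -/
noncomputable def theta (Q z : K) : K := ∑' n : ℤ, Q ^ tri n * z ^ n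

/-- Some power of `‖Q‖⁻¹` dominates both `‖z‖` and `‖z⁻¹‖`. Measuring `z` on the scale of `Q`
reduces convergence to a comparison of integer exponents. -/
theorem exists_norm_zpow_le {Q z : K} (hQ0 : Q ≠ 0) (hQ1 : ‖Q‖ < 1) (hz : z ≠ 0) :
    ∃ B : ℤ, 0 ≤ B ∧ ∀ n : ℤ, ‖z ^ n‖ ≤ ‖Q‖ ^ (-(B * |n|)) := by
  have hr0 : 0 < ‖Q‖ := norm_pos_iff.mpr hQ0
  have key : ∀ x : ℝ, ∃ B : ℕ, ∀ C, B ≤ C → x ≤ ‖Q‖ ^ (-(C : ℤ)) := by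
    intro x
    obtain ⟨B, hB⟩ := pow_unbounded_of_one_lt x ((one_lt_inv₀ hr0).mpr hQ1)
    refine ⟨B, fun C hC => hB.le.trans ?_⟩
    rw [zpow_neg, ← inv_zpow, zpow_natCast]
    exact pow_le_pow_right₀ ((one_lt_inv₀ hr0).mpr hQ1).le hC
  obtain ⟨B₁, h₁⟩ := key ‖z‖
  obtain ⟨B₂, h₂⟩ := key ‖z⁻¹‖
  have hA := h₁ _ (le_max_left B₁ B₂)
  have hB := h₂ _ (le_max_right B₁ B₂)
  refine ⟨(max B₁ B₂ : ℕ), by positivity, fun n => ?_⟩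
  generalize max B₁ B₂ = B at hA hB
  rw [← neg_mul, zpow_mul]
  rcases le_total 0 n with hn | hn
  · rw [abs_of_nonneg hn]
    lift n to ℕ using hn
    rw [zpow_natCast, zpow_natCast, norm_pow]
    exact pow_le_pow_left₀ (norm_nonneg _) hA n
  · rw [abs_of_nonpos hn]
    obtain ⟨m, rfl⟩ : ∃ m : ℕ, n = -m := ⟨n.natAbs, by omega⟩
    rw [neg_neg, zpow_neg, ← inv_zpow, zpow_natCast, zpow_natCast, norm_pow]
    exact pow_le_pow_left₀ (norm_nonneg _) hB m

theorem norm_theta_term_le {Q z : K} {B : ℤ} (hQ0 : Q ≠ 0)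
    (hB : ∀ n : ℤ, ‖z ^ n‖ ≤ ‖Q‖ ^ (-(B * |n|))) (n : ℤ) :
    ‖Q ^ tri n * z ^ n‖ ≤ ‖Q‖ ^ (tri n - B * |n|) := by
  have hr0 : 0 < ‖Q‖ := norm_pos_iff.mpr hQ0
  rw [norm_mul, norm_zpow, sub_eq_add_neg, zpow_add₀ hr0.ne']
  gcongr
  exact hB n

theorem tendsto_tri_sub (B : ℤ) : Tendsto (fun n : ℤ => tri n - B * |n|) cofinite atTop :=
  tendsto_cofinite_atTop_of_abs_le ((B + 2) ^ 2) fun n => by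
    have := mul_abs_le_tri (B + 1) n
    linarith

variable [IsUltrametricDist K] [CompleteSpace K]

theorem summable_theta {Q z : K} (hQ0 : Q ≠ 0) (hQ1 : ‖Q‖ < 1) (hz : z ≠ 0) :
    Summable fun n : ℤ => Q ^ tri n * z ^ n := by
  obtain ⟨B, -, hB⟩ := exists_norm_zpow_le hQ0 hQ1 hz
  refine summable_of_norm_le_zpow (norm_pos_iff.mpr hQ0) hQ1 1 _ (tendsto_tri_sub B) fun n => ?_
  rw [one_mul]
  exact norm_theta_term_le hQ0 hB n

theorem theta_eq_mul {Q z : K} (hQ0 : Q ≠ 0) (hz : z ≠ 0) (n : ℤ) :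
    theta Q z = Q ^ tri n * z ^ n * theta Q (z * Q ^ n) := by
  rw [theta, theta, ← tsum_mul_left, ← (Equiv.addLeft n).tsum_eq]
  refine tsum_congr fun m => ?_
  rw [Equiv.coe_addLeft, tri_add, zpow_add₀ hz, zpow_add₀ hQ0, zpow_add₀ hQ0, mul_zpow, ← zpow_mul]
  ring

theorem theta_inv {Q z : K} (hz : z ≠ 0) : theta Q z⁻¹ = z⁻¹ * theta Q z := by
  rw [theta, theta, ← tsum_mul_left, ← (Equiv.subLeft (1 : ℤ)).tsum_eq]
  refine tsum_congr fun m => ?_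
  rw [Equiv.subLeft_apply, tri_one_sub, inv_zpow', neg_sub, zpow_sub₀ hz]
  field_simp

/-- The reflection `n ↦ 1 - n` fixes the exponent and reverses the sign, so the sum is its own
negative. -/
theorem theta_neg_one [CharZero K] (Q : K) : theta Q (-1) = 0 := by
  have h : theta Q (-1) = -theta Q (-1) := by
    nth_rewrite 1 [theta]
    rw [theta, ← tsum_neg, ← (Equiv.subLeft (1 : ℤ)).tsum_eq]
    refine tsum_congr fun m => ?_
    rw [Equiv.subLeft_apply, tri_one_sub, zpow_sub₀ (by norm_num)]
    rcases Int.even_or_odd m with h | h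
    · rw [h.neg_one_zpow]; ring
    · rw [h.neg_one_zpow]; ring
  exact self_eq_neg.mp h

theorem theta_neg_zpow [CharZero K] {Q : K} (hQ0 : Q ≠ 0) (n : ℤ) : theta Q (-Q ^ n) = 0 := by
  have h := theta_eq_mul hQ0 (z := -1) (by norm_num) n
  rw [theta_neg_one, neg_one_mul] at h
  have h2 : Q ^ tri n * (-1 : K) ^ n ≠ 0 :=
    mul_ne_zero (zpow_ne_zero _ hQ0) (zpow_ne_zero _ (by norm_num))
  exact (mul_eq_zero.mp h.symm).resolve_left h2

end Theta

end MockTheta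

namespace MockTheta
open Filter Topology

/-! ### Jacobi's triple product from its finite form. -/

section TripleProduct

variable {K : Type*} [NormedField K] [IsUltrametricDist K] [CompleteSpace K]

theorem norm_gaussBinom_le {Q : K} (hQ1 : ‖Q‖ < 1) (m i : ℕ) : ‖gaussBinom Q m i‖ ≤ 1 := by
  rcases lt_or_ge m i with h | h
  · rw [gaussBinom_eq_zero Q h, norm_zero]; exact zero_le_one
  · obtain ⟨b, rfl⟩ := Nat.exists_eq_add_of_le h
    have h1 := congrArg norm (gaussBinom_mul_poch Q i b)
    rw [norm_mul, norm_mul, norm_poch hQ1 hQ1, norm_poch hQ1 hQ1, norm_poch hQ1 hQ1] at h1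
    linarith

/-- The coefficients in the finite form of the triple product identity. -/
noncomputable def tripleCoeff (Q : K) (N : ℕ) (n : ℤ) : K :=
  if |n| ≤ N then gaussBinom Q (2 * N) (N + n).toNat else 0

theorem norm_tripleCoeff_le {Q : K} (hQ1 : ‖Q‖ < 1) (N : ℕ) (n : ℤ) :
    ‖tripleCoeff Q N n‖ ≤ 1 := by
  rw [tripleCoeff]
  split_ifs
  · exact norm_gaussBinom_le hQ1 _ _
  · rw [norm_zero]; exact zero_le_one

theorem tendsto_tripleCoeff {Q : K} (hQ1 : ‖Q‖ < 1) (n : ℤ) :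
    Tendsto (fun N => tripleCoeff Q N n) atTop (𝓝 (eulerProd Q Q)⁻¹) := by
  have hE := eulerProd_ne_zero hQ1 hQ1
  have hsub : ∀ f : ℕ → ℕ, Tendsto f atTop atTop →
      Tendsto (fun N => poch Q Q (f N)) atTop (𝓝 (eulerProd Q Q)) :=
    fun f hf => (tendsto_poch hQ1 Q).comp hf
  have t1 := hsub (fun N => 2 * N) (tendsto_atTop_mono (fun N => by simp; omega) tendsto_id)
  have t2 := hsub (fun N => ((N : ℤ) + n).toNat) (tendsto_atTop.mpr fun b => by
    filter_upwards [eventually_ge_atTop (b + n.natAbs)] with N hN; omega)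
  have t3 := hsub (fun N => ((N : ℤ) - n).toNat) (tendsto_atTop.mpr fun b => by
    filter_upwards [eventually_ge_atTop (b + n.natAbs)] with N hN; omega)
  have t4 := t1.div (t2.mul t3) (mul_ne_zero hE hE)
  rw [show eulerProd Q Q / (eulerProd Q Q * eulerProd Q Q) = (eulerProd Q Q)⁻¹ by
    field_simp] at t4
  refine t4.congr' ?_
  filter_upwards [eventually_ge_atTop n.natAbs] with N hN
  have h1 : |n| ≤ N := by rw [Int.abs_eq_natAbs]; exact_mod_cast hN
  have h2 := gaussBinom_mul_poch Q ((N : ℤ) + n).toNat ((N : ℤ) - n).toNat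
  rw [show ((N : ℤ) + n).toNat + ((N : ℤ) - n).toNat = 2 * N by omega] at h2
  simp only [Pi.div_apply]
  rw [tripleCoeff, if_pos h1, ← h2]
  have h3 := poch_ne_zero hQ1 hQ1 ((N : ℤ) + n).toNat
  have h4 := poch_ne_zero hQ1 hQ1 ((N : ℤ) - n).toNat
  field_simp

/-- This is the q-binomial theorem of length `2N` at the argument `z Q^{-N}`. Its first `N` factors,
read backwards, are those of the product in `Q / z` up to a monomial, and the summation index is
recentred by `N`. -/
theorem poch_mul_poch_eq_tsum {Q z : K} (hQ0 : Q ≠ 0) (hz : z ≠ 0) (N : ℕ) :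
    poch (-z) Q N * poch (-(Q / z)) Q N =
      ∑' n : ℤ, tripleCoeff Q N n * (Q ^ tri n * z ^ n) := by
  have h1 : poch (-(z * Q ^ (-(N : ℤ)))) Q (2 * N) =
      z ^ N * Q ^ (-(tri (N + 1) : ℤ)) * (poch (-z) Q N * poch (-(Q / z)) Q N) := by
    rw [two_mul, poch_add]
    have e1 : -(z * Q ^ (-(N : ℤ))) * Q ^ N = -z := by
      rw [neg_mul, mul_assoc, ← zpow_natCast Q N, ← zpow_add₀ hQ0]; simp
    rw [e1]
    have e2 : poch (-(z * Q ^ (-(N : ℤ)))) Q N =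
        z ^ N * Q ^ (-(tri (N + 1) : ℤ)) * poch (-(Q / z)) Q N := by
      clear e1
      induction N with
      | zero => simp
      | succ N ih =>
        rw [poch_succ', show -(z * Q ^ (-((N + 1 : ℕ) : ℤ))) * Q = -(z * Q ^ (-(N : ℤ))) by
          rw [neg_mul, mul_assoc, ← zpow_add_one₀ hQ0]; congr 3; push_cast; ring, ih, poch_succ,
          Nat.cast_succ, tri_add_one (N + 1 : ℤ), pow_succ z]
        have e3 : Q ^ ((N : ℤ) + 1) = Q ^ N * Q := by
          rw [zpow_add_one₀ hQ0, zpow_natCast]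
        have e4 : Q ^ (-((N : ℤ) + 1)) = (Q ^ N * Q)⁻¹ := by rw [zpow_neg, e3]
        have e5 : Q ^ (-(tri ((N : ℤ) + 1) + ((N : ℤ) + 1))) =
            Q ^ (-tri ((N : ℤ) + 1)) * (Q ^ N * Q)⁻¹ := by rw [neg_add, zpow_add₀ hQ0, e4]
        rw [e4, e5]
        field_simp
        ring
    rw [e2]; ring
  rw [poch_eq_sum_gaussBinom] at h1
  have h2 : z ^ N * Q ^ (-(tri (N + 1) : ℤ)) ≠ 0 :=
    mul_ne_zero (pow_ne_zero _ hz) (zpow_ne_zero _ hQ0)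
  apply mul_left_cancel₀ h2
  rw [← h1, tsum_eq_sum (s := Finset.Icc (-(N : ℤ)) N), Finset.mul_sum]
  · refine Finset.sum_nbij' (fun i => (i : ℤ) - N) (fun n => (N + n).toNat) ?_ ?_ ?_ ?_ ?_
    · intro i hi; rw [Finset.mem_range] at hi; rw [Finset.mem_Icc]; omega
    · intro n hn; rw [Finset.mem_Icc] at hn; rw [Finset.mem_range]; omega
    · intro i hi; omega
    · intro n hn; rw [Finset.mem_Icc] at hn; omega
    · intro i hi
      rw [Finset.mem_range] at hi
      rw [tripleCoeff, if_pos (by rw [abs_le]; omega),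
        show ((N : ℤ) + ((i : ℤ) - N)).toNat = i by omega]
      have e1 : z ^ i = z ^ N * z ^ ((i : ℤ) - N) := by
        rw [← zpow_natCast, ← zpow_natCast, ← zpow_add₀ hz]; congr 1; ring
      have e2 : Q ^ (i.choose 2) * (Q ^ (-(N : ℤ))) ^ i =
          Q ^ (-(tri (N + 1) : ℤ)) * Q ^ tri ((i : ℤ) - N) := by
        rw [← zpow_natCast, ← tri_natCast, ← zpow_natCast, ← zpow_mul, ← zpow_add₀ hQ0,
          ← zpow_add₀ hQ0, tri_sub, tri_add_one]
        congr 1; ring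
      rw [mul_pow, e1]
      linear_combination gaussBinom Q (2 * N) i * z ^ N * z ^ ((i : ℤ) - N) * e2
  · intro n hn
    rw [tripleCoeff, if_neg, zero_mul]
    rwa [abs_le, ← Finset.mem_Icc]

/-- Jacobi's triple product identity. -/
theorem theta_eq_eulerProd {Q z : K} (hQ0 : Q ≠ 0) (hQ1 : ‖Q‖ < 1) (hz : z ≠ 0) :
    theta Q z = eulerProd (-z) Q * eulerProd (-(Q / z)) Q * eulerProd Q Q := by
  have t1 := (tendsto_poch hQ1 (-z)).mul (tendsto_poch hQ1 (-(Q / z)))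
  have t2 : Tendsto (fun N => ∑' n : ℤ, tripleCoeff Q N n * (Q ^ tri n * z ^ n)) atTop
      (𝓝 (∑' n : ℤ, (eulerProd Q Q)⁻¹ * (Q ^ tri n * z ^ n))) := by
    -- The finite coefficients have norm at most one, so the theta terms themselves dominate and the
    -- limit passes inside the sum.
    have h0 := (summable_theta hQ0 hQ1 hz).tendsto_cofinite_zero.norm
    rw [norm_zero] at h0
    refine tendsto_tsum_of_norm_le h0 (fun N n => ?_) fun n =>
      (tendsto_tripleCoeff hQ1 n).mul_const _
    rw [norm_mul]
    exact mul_le_of_le_one_left (norm_nonneg _) (norm_tripleCoeff_le hQ1 N n)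
  have h := tendsto_nhds_unique t1 (t2.congr fun N => (poch_mul_poch_eq_tsum hQ0 hz N).symm)
  rw [h, tsum_mul_left, theta]
  have hE := eulerProd_ne_zero hQ1 hQ1
  field_simp

/-- All factors have norm at most one, so changing the argument changes the product by no more than
the argument. The bound is uniform in the length and passes to infinite products. -/
theorem norm_poch_sub_le {Q : K} (hQ1 : ‖Q‖ < 1) {z w : K} (hz : ‖z‖ ≤ 1) (hw : ‖w‖ ≤ 1) (n : ℕ) :
    ‖poch z Q n - poch w Q n‖ ≤ ‖z - w‖ := by
  have hone : ∀ x : K, ‖x‖ ≤ 1 → ∀ k : ℕ, ‖1 - x * Q ^ k‖ ≤ 1 := by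
    intro x hx k
    rw [sub_eq_add_neg]
    refine (IsUltrametricDist.norm_add_le_max _ _).trans ?_
    rw [norm_one, norm_neg, norm_mul, norm_pow]
    exact max_le le_rfl (mul_le_one₀ hx (by positivity) (pow_le_one₀ (norm_nonneg _) hQ1.le))
  have hp : ∀ m : ℕ, ‖poch w Q m‖ ≤ 1 := by
    intro m
    rw [poch, norm_prod]
    exact Finset.prod_le_one (fun _ _ => norm_nonneg _) fun k _ => hone w hw k
  induction n with
  | zero => simp
  | succ n ih =>
    rw [poch_succ, poch_succ, show poch z Q n * (1 - z * Q ^ n) - poch w Q n * (1 - w * Q ^ n) =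
      (poch z Q n - poch w Q n) * (1 - z * Q ^ n) + -(poch w Q n * Q ^ n * (z - w)) by ring]
    refine (IsUltrametricDist.norm_add_le_max _ _).trans ?_
    rw [norm_neg, norm_mul, norm_mul, norm_mul, norm_pow]
    refine max_le ?_ ?_
    · exact (mul_le_of_le_one_right (norm_nonneg _) (hone z hz n)).trans ih
    · exact mul_le_of_le_one_left (norm_nonneg _)
        (mul_le_one₀ (hp n) (by positivity) (pow_le_one₀ (norm_nonneg _) hQ1.le))

theorem norm_eulerProd_sub_le {Q : K} (hQ1 : ‖Q‖ < 1) {z w : K} (hz : ‖z‖ ≤ 1) (hw : ‖w‖ ≤ 1) :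
    ‖eulerProd z Q - eulerProd w Q‖ ≤ ‖z - w‖ :=
  le_of_tendsto ((tendsto_poch hQ1 z).sub (tendsto_poch hQ1 w)).norm
    (Eventually.of_forall fun n => norm_poch_sub_le hQ1 hz hw n)

end TripleProduct

/-! ### The Laurent expansion of a theta function divided by its linear factor. -/

section Kernel

variable {K : Type*} [NormedField K]

/-- The Laurent coefficients of `θ(y) / (1 + y)`. -/
noncomputable def kernelCoeff (Q : K) (i : ℤ) : K := Q ^ tri (i + 1) * partialTheta Q i

/-- The Laurent series of `θ(y) / (1 + y)`. -/
noncomputable def kernel (Q y : K) : K := ∑' i : ℤ, kernelCoeff Q i * y ^ i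

variable [IsUltrametricDist K] [CompleteSpace K]

/-- The recurrence of the partial theta function is exactly the coefficientwise form of multiplying
the kernel by `1 + y`. -/
theorem kernelCoeff_add {Q : K} (hQ0 : Q ≠ 0) (hQ1 : ‖Q‖ < 1) (i : ℤ) :
    kernelCoeff Q i + kernelCoeff Q (i - 1) = Q ^ tri i := by
  rw [kernelCoeff, kernelCoeff, partialTheta_step hQ0 hQ1 (i - 1), tri_add_one, zpow_add₀ hQ0,
    sub_add_cancel]
  ring

theorem norm_kernelCoeff_le {Q : K} (hQ1 : ‖Q‖ < 1) (i : ℤ) :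
    ‖kernelCoeff Q i‖ ≤ ‖Q‖ ^ tri (i + 1) := by
  rw [kernelCoeff, norm_mul, norm_zpow]
  exact mul_le_of_le_one_right (by positivity) (norm_partialTheta_le hQ1 i)

theorem summable_kernel {Q y : K} (hQ0 : Q ≠ 0) (hQ1 : ‖Q‖ < 1) (hy : y ≠ 0) :
    Summable fun i : ℤ => kernelCoeff Q i * y ^ i := by
  obtain ⟨B, hB0, hB⟩ := exists_norm_zpow_le hQ0 hQ1 hy
  have hr0 : 0 < ‖Q‖ := norm_pos_iff.mpr hQ0
  refine summable_of_norm_le_zpow hr0 hQ1 1 (fun i => tri (i + 1) - B * |i|)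
    (tendsto_cofinite_atTop_of_abs_le ((B + 3) ^ 2) fun n => ?_) fun i => ?_
  · have h1 := mul_abs_le_tri (B + 2) n
    rw [tri_add_one]
    have h2 := neg_abs_le n
    linarith
  · rw [norm_mul, one_mul, sub_eq_add_neg, zpow_add₀ hr0.ne']
    gcongr
    · exact norm_kernelCoeff_le hQ1 i
    · exact hB i

theorem one_add_mul_kernel {Q y : K} (hQ0 : Q ≠ 0) (hQ1 : ‖Q‖ < 1) (hy : y ≠ 0) :
    (1 + y) * kernel Q y = theta Q y := by
  have hs := summable_kernel hQ0 hQ1 hy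
  have hs' : Summable fun i : ℤ => kernelCoeff Q (i - 1) * y ^ i := by
    have := ((Equiv.subRight (1 : ℤ)).summable_iff.mpr hs).mul_right y
    refine this.congr fun i => ?_
    simp only [Function.comp, Equiv.subRight_apply]
    rw [zpow_sub_one₀ hy]; field_simp
  have h1 : y * kernel Q y = ∑' i : ℤ, kernelCoeff Q (i - 1) * y ^ i := by
    rw [kernel, ← tsum_mul_left, ← (Equiv.subRight (1 : ℤ)).tsum_eq]
    refine tsum_congr fun i => ?_
    rw [Equiv.subRight_apply, zpow_sub_one₀ hy]; field_simp
  rw [add_mul, one_mul, h1, kernel, ← hs.tsum_add hs', theta]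
  refine tsum_congr fun i => ?_
  rw [← add_mul, kernelCoeff_add hQ0 hQ1]

/-- At `y = -1` the quotient is `0 / 0`. The triple product evaluates it at nearby points, where the
factor `1 + y` cancels, and continuity of both sides gives the limit. -/
theorem kernel_neg_one {Q : K} (hQ0 : Q ≠ 0) (hQ1 : ‖Q‖ < 1) :
    kernel Q (-1) = eulerProd Q Q ^ 3 := by
  have hQN : Tendsto (fun N : ℕ => Q ^ (N + 1)) atTop (𝓝 0) :=
    (tendsto_add_atTop_iff_nat 1).mpr (tendsto_pow_atTop_nhds_zero_of_norm_lt_one hQ1)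
  have hlt : ∀ N : ℕ, ‖Q ^ (N + 1)‖ < 1 := fun N => by
    rw [norm_pow]; exact pow_lt_one₀ (norm_nonneg _) hQ1 (by omega)
  -- These points tend to `-1`, never equal it, and all have norm one, which gives a bound on the
  -- kernel terms independent of `N`.
  let y : ℕ → K := fun N => -(1 + Q ^ (N + 1))
  have hy : ∀ N, ‖y N‖ = 1 := fun N => by
    rw [norm_neg]; exact norm_one_add_of_norm_lt (hlt N)
  have hy0 : ∀ N, y N ≠ 0 := fun N => norm_ne_zero_iff.mp (by rw [hy]; exact one_ne_zero)
  have hyt : Tendsto y atTop (𝓝 (-1)) := by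
    have := ((tendsto_const_nhds (x := (1 : K))).add hQN).neg
    rw [add_zero] at this
    exact this
  have t1 : Tendsto (fun N => kernel Q (y N)) atTop (𝓝 (kernel Q (-1))) := by
    have h0 := (summable_kernel hQ0 hQ1 (neg_ne_zero.mpr (one_ne_zero (α := K)))).tendsto_cofinite_zero.norm
    rw [norm_zero] at h0
    refine tendsto_tsum_of_norm_le h0 (fun N i => ?_) fun i => ?_
    · rw [norm_mul, norm_mul, norm_zpow, norm_zpow, hy, norm_neg, norm_one]
    · exact ((continuousAt_zpow₀ (-1 : K) i (Or.inl (by norm_num))).tendsto.comp hyt).const_mul _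
  have hk : ∀ N, kernel Q (y N) =
      eulerProd (-y N * Q) Q * eulerProd (-(Q / y N)) Q * eulerProd Q Q := by
    intro N
    have h1 := one_add_mul_kernel hQ0 hQ1 (hy0 N)
    rw [theta_eq_eulerProd hQ0 hQ1 (hy0 N), eulerProd_eq_mul hQ1, sub_neg_eq_add] at h1
    have h2 : 1 + y N ≠ 0 := by
      simp only [y]
      rw [show 1 + -(1 + Q ^ (N + 1)) = -Q ^ (N + 1) by ring]
      exact neg_ne_zero.mpr (pow_ne_zero _ hQ0)
    apply mul_left_cancel₀ h2
    rw [h1]; ring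
  have hE : ∀ u : ℕ → K, (∀ N, ‖u N‖ ≤ 1) → Tendsto u atTop (𝓝 Q) →
      Tendsto (fun N => eulerProd (u N) Q) atTop (𝓝 (eulerProd Q Q)) := by
    intro u hu ht
    rw [tendsto_iff_norm_sub_tendsto_zero] at ht ⊢
    exact squeeze_zero (fun _ => norm_nonneg _)
      (fun N => norm_eulerProd_sub_le hQ1 (hu N) hQ1.le) ht
  have t2 : Tendsto (fun N => eulerProd (-y N * Q) Q) atTop (𝓝 (eulerProd Q Q)) := by
    refine hE _ (fun N => ?_) ?_
    · rw [norm_mul, norm_neg, hy, one_mul]; exact hQ1.le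
    · simpa using (hyt.neg.mul_const Q)
  have t3 : Tendsto (fun N => eulerProd (-(Q / y N)) Q) atTop (𝓝 (eulerProd Q Q)) := by
    refine hE _ (fun N => ?_) ?_
    · rw [norm_neg, norm_div, hy, div_one]; exact hQ1.le
    · have := ((tendsto_const_nhds (x := Q)).div hyt (by norm_num)).neg
      rw [div_neg, div_one, neg_neg] at this
      exact this
  have t4 := (t2.mul t3).mul_const (eulerProd Q Q)
  rw [← pow_two, ← pow_succ] at t4
  exact tendsto_nhds_unique t1 (t4.congr fun N => (hk N).symm)

end Kernel

end MockTheta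

namespace MockTheta
open Filter Topology

theorem sum_Icc_neg_succ {M : Type*} [AddCommMonoid M] (f : ℤ → M) (N : ℕ) :
    ∑ j ∈ Finset.Icc (-((N + 1 : ℕ) : ℤ)) ((N + 1 : ℕ) : ℤ), f j =
      ∑ j ∈ Finset.Icc (-(N : ℤ)) N, f j + (f (N + 1) + f (-(N + 1))) := by
  have h1 : Finset.Icc (-((N + 1 : ℕ) : ℤ)) ((N + 1 : ℕ) : ℤ) =
      insert (-((N : ℤ) + 1)) (insert ((N : ℤ) + 1) (Finset.Icc (-(N : ℤ)) N)) := by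
    ext j; simp only [Finset.mem_Icc, Finset.mem_insert]; omega
  rw [h1, Finset.sum_insert, Finset.sum_insert]
  · rw [add_comm (f _), add_comm (f _), add_assoc]
  · simp
  · simp only [Finset.mem_Icc, Finset.mem_insert]; omega

/-! ### Finite hypergeometric identities. -/

section FiniteIdentities

/-- The q-Chu-Vandermonde sum with denominators cleared. Pascal's rule reduces the case `m + 1` to
the case `m` at both `b` and `b * p`, so `b` has to vary in the induction. -/
theorem sum_gaussBinom_mul_poch {R : Type*} [CommRing R] (p b d : R) (m : ℕ) :
    ∑ i ∈ Finset.range (m + 1), gaussBinom p m i *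
      (poch b p i * poch (b * d * p ^ i) p (m - i) * (-d) ^ i * p ^ i.choose 2) = poch d p m := by
  induction m generalizing b with
  | zero => simp
  | succ m ih =>
    rw [sum_gaussBinom_succ]
    have h1 : ∑ i ∈ Finset.range (m + 1), gaussBinom p m i * (poch b p i *
        poch (b * d * p ^ i) p (m + 1 - i) * (-d) ^ i * p ^ i.choose 2) =
        poch d p m * (1 - b * d * p ^ m) := by
      rw [← ih b, Finset.sum_mul]
      refine Finset.sum_congr rfl fun i hi => ?_
      obtain ⟨k, rfl⟩ := Nat.exists_eq_add_of_le (Nat.lt_succ_iff.mp (Finset.mem_range.mp hi))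
      rw [show i + k + 1 - i = k + 1 by omega, Nat.add_sub_cancel_left, poch_succ]
      ring
    have h2 : ∑ i ∈ Finset.range (m + 1), p ^ (m - i) * gaussBinom p m i * (poch b p (i + 1) *
        poch (b * d * p ^ (i + 1)) p (m + 1 - (i + 1)) * (-d) ^ (i + 1) * p ^ (i + 1).choose 2) =
        poch d p m * (p ^ m * (-d) * (1 - b)) := by
      rw [← ih (b * p), Finset.sum_mul]
      refine Finset.sum_congr rfl fun i hi => ?_
      obtain ⟨k, rfl⟩ := Nat.exists_eq_add_of_le (Nat.lt_succ_iff.mp (Finset.mem_range.mp hi))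
      rw [show i + k + 1 - (i + 1) = k by omega, Nat.add_sub_cancel_left, poch_succ',
        choose_succ_two, show b * d * p ^ (i + 1) = b * p * d * p ^ i by ring]
      ring
    rw [h1, h2, poch_succ]
    ring

/-- The right side has simple poles in `x` and this is its partial fraction expansion. The induction
combines the instances at `x` and `x * p`. -/
theorem sum_gaussBinom_div {F : Type*} [Field F] (p : F) (n : ℕ) (x : F)
    (hx : ∀ k : ℕ, 1 - x * p ^ k ≠ 0) :
    ∑ k ∈ Finset.range (n + 1), gaussBinom p n k *
      ((-1) ^ k * p ^ (k + 1).choose 2 / (1 - x * p ^ k)) = poch p p n / poch x p (n + 1) := by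
  induction n generalizing x with
  | zero => simp [poch_succ]
  | succ n ih =>
    have hx' : ∀ k : ℕ, 1 - x * p * p ^ k ≠ 0 := fun k => by
      have := hx (k + 1); rwa [pow_succ', ← mul_assoc] at this
    have hne : ∀ m, poch x p m ≠ 0 := fun m => Finset.prod_ne_zero_iff.mpr fun k _ => hx k
    have hne' : ∀ m, poch (x * p) p m ≠ 0 := fun m => Finset.prod_ne_zero_iff.mpr fun k _ => hx' k
    rw [sum_gaussBinom_succ, ih x hx]
    have h2 : ∑ k ∈ Finset.range (n + 1), p ^ (n - k) * gaussBinom p n k *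
        ((-1) ^ (k + 1) * p ^ (k + 1 + 1).choose 2 / (1 - x * p ^ (k + 1))) =
        -p ^ (n + 1) * (poch p p n / poch (x * p) p (n + 1)) := by
      rw [← ih (x * p) hx', Finset.mul_sum]
      refine Finset.sum_congr rfl fun k hk => ?_
      obtain ⟨b, rfl⟩ := Nat.exists_eq_add_of_le (Nat.lt_succ_iff.mp (Finset.mem_range.mp hk))
      rw [choose_succ_two (k + 1), Nat.add_sub_cancel_left,
        show 1 - x * p ^ (k + 1) = 1 - x * p * p ^ k by ring]
      ring
    rw [h2, poch_succ' x p (n + 1), poch_self_succ]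
    have h3 : poch x p (n + 1) * (1 - x * p ^ (n + 1)) = (1 - x) * poch (x * p) p (n + 1) := by
      rw [← poch_succ, poch_succ']
    have h4 : 1 - x ≠ 0 := by simpa using hx 0
    have h5 := hne (n + 1)
    have h6 := hne' (n + 1)
    have h7 : 1 / poch x p (n + 1) = (1 - x * p ^ (n + 1)) / ((1 - x) * poch (x * p) p (n + 1)) := by
      rw [← h3]; field_simp [hx (n + 1)]
    rw [div_eq_mul_one_div, h7]
    field_simp
    ring

end FiniteIdentities

/-! ### Bailey pairs for the reciprocal denominators of `λ` and `ψ`. -/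

section BaileyPairs

variable {K : Type*} [NormedField K] [IsUltrametricDist K] [CompleteSpace K]

theorem gaussBinom_mul_one_sub {p : K} (hp : ‖p‖ < 1) (i b : ℕ) :
    gaussBinom p (i + b + 1) i * (1 - p ^ (b + 1)) =
      gaussBinom p (i + b) i * (1 - p ^ (i + b + 1)) := by
  have h1 := gaussBinom_mul_poch p i (b + 1)
  have h2 := gaussBinom_mul_poch p i b
  rw [← add_assoc, poch_self_succ, poch_self_succ, ← h2] at h1
  have h3 := poch_ne_zero hp hp i
  have h4 := poch_ne_zero hp hp b
  apply mul_right_cancel₀ (mul_ne_zero h3 h4)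
  linear_combination h1

/-- Gauss's evaluation. One application of Pascal's rule weights level `2n + 1` by `1 - p^(2n+1-i)`;
absorbing this weight into the binomial brings out the constant factor `1 - p^(2n+1)` and leaves
level `2n`. -/
theorem sum_neg_one_pow_mul_gaussBinom {p : K} (hp : ‖p‖ < 1) (n : ℕ) :
    ∑ i ∈ Finset.range (2 * n + 1), (-1) ^ i * gaussBinom p (2 * n) i = poch p (p ^ 2) n := by
  induction n with
  | zero => simp
  | succ n ih =>
    have h1 : ∑ i ∈ Finset.range (2 * n + 1 + 2),
        gaussBinom p (2 * n + 1 + 1) i * (-1) ^ i =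
        ∑ i ∈ Finset.range (2 * n + 2), gaussBinom p (2 * n + 1) i * (-1) ^ i *
          (1 - p ^ (2 * n + 1 - i)) := by
      rw [sum_gaussBinom_succ p (2 * n + 1), ← Finset.sum_add_distrib]
      refine Finset.sum_congr rfl fun i _ => ?_
      ring
    rw [show 2 * (n + 1) + 1 = 2 * n + 1 + 2 by ring, show 2 * (n + 1) = 2 * n + 1 + 1 by ring]
    simp_rw [mul_comm ((-1 : K) ^ _)]
    rw [h1, Finset.sum_range_succ, Nat.sub_self, pow_zero, sub_self, mul_zero, add_zero, poch_succ,
      ← ih, Finset.sum_mul]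
    refine Finset.sum_congr rfl fun i hi => ?_
    obtain ⟨b, hb⟩ := Nat.exists_eq_add_of_le (Nat.lt_succ_iff.mp (Finset.mem_range.mp hi))
    have h2 := gaussBinom_mul_one_sub hp i b
    rw [hb, show i + b + 1 - i = b + 1 by omega,
      show p * (p ^ 2) ^ n = p ^ (i + b + 1) by rw [← hb]; ring]
    linear_combination (-1) ^ i * h2

theorem poch_self_mul_poch_neg {R : Type*} [CommRing R] (p : R) (n : ℕ) :
    poch p p n * poch (-p) p n = poch (p ^ 2) (p ^ 2) n := by
  rw [poch, poch, poch, ← Finset.prod_mul_distrib]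
  exact Finset.prod_congr rfl fun k _ => by ring

theorem poch_two_mul {R : Type*} [CommRing R] (a p : R) (n : ℕ) :
    poch a p (2 * n) = poch a (p ^ 2) n * poch (a * p) (p ^ 2) n := by
  induction n with
  | zero => simp
  | succ n ih =>
    rw [show 2 * (n + 1) = 2 * n + 1 + 1 by ring, poch_succ, poch_succ, ih, poch_succ, poch_succ]
    ring

/-- The inner sum of Bailey's lemma relative to `a = p`, with one parameter equal to `-p` and the
other sent to infinity. It is q-Chu-Vandermonde with `b = d = -p^(r+1)`. -/
theorem sum_bailey_step {p : K} (hp : ‖p‖ < 1) (r m : ℕ) :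
    ∑ i ∈ Finset.range (m + 1), poch (-p) p (r + i) * p ^ (r + i + 1).choose 2 /
      (poch p p (m - i) * poch p p i * poch p p (2 * r + 1 + i)) =
    poch (-p) p (r + m) * p ^ (r + 1).choose 2 / (poch p p m * poch p p (2 * r + 1 + m)) := by
  have hne : ∀ n, poch p p n ≠ 0 := poch_ne_zero hp hp
  have h := sum_gaussBinom_mul_poch p (-p ^ (r + 1)) (-p ^ (r + 1)) m
  rw [poch_add (-p) p r m, show -p * p ^ r = -p ^ (r + 1) by ring, ← h, mul_right_comm,
    Finset.mul_sum, Finset.sum_div]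
  refine Finset.sum_congr rfl fun i hi => ?_
  obtain ⟨b, rfl⟩ := Nat.exists_eq_add_of_le (Nat.lt_succ_iff.mp (Finset.mem_range.mp hi))
  have h1 := gaussBinom_mul_poch p i b
  have h2 := poch_add p p (2 * r + 1 + i) b
  have h3 : p ^ (r + i + 1).choose 2 =
      p ^ (r + 1).choose 2 * p ^ i.choose 2 * (p ^ (r + 1)) ^ i := by
    rw [← pow_mul, ← pow_add, ← pow_add]
    congr 1
    zify
    rw [← tri_natCast, ← tri_natCast, ← tri_natCast]
    push_cast
    rw [show (r : ℤ) + i + 1 = (r + 1) + i by ring, tri_add]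
  have h4 := hne (i + b)
  rw [← h1, poch_add (-p) p r i, show -p * p ^ r = -p ^ (r + 1) by ring, Nat.add_sub_cancel_left, h3,
    ← add_assoc (2 * r + 1) i b, h2, neg_neg,
    show -p ^ (r + 1) * -p ^ (r + 1) * p ^ i = p * p ^ (2 * r + 1 + i) by ring]
  have h5 : gaussBinom p (i + b) i ≠ 0 := fun h0 => h4 (by rw [← h1, h0]; ring)
  have h6 : poch (p * p ^ (2 * r + 1 + i)) p b ≠ 0 := fun h0 =>
    hne (2 * r + 1 + i + b) (by rw [h2, h0]; ring)
  field_simp [hne i, hne b, hne (2 * r + 1 + i)]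

/-- One step along the Bailey chain. -/
theorem bailey_pair {p x : K} (hp : ‖p‖ < 1) (hx : ∀ k : ℕ, 1 - x * p ^ k ≠ 0) {a : ℕ → K}
    (ha : ∀ k, ∑ r ∈ Finset.range (k + 1), a r / (poch p p (k - r) * poch p p (k + r + 1)) =
      (-1) ^ k / ((1 - x * p ^ k) * (poch p p k * poch (-p) p k))) (n : ℕ) :
    ∑ r ∈ Finset.range (n + 1), p ^ (r + 1).choose 2 * a r /
      (poch p p (n - r) * poch p p (n + r + 1)) = 1 / (poch (-p) p n * poch x p (n + 1)) := by
  have hne : ∀ n, poch p p n ≠ 0 := poch_ne_zero hp hp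
  have hne' : ∀ n, poch (-p) p n ≠ 0 := poch_ne_zero hp (by rwa [norm_neg])
  -- Each weight is expanded by the inner Bailey sum and the order of summation reversed. The
  -- hypothesis on `a` then evaluates the sum over `r`, and the partial fraction expansion the sum
  -- over `k`.
  have h1 : poch (-p) p n * ∑ r ∈ Finset.range (n + 1), p ^ (r + 1).choose 2 * a r /
      (poch p p (n - r) * poch p p (n + r + 1)) =
      ∑ r ∈ Finset.range (n + 1), ∑ k ∈ Finset.Ico r (n + 1), a r *
        (poch (-p) p k * p ^ (k + 1).choose 2 /
        (poch p p (n - k) * poch p p (k - r) * poch p p (k + r + 1))) := by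
    rw [Finset.mul_sum]
    refine Finset.sum_congr rfl fun r hr => ?_
    obtain ⟨m, rfl⟩ := Nat.exists_eq_add_of_le (Nat.lt_succ_iff.mp (Finset.mem_range.mp hr))
    have h2 := sum_bailey_step hp r m
    rw [← Finset.mul_sum, Finset.sum_Ico_eq_sum_range, show r + m + 1 - r = m + 1 by omega]
    rw [show r + m - r = m by omega, show r + m + r + 1 = 2 * r + 1 + m by ring]
    rw [Finset.sum_congr rfl fun i hi => by
      rw [show r + m - (r + i) = m - i by omega, show r + i - r = i by omega,
        show r + i + r + 1 = 2 * r + 1 + i by ring], h2]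
    ring
  have h3 : ∑ r ∈ Finset.range (n + 1), ∑ k ∈ Finset.Ico r (n + 1), a r *
        (poch (-p) p k * p ^ (k + 1).choose 2 /
        (poch p p (n - k) * poch p p (k - r) * poch p p (k + r + 1))) =
      ∑ k ∈ Finset.range (n + 1), poch (-p) p k * p ^ (k + 1).choose 2 / poch p p (n - k) *
        ∑ r ∈ Finset.range (k + 1), a r / (poch p p (k - r) * poch p p (k + r + 1)) := by
    rw [Finset.sum_comm' (t' := Finset.range (n + 1)) (s' := fun k => Finset.range (k + 1))
      (fun r k => by simp only [Finset.mem_range, Finset.mem_Ico]; omega)]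
    refine Finset.sum_congr rfl fun k _ => ?_
    rw [Finset.mul_sum]
    refine Finset.sum_congr rfl fun r _ => ?_
    field_simp [hne (n - k), hne (k - r), hne (k + r + 1)]
  have h4 : ∑ k ∈ Finset.range (n + 1), poch (-p) p k * p ^ (k + 1).choose 2 / poch p p (n - k) *
        ∑ r ∈ Finset.range (k + 1), a r / (poch p p (k - r) * poch p p (k + r + 1)) =
      1 / poch x p (n + 1) := by
    have h5 := sum_gaussBinom_div p n x hx
    have hxn : poch x p (n + 1) ≠ 0 := Finset.prod_ne_zero_iff.mpr fun k _ => hx k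
    have h6 : ∑ k ∈ Finset.range (n + 1), poch (-p) p k * p ^ (k + 1).choose 2 / poch p p (n - k) *
        ∑ r ∈ Finset.range (k + 1), a r / (poch p p (k - r) * poch p p (k + r + 1)) =
        (∑ k ∈ Finset.range (n + 1), gaussBinom p n k *
      ((-1) ^ k * p ^ (k + 1).choose 2 / (1 - x * p ^ k))) / poch p p n := by
      rw [Finset.sum_div]
      refine Finset.sum_congr rfl fun k hk => ?_
      obtain ⟨b, rfl⟩ := Nat.exists_eq_add_of_le (Nat.lt_succ_iff.mp (Finset.mem_range.mp hk))
      have h7 := gaussBinom_mul_poch p k b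
      have h8 : gaussBinom p (k + b) k ≠ 0 := fun h0 => hne (k + b) (by rw [← h7, h0]; ring)
      rw [ha, ← h7, Nat.add_sub_cancel_left]
      field_simp [hne b, hne k, hne' k, hx k]
    rw [h6, h5]
    field_simp [hne n]
  rw [h3, h4] at h1
  rw [← one_div_mul_one_div, ← h1, ← mul_assoc, one_div_mul_cancel (hne' n), one_mul]

/-- The finite alternating sum `∑_{|j| ≤ r} (-1)^j q^{-j²}`. -/
noncomputable def signedSum (q : K) (r : ℕ) : K :=
  ∑ j ∈ Finset.Icc (-(r : ℤ)) r, (-1) ^ j * q ^ (-(j ^ 2))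

theorem signedSum_succ (q : K) (r : ℕ) :
    signedSum q (r + 1) = signedSum q r + 2 * (-1) ^ (r + 1) * (q ^ (r + 1) ^ 2)⁻¹ := by
  rw [signedSum, sum_Icc_neg_succ, signedSum, neg_sq, zpow_neg (-1 : K)]
  have h1 : (-1 : K) ^ ((r : ℤ) + 1) = (-1) ^ (r + 1) := by
      rw [← Nat.cast_succ, zpow_natCast]
  have h2 : q ^ (-((r : ℤ) + 1) ^ 2) = (q ^ (r + 1) ^ 2)⁻¹ := by
    rw [zpow_neg]; exact_mod_cast congrArg _ (zpow_natCast q ((r + 1) ^ 2))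
  have h3 : ((-1 : K) ^ (r + 1))⁻¹ = (-1) ^ (r + 1) := by
    rw [← inv_pow]; norm_num
  rw [h1, h2, h3]; ring

theorem gaussBinom_symm {p : K} (hp : ‖p‖ < 1) (i b : ℕ) :
    gaussBinom p (i + b) i = gaussBinom p (i + b) b := by
  have h1 := gaussBinom_mul_poch p i b
  have h2 := gaussBinom_mul_poch p b i
  rw [add_comm b i, ← h1] at h2
  apply mul_right_cancel₀ (mul_ne_zero (poch_ne_zero hp hp i) (poch_ne_zero hp hp b))
  linear_combination -h2

/-- Abel summation. Passing from `r` to `r + 1` adds the terms `j = ±(r + 1)` to `signedSum`, and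
their power of `q` cancels the weight `q^((r+1)²)`. An alternating sum of binomials free of `q`
remains; the boundary term at `N` makes the induction close. -/
theorem sum_sub_mul_signedSum {p q : K} (hp : ‖p‖ < 1) (hq : q ≠ 0) (n N : ℕ) (hN : N ≤ n) :
    ∑ r ∈ Finset.range N, (q ^ r ^ 2 * gaussBinom p (2 * n) (n + r) -
        q ^ (r + 1) ^ 2 * gaussBinom p (2 * n) (n + r + 1)) * signedSum q r +
      q ^ N ^ 2 * gaussBinom p (2 * n) (n + N) * signedSum q N =
      ∑ j ∈ Finset.Icc (-(N : ℤ)) N, (-1) ^ j * gaussBinom p (2 * n) (n + j).toNat := by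
  induction N with
  | zero => simp [signedSum]
  | succ N ih =>
    rw [sum_Icc_neg_succ, ← ih (by omega), Finset.sum_range_succ, signedSum_succ,
      zpow_neg (-1 : K)]
    have h1 : (-1 : K) ^ ((N : ℤ) + 1) = (-1) ^ (N + 1) := by
      rw [← Nat.cast_succ, zpow_natCast]
    have h3 : ((-1 : K) ^ (N + 1))⁻¹ = (-1) ^ (N + 1) := by
      rw [← inv_pow]; norm_num
    obtain ⟨b, rfl⟩ := Nat.exists_eq_add_of_le hN
    have h4 : gaussBinom p (2 * (N + 1 + b)) b =
        gaussBinom p (2 * (N + 1 + b)) (N + 1 + b + N + 1) := by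
      rw [show 2 * (N + 1 + b) = b + (N + 1 + b + N + 1) by ring]; exact gaussBinom_symm hp _ _
    rw [h1, h3, show ((N + 1 + b : ℕ) + ((N : ℤ) + 1)).toNat = N + 1 + b + N + 1 by omega,
      show ((N + 1 + b : ℕ) + -((N : ℤ) + 1)).toNat = b by omega, h4, ← add_assoc (N + 1 + b) N 1]
    field_simp
    ring

theorem sum_sub_mul_signedSum_eq {p q : K} (hp : ‖p‖ < 1) (hq : q ≠ 0) (n : ℕ) :
    ∑ r ∈ Finset.range (n + 1), (q ^ r ^ 2 * gaussBinom p (2 * n) (n + r) -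
        q ^ (r + 1) ^ 2 * gaussBinom p (2 * n) (n + r + 1)) * signedSum q r =
      (-1) ^ n * poch p (p ^ 2) n := by
  have h1 := sum_sub_mul_signedSum hp hq n n le_rfl
  rw [Finset.sum_range_succ, gaussBinom_eq_zero p (show 2 * n < n + n + 1 by omega), mul_zero,
    sub_zero, h1, ← sum_neg_one_pow_mul_gaussBinom hp, Finset.mul_sum]
  refine Finset.sum_nbij' (fun j => (n + j).toNat) (fun i => (i : ℤ) - n) ?_ ?_ ?_ ?_ ?_
  · intro j hj; rw [Finset.mem_Icc] at hj; rw [Finset.mem_range]; omega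
  · intro i hi; rw [Finset.mem_range] at hi; rw [Finset.mem_Icc]; omega
  · intro j hj; rw [Finset.mem_Icc] at hj; omega
  · intro i hi; omega
  · intro j hj
    rw [Finset.mem_Icc] at hj
    have h2 : (-1 : K) ^ j = (-1) ^ n * (-1) ^ ((n : ℤ) + j).toNat := by
      have h3 : (-1 : K) ^ ((n : ℤ) + j).toNat = (-1) ^ n * (-1) ^ j := by
        rw [← zpow_natCast, Int.toNat_of_nonneg (by omega), zpow_add₀ (by norm_num), zpow_natCast]
      rw [h3, ← mul_assoc, ← mul_pow]; norm_num
    rw [h2]; ring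

/-- Summation by parts; `c` records how the base `p` relates to `q`. -/
theorem sum_signedSum_div {p q : K} (hp : ‖p‖ < 1) (hq : q ≠ 0) (c : ℕ → K) (hc : ∀ k, c k ≠ 0)
    (h : ∀ r s, 1 - p ^ (2 * r + s + 1) - q ^ (2 * r + 1) * (1 - p ^ s) =
      (1 - q ^ (2 * r + 1)) * c (r + s)) (k : ℕ) :
    ∑ r ∈ Finset.range (k + 1), q ^ r ^ 2 * (1 - q ^ (2 * r + 1)) * signedSum q r /
      (poch p p (k - r) * poch p p (k + r + 1)) =
      (-1) ^ k / (c k * (poch p p k * poch (-p) p k)) := by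
  have hne : ∀ n, poch p p n ≠ 0 := poch_ne_zero hp hp
  have hne' : ∀ n, poch (-p) p n ≠ 0 := poch_ne_zero hp (by rwa [norm_neg])
  -- The summand is a difference of two neighbouring weighted binomials. After clearing denominators
  -- the claim is hypothesis `h` at `s = k - r`.
  have h1 : ∀ r ∈ Finset.range (k + 1), q ^ r ^ 2 * (1 - q ^ (2 * r + 1)) * signedSum q r /
      (poch p p (k - r) * poch p p (k + r + 1)) =
      (q ^ r ^ 2 * gaussBinom p (2 * k) (k + r) -
        q ^ (r + 1) ^ 2 * gaussBinom p (2 * k) (k + r + 1)) * signedSum q r /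
        (c k * poch p p (2 * k)) := by
    intro r hr
    obtain ⟨s, rfl⟩ := Nat.exists_eq_add_of_le (Nat.lt_succ_iff.mp (Finset.mem_range.mp hr))
    have e1 : gaussBinom p (2 * (r + s)) (r + s + r) =
        poch p p (2 * (r + s)) / (poch p p (2 * r + s) * poch p p s) := by
      rw [eq_div_iff (mul_ne_zero (hne _) (hne _)), ← mul_assoc,
        show 2 * (r + s) = 2 * r + s + s by ring, show r + s + r = 2 * r + s by ring,
        gaussBinom_mul_poch]
    have e2 : gaussBinom p (2 * (r + s)) (r + s + r + 1) =
        poch p p (2 * (r + s)) * (1 - p ^ s) / (poch p p (2 * r + s + 1) * poch p p s) := by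
      rw [eq_div_iff (mul_ne_zero (hne _) (hne _)), ← mul_assoc, show r + s + r + 1 = 2 * r + s + 1 by ring]
      cases s with
      | zero => rw [gaussBinom_eq_zero p (by omega)]; simp
      | succ s =>
        rw [show 2 * (r + (s + 1)) = 2 * r + (s + 1) + 1 + s by ring, poch_self_succ p s,
          ← gaussBinom_mul_poch p (2 * r + (s + 1) + 1) s]
        ring
    have e3 := h r s
    have e4 : 1 - p ^ (2 * r + s + 1) ≠ 0 := fun h0 => hne (2 * r + s + 1) (by
      rw [poch_self_succ, h0, mul_zero])
    rw [e1, e2, show r + s - r = s by omega, show r + s + r + 1 = 2 * r + s + 1 by ring,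
      poch_self_succ p (2 * r + s)]
    have h5 := hne (2 * r + s); have h6 := hne s; have h7 := hne (2 * (r + s)); have h8 := hc (r + s)
    field_simp
    linear_combination (-signedSum q r * q ^ r ^ 2) * e3
  rw [Finset.sum_congr rfl h1, ← Finset.sum_div, sum_sub_mul_signedSum_eq hp hq, poch_two_mul,
    poch_self_mul_poch_neg, ← pow_two]
  have h2 : poch p (p ^ 2) k ≠ 0 := fun h0 => hne (2 * k) (by rw [poch_two_mul, h0, zero_mul])
  have h3 : poch (p ^ 2) (p ^ 2) k ≠ 0 := by
    rw [← poch_self_mul_poch_neg]; exact mul_ne_zero (hne _) (hne' _)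
  have h4 := hc k
  field_simp

/-- Here the base is `q` itself, the correction factor is constantly `1`, and `x = 0` makes the
second product trivial. -/
theorem sum_signedSum_eq_one_div_poch {q : K} (hq : q ≠ 0) (hq1 : ‖q‖ < 1) (n : ℕ) :
    ∑ r ∈ Finset.range (n + 1), q ^ (r + 1).choose 2 *
      (q ^ r ^ 2 * (1 - q ^ (2 * r + 1)) * signedSum q r) /
      (poch q q (n - r) * poch q q (n + r + 1)) = 1 / poch (-q) q n := by
  have h1 := bailey_pair (x := 0) hq1 (fun k => by simp)
    (a := fun r => q ^ r ^ 2 * (1 - q ^ (2 * r + 1)) * signedSum q r) (fun k => by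
      rw [sum_signedSum_div hq1 hq (fun _ => 1) (fun _ => one_ne_zero) (fun r s => by ring) k]
      simp) n
  rw [h1]; simp [poch]

/-- The same pair to the base `q²`, where the correction factor is `1 + q^(2k+1)`. Thus `x = -q`,
and the even and odd halves of `(-q; q)_{2n+1}` come together. -/
theorem sum_signedSum_eq_one_div_poch_sq {q : K} (hq : q ≠ 0) (hq1 : ‖q‖ < 1) (n : ℕ) :
    ∑ r ∈ Finset.range (n + 1), (q ^ 2) ^ (r + 1).choose 2 *
      (q ^ r ^ 2 * (1 - q ^ (2 * r + 1)) * signedSum q r) /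
      (poch (q ^ 2) (q ^ 2) (n - r) * poch (q ^ 2) (q ^ 2) (n + r + 1)) =
      1 / poch (-q) q (2 * n + 1) := by
  have hp : ‖q ^ 2‖ < 1 := by rw [norm_pow]; exact pow_lt_one₀ (norm_nonneg _) hq1 two_ne_zero
  have hx : ∀ k : ℕ, 1 - -q * (q ^ 2) ^ k ≠ 0 := fun k => by
    rw [neg_mul, sub_neg_eq_add, ← norm_ne_zero_iff, norm_one_add_of_norm_lt]
    · exact one_ne_zero
    · rw [← pow_mul, ← pow_succ', norm_pow]; exact pow_lt_one₀ (norm_nonneg _) hq1 (by omega)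
  have h1 := bailey_pair (x := -q) hp hx
    (a := fun r => q ^ r ^ 2 * (1 - q ^ (2 * r + 1)) * signedSum q r) (fun k => by
      rw [sum_signedSum_div hp hq (fun k => 1 - -q * (q ^ 2) ^ k) hx (fun r s => by ring) k]) n
  rw [h1, poch_succ, poch_succ, poch_two_mul (-q)]
  congr 1; ring_nf

end BaileyPairs

end MockTheta

namespace MockTheta
open Filter Topology

/-! ### Infinite summation formulas and the Hecke-type series. -/

section Telescoping

variable {K : Type*} [NormedField K] [IsUltrametricDist K] [CompleteSpace K]

theorem tsum_eq_zero_of_telescope {f g : ℕ → K} (hf : Summable f) (hg : Tendsto g atTop (𝓝 0))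
    (hg0 : g 0 = 0) (h : ∀ s, f s = g (s + 1) - g s) : ∑' s, f s = 0 := by
  have h1 : ∀ n, ∑ s ∈ Finset.range n, f s = g n := fun n => by
    rw [Finset.sum_congr rfl fun s _ => h s, Finset.sum_range_sub, hg0, sub_zero]
  exact tendsto_nhds_unique hf.hasSum.tendsto_sum_nat (hg.congr fun n => (h1 n).symm)

/-- The ratio of two solutions of a first-order recurrence is constant, and both tend to `1`. -/
theorem eq_of_same_recurrence {G P a b : ℕ → K} (hG : ∀ n, a n * G n = b n * G (n + 1))
    (hP : ∀ n, a n * P n = b n * P (n + 1)) (ha : ∀ n, a n ≠ 0) (hP0 : ∀ n, P n ≠ 0)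
    (hGt : Tendsto G atTop (𝓝 1)) (hPt : Tendsto P atTop (𝓝 1)) : G 0 = P 0 := by
  have h1 : ∀ n, G n * P 0 = G 0 * P n := by
    intro n
    induction n with
    | zero => rfl
    | succ n ih =>
      have h2 : G n * P (n + 1) = P n * G (n + 1) := by
        apply mul_left_cancel₀ (ha n)
        linear_combination P (n + 1) * hG n - G (n + 1) * hP n
      apply mul_right_cancel₀ (hP0 n)
      linear_combination P (n + 1) * ih - P 0 * h2
  have h3 := tendsto_nhds_unique (hGt.mul_const (P 0)) ((hPt.const_mul (G 0)).congr fun n => (h1 n).symm)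
  linear_combination -h3

/-- A closed form is proved by letting its argument run through a geometric progression indexed by
`n`. The weighted difference of consecutive terms telescopes with certificate `-c n (1 - q^s) t n
s`, so the sums obey the recurrence of the product, and both tend to `1`. -/
theorem tsum_mul_eq_of_step {t : ℕ → ℕ → K} {a b : ℕ → K} {q : K} (hq : ‖q‖ < 1) {r : ℝ} (hr1 : r < 1)
    (ht0 : ∀ n, t n 0 = 1) (htn : ∀ n s, ‖t n s‖ ≤ r ^ s)
    (htt : ∀ s, Tendsto (fun n => t n s) atTop (𝓝 (if s = 0 then 1 else 0)))
    (c : ℕ → K)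
    (h : ∀ n s, a n * t n s - b n * t (n + 1) s =
      -c n * (1 - q ^ (s + 1)) * t n (s + 1) + c n * (1 - q ^ s) * t n s)
    {P : ℕ → K} (hP : ∀ n, a n * P n = b n * P (n + 1)) (ha : ∀ n, a n ≠ 0) (hP0 : ∀ n, P n ≠ 0)
    (hPt : Tendsto P atTop (𝓝 1)) : ∑' s, t 0 s = P 0 := by
  have hr0 : 0 ≤ r := by simpa using (norm_nonneg _).trans (htn 0 1)
  have hs : ∀ n, Summable (t n) := fun n =>
    Summable.of_norm_bounded (summable_geometric_of_lt_one hr0 hr1) (htn n)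
  have hG : ∀ n, a n * ∑' s, t n s = b n * ∑' s, t (n + 1) s := by
    intro n
    rw [← sub_eq_zero, ← tsum_mul_left, ← tsum_mul_left,
      ← ((hs n).mul_left _).tsum_sub ((hs (n + 1)).mul_left _)]
    refine tsum_eq_zero_of_telescope (g := fun s => -c n * (1 - q ^ s) * t n s)
      (((hs n).mul_left _).sub ((hs (n + 1)).mul_left _)) ?_ (by simp) fun s => ?_
    · have h1 := ((tendsto_const_nhds (x := (1 : K))).sub
        (tendsto_pow_atTop_nhds_zero_of_norm_lt_one hq)).const_mul (-c n)
      have h2 := h1.mul (hs n).tendsto_atTop_zero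
      rwa [mul_zero] at h2
    · rw [h]; ring
  refine eq_of_same_recurrence (G := fun n => ∑' s, t n s) hG hP ha hP0 ?_ hPt
  have h3 := tendsto_tsum_of_norm_le (b := fun s : ℕ => r ^ s) (by
    rw [Nat.cofinite_eq_atTop]; exact tendsto_pow_atTop_nhds_zero_of_lt_one hr0 hr1) htn htt
  rwa [tsum_eq_single 0 (fun s hs => if_neg hs), if_pos rfl] at h3

theorem tendsto_eulerProd_of_tendsto_zero {Q : K} (hQ : ‖Q‖ < 1) {u : ℕ → K} (hu : ∀ n, ‖u n‖ ≤ 1)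
    (ht : Tendsto u atTop (𝓝 0)) : Tendsto (fun n => eulerProd (u n) Q) atTop (𝓝 1) := by
  have h0 : eulerProd 0 Q = 1 := by simp [eulerProd]
  rw [← h0, tendsto_iff_norm_sub_tendsto_zero]
  rw [tendsto_zero_iff_norm_tendsto_zero] at ht
  refine squeeze_zero (fun _ => norm_nonneg _) (fun n => ?_) ht
  simpa using norm_eulerProd_sub_le hQ (hu n) (w := 0) (by simp)

theorem norm_mul_pow_lt_one {q w : K} (hq : ‖q‖ < 1) (hw : ‖w‖ < 1) (n : ℕ) : ‖w * q ^ n‖ < 1 := by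
  rw [norm_mul, norm_pow]
  exact (mul_le_of_le_one_right (norm_nonneg _) (pow_le_one₀ (norm_nonneg _) hq.le)).trans_lt hw

theorem tendsto_mul_pow_zero {q : K} (hq : ‖q‖ < 1) (w : K) :
    Tendsto (fun n : ℕ => w * q ^ n) atTop (𝓝 0) := by
  simpa using (tendsto_pow_atTop_nhds_zero_of_norm_lt_one hq).const_mul w

theorem one_sub_ne_zero_of_norm_lt {x : K} (hx : ‖x‖ < 1) : 1 - x ≠ 0 := by
  rw [← norm_ne_zero_iff, norm_one_sub_of_norm_lt hx]; exact one_ne_zero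

theorem tendsto_poch_one {p : K} {u : ℕ → K} (ht : Tendsto u atTop (𝓝 0)) (s : ℕ) :
    Tendsto (fun n => poch (u n) p s) atTop (𝓝 1) := by
  have h := tendsto_finsetProd (Finset.range s) fun k _ =>
    (tendsto_const_nhds (x := (1 : K))).sub (ht.mul_const (p ^ k))
  simpa [poch] using h

/-- The q-Gauss sum with opposite numerator parameters `±√A`, written so that the square root never
appears. -/
theorem tsum_poch_sq_div {q A w : K} (hq : ‖q‖ < 1) (hA : ‖A‖ < 1) (hw : ‖w‖ < 1) :
    ∑' s : ℕ, poch A (q ^ 2) s * (-w) ^ s / (poch q q s * poch (A * w) q s) =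
      eulerProd (A * w ^ 2) (q ^ 2) / (eulerProd (A * w) q * eulerProd (-w) q) := by
  have hq2 : ‖q ^ 2‖ < 1 := by rw [norm_pow]; exact pow_lt_one₀ (norm_nonneg _) hq two_ne_zero
  have hwn := fun n => norm_mul_pow_lt_one hq hw n
  have hAw : ∀ x : K, ‖x‖ < 1 → ‖A * x‖ < 1 := fun x hx => by
    rw [norm_mul]; exact mul_lt_one_of_nonneg_of_lt_one_left (norm_nonneg _) hA hx.le
  have hsq : ∀ x : K, ‖x‖ < 1 → ‖x ^ 2‖ < 1 := fun x hx => by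
    rw [norm_pow]; exact pow_lt_one₀ (norm_nonneg _) hx two_ne_zero
  have hneg : ∀ x : K, ‖x‖ < 1 → ‖-x‖ < 1 := fun x hx => by rwa [norm_neg]
  have hwt := tendsto_mul_pow_zero hq w
  have hAwt : Tendsto (fun n : ℕ => A * (w * q ^ n)) atTop (𝓝 0) := by
    simpa using hwt.const_mul A
  have key := tsum_mul_eq_of_step (q := q) (r := ‖w‖)
    (t := fun n s => poch A (q ^ 2) s * (-(w * q ^ n)) ^ s / (poch q q s * poch (A * (w * q ^ n)) q s))
    (a := fun n => (1 - A * (w * q ^ n)) * (1 - -(w * q ^ n)))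
    (b := fun n => 1 - A * (w * q ^ n) ^ 2) (c := fun n => 1 - A * (w * q ^ n))
    (P := fun n => eulerProd (A * (w * q ^ n) ^ 2) (q ^ 2) /
      (eulerProd (A * (w * q ^ n)) q * eulerProd (-(w * q ^ n)) q)) hq hw
    (fun n => by simp) (fun n s => ?_) (fun s => ?_) (fun n s => ?_) (fun n => ?_) (fun n => ?_)
    (fun n => ?_) ?_
  · simpa using key
  · rw [norm_div, norm_mul, norm_mul, norm_poch hq2 hA, norm_poch hq hq, norm_poch hq (hAw _ (hwn n)),
      norm_pow, norm_neg, one_mul, mul_one, div_one]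
    gcongr
    rw [norm_mul, norm_pow]
    exact mul_le_of_le_one_right (norm_nonneg _) (pow_le_one₀ (norm_nonneg _) hq.le)
  · rcases eq_or_ne s 0 with rfl | hs
    · simp
    · rw [if_neg hs]
      have h1 := ((hwt.neg.pow s).const_mul (poch A (q ^ 2) s)).div
        ((tendsto_poch_one (p := q) hAwt s).const_mul (poch q q s))
        (by rw [mul_one]; exact poch_ne_zero hq hq s)
      simpa [hs, Pi.div_def] using h1
  · have h1 := poch_succ' (A * (w * q ^ n)) q s
    rw [poch_succ] at h1
    have h2 := poch_ne_zero hq (hAw _ (hwn n)) s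
    have h3 := poch_ne_zero hq (hAw _ (hwn (n + 1))) s
    have h4 := poch_ne_zero hq hq s
    have h5 : 1 - A * (w * q ^ n) * q ^ s ≠ 0 :=
      one_sub_ne_zero_of_norm_lt (norm_mul_pow_lt_one hq (hAw _ (hwn n)) s)
    have h6 : 1 - q ^ (s + 1) ≠ 0 :=
      one_sub_ne_zero_of_norm_lt (by rw [pow_succ']; exact norm_mul_pow_lt_one hq hq s)
    have h7 : 1 - A * (w * q ^ n) ≠ 0 := one_sub_ne_zero_of_norm_lt (hAw _ (hwn n))
    rw [show A * (w * q ^ n) * q = A * (w * q ^ (n + 1)) by ring] at h1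
    have h8 : poch (A * (w * q ^ (n + 1))) q s = poch (A * (w * q ^ n)) q s *
      (1 - A * (w * q ^ n) * q ^ s) / (1 - A * (w * q ^ n)) := by
      rw [eq_div_iff h7, h1]; ring
    rw [h8, poch_succ A, poch_succ (A * _), poch_self_succ,
      show -(w * q ^ (n + 1)) = -(w * q ^ n) * q by ring, mul_pow _ q s, pow_succ (-(w * q ^ n)) s,
      show (q ^ 2) ^ s = (q ^ s) ^ 2 by ring]
    generalize w * q ^ n = W at *
    rw [pow_succ q s] at h6 ⊢
    generalize q ^ s = Y at *
    have h9 : 1 - q * Y ≠ 0 := by rwa [mul_comm]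
    field_simp
    ring
  · rw [eulerProd_eq_mul hq2 (A * _), eulerProd_eq_mul hq (A * (w * q ^ n)),
      eulerProd_eq_mul hq (-(w * q ^ n)),
      show A * (w * q ^ n) ^ 2 * q ^ 2 = A * (w * q ^ (n + 1)) ^ 2 by ring,
      show A * (w * q ^ n) * q = A * (w * q ^ (n + 1)) by ring,
      show -(w * q ^ n) * q = -(w * q ^ (n + 1)) by ring]
    have h1 := one_sub_ne_zero_of_norm_lt (hAw _ (hwn n))
    have h2 := one_sub_ne_zero_of_norm_lt (hneg _ (hwn n))
    have h3 := eulerProd_ne_zero hq (hAw _ (hwn (n + 1)))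
    have h4 := eulerProd_ne_zero hq (hneg _ (hwn (n + 1)))
    generalize eulerProd (A * (w * q ^ (n + 1))) q = E at *
    generalize eulerProd (-(w * q ^ (n + 1))) q = E' at *
    generalize w * q ^ n = W at *
    field_simp
  · exact mul_ne_zero (one_sub_ne_zero_of_norm_lt (hAw _ (hwn n)))
      (one_sub_ne_zero_of_norm_lt (hneg _ (hwn n)))
  · exact div_ne_zero (eulerProd_ne_zero hq2 (hAw _ (hsq _ (hwn n))))
      (mul_ne_zero (eulerProd_ne_zero hq (hAw _ (hwn n))) (eulerProd_ne_zero hq (hneg _ (hwn n))))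
  · have h1 := tendsto_eulerProd_of_tendsto_zero hq2 (u := fun n : ℕ => A * (w * q ^ n) ^ 2)
      (fun n => (hAw _ (hsq _ (hwn n))).le) (by simpa using (hwt.pow 2).const_mul A)
    have h2 := tendsto_eulerProd_of_tendsto_zero hq (u := fun n : ℕ => A * (w * q ^ n))
      (fun n => (hAw _ (hwn n)).le) hAwt
    have h3 := tendsto_eulerProd_of_tendsto_zero hq (u := fun n : ℕ => -(w * q ^ n))
      (fun n => (hneg _ (hwn n)).le) (by simpa using hwt.neg)
    simpa [Pi.div_def] using h1.div (h2.mul h3) (by norm_num)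

/-- The q-Gauss sum with one numerator parameter sent to infinity. -/
theorem tsum_poch_div {p A w : K} (hp : ‖p‖ < 1) (hA : ‖A‖ < 1) (hw : ‖w‖ < 1) :
    ∑' s : ℕ, poch A p s * p ^ s.choose 2 * (-w) ^ s / (poch p p s * poch (A * w) p s) =
      eulerProd w p / eulerProd (A * w) p := by
  have hwn := fun n => norm_mul_pow_lt_one hp hw n
  have hAw : ∀ x : K, ‖x‖ < 1 → ‖A * x‖ < 1 := fun x hx => by
    rw [norm_mul]; exact mul_lt_one_of_nonneg_of_lt_one_left (norm_nonneg _) hA hx.le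
  have hwt := tendsto_mul_pow_zero hp w
  have hAwt : Tendsto (fun n : ℕ => A * (w * p ^ n)) atTop (𝓝 0) := by
    simpa using hwt.const_mul A
  have key := tsum_mul_eq_of_step (q := p) (r := ‖w‖)
    (t := fun n s => poch A p s * p ^ s.choose 2 * (-(w * p ^ n)) ^ s /
      (poch p p s * poch (A * (w * p ^ n)) p s))
    (a := fun n => 1 - A * (w * p ^ n)) (b := fun n => 1 - w * p ^ n)
    (c := fun n => 1 - A * (w * p ^ n))
    (P := fun n => eulerProd (w * p ^ n) p / eulerProd (A * (w * p ^ n)) p) hp hw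
    (fun n => by simp) (fun n s => ?_) (fun s => ?_) (fun n s => ?_) (fun n => ?_) (fun n => ?_)
    (fun n => ?_) ?_
  · simpa using key
  · rw [norm_div, norm_mul, norm_mul, norm_mul, norm_poch hp hA, norm_poch hp hp,
      norm_poch hp (hAw _ (hwn n)), norm_pow, norm_pow, norm_neg, one_mul, mul_one, div_one]
    refine (mul_le_of_le_one_left (by positivity) (pow_le_one₀ (norm_nonneg _) hp.le)).trans ?_
    gcongr
    rw [norm_mul, norm_pow]
    exact mul_le_of_le_one_right (norm_nonneg _) (pow_le_one₀ (norm_nonneg _) hp.le)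
  · rcases eq_or_ne s 0 with rfl | hs
    · simp
    · rw [if_neg hs]
      have h1 := ((hwt.neg.pow s).const_mul (poch A p s * p ^ s.choose 2)).div
        ((tendsto_poch_one (p := p) hAwt s).const_mul (poch p p s))
        (by rw [mul_one]; exact poch_ne_zero hp hp s)
      simpa [hs, Pi.div_def] using h1
  · have h1 := poch_succ' (A * (w * p ^ n)) p s
    rw [poch_succ] at h1
    have h2 := poch_ne_zero hp (hAw _ (hwn n)) s
    have h3 := poch_ne_zero hp (hAw _ (hwn (n + 1))) s
    have h4 := poch_ne_zero hp hp s
    have h5 : 1 - A * (w * p ^ n) * p ^ s ≠ 0 :=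
      one_sub_ne_zero_of_norm_lt (norm_mul_pow_lt_one hp (hAw _ (hwn n)) s)
    have h6 : 1 - p ^ (s + 1) ≠ 0 :=
      one_sub_ne_zero_of_norm_lt (by rw [pow_succ']; exact norm_mul_pow_lt_one hp hp s)
    have h7 : 1 - A * (w * p ^ n) ≠ 0 := one_sub_ne_zero_of_norm_lt (hAw _ (hwn n))
    rw [show A * (w * p ^ n) * p = A * (w * p ^ (n + 1)) by ring] at h1
    have h8 : poch (A * (w * p ^ (n + 1))) p s = poch (A * (w * p ^ n)) p s *
      (1 - A * (w * p ^ n) * p ^ s) / (1 - A * (w * p ^ n)) := by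
      rw [eq_div_iff h7, h1]; ring
    rw [h8, poch_succ A, poch_succ (A * _), poch_self_succ, choose_succ_two, pow_add p (s.choose 2),
      show -(w * p ^ (n + 1)) = -(w * p ^ n) * p by ring, mul_pow _ p s, pow_succ (-(w * p ^ n)) s]
    generalize w * p ^ n = W at *
    rw [pow_succ p s] at h6 ⊢
    generalize p ^ s = Y at *
    field_simp
    ring
  · rw [eulerProd_eq_mul hp (A * _), eulerProd_eq_mul hp (w * p ^ n),
      show A * (w * p ^ n) * p = A * (w * p ^ (n + 1)) by ring,
      show (w * p ^ n) * p = (w * p ^ (n + 1)) by ring]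
    have h1 := one_sub_ne_zero_of_norm_lt (hAw _ (hwn n))
    have h3 := eulerProd_ne_zero hp (hAw _ (hwn (n + 1)))
    generalize eulerProd (A * (w * p ^ (n + 1))) p = E at *
    generalize w * p ^ n = W at *
    field_simp
  · exact one_sub_ne_zero_of_norm_lt (hAw _ (hwn n))
  · exact div_ne_zero (eulerProd_ne_zero hp (hwn n)) (eulerProd_ne_zero hp (hAw _ (hwn n)))
  · have h1 := tendsto_eulerProd_of_tendsto_zero hp (u := fun n : ℕ => w * p ^ n)
      (fun n => (hwn n).le) hwt
    have h2 := tendsto_eulerProd_of_tendsto_zero hp (u := fun n : ℕ => A * (w * p ^ n))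
      (fun n => (hAw _ (hwn n)).le) hAwt
    simpa [Pi.div_def] using h1.div h2 (by norm_num)

theorem tsum_sum_range_eq {f : ℕ × ℕ → K} {r : ℝ} (hr0 : 0 ≤ r) (hr1 : r < 1)
    (hf : ∀ x, ‖f x‖ ≤ r ^ x.1 * r ^ x.2) :
    ∑' n, ∑ k ∈ Finset.range (n + 1), f (k, n - k) = ∑' k, ∑' s, f (k, s) := by
  have hg := summable_geometric_of_lt_one hr0 hr1
  have hs : Summable f := Summable.of_norm_bounded
    (hg.mul_of_nonneg hg (fun _ => by positivity) (fun _ => by positivity)) hf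
  have hs' := (Finset.HasAntidiagonal.sigmaAntidiagonalEquivProd (A := ℕ)).summable_iff.mpr hs
  have h1 := (Finset.HasAntidiagonal.sigmaAntidiagonalEquivProd (A := ℕ)).tsum_eq f
  have h2 := hs'.tsum_sigma
  simp only [Function.comp] at h2
  rw [← hs.tsum_prod, ← h1, h2]
  refine tsum_congr fun n => ?_
  simp only [Finset.HasAntidiagonal.sigmaAntidiagonalEquivProd_apply]
  rw [tsum_fintype, Finset.sum_coe_sort (Finset.HasAntidiagonal.antidiagonal n) f,
    Finset.Nat.sum_antidiagonal_eq_sum_range_succ_mk]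

theorem norm_pow_sq_mul_signedSum_le {q : K} (hq0 : q ≠ 0) (hq : ‖q‖ < 1) (r : ℕ) :
    ‖q ^ r ^ 2 * signedSum q r‖ ≤ 1 := by
  rw [signedSum, Finset.mul_sum]
  refine IsUltrametricDist.norm_sum_le_of_forall_le_of_nonneg zero_le_one fun j hj => ?_
  rw [Finset.mem_Icc] at hj
  have h1 : 0 ≤ (r : ℤ) ^ 2 - j ^ 2 := by nlinarith
  rw [mul_left_comm, ← zpow_natCast q, ← zpow_add₀ hq0, norm_mul, norm_zpow, norm_neg, norm_one,
    one_zpow, one_mul, norm_zpow]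
  obtain ⟨e, he⟩ := Int.eq_ofNat_of_zero_le h1
  rw [show ((r ^ 2 : ℕ) : ℤ) + -(j ^ 2) = (e : ℕ) by rw [← he]; push_cast; ring, zpow_natCast]
  exact pow_le_one₀ (norm_nonneg _) hq.le

/-- The sixth order mock theta function `λ` at a point of an ultrametric field. -/
noncomputable def lambdaSum (q : K) : K :=
  ∑' n : ℕ, (-1) ^ n * q ^ n * poch q (q ^ 2) n / poch (-q) q n

/-- The sixth order mock theta function `ψ` at a point of an ultrametric field. -/
noncomputable def psiSum (q : K) : K :=
  ∑' n : ℕ, (-1) ^ n * q ^ (n + 1) ^ 2 * poch q (q ^ 2) n / poch (-q) q (2 * n + 1)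

/-- Replacing `1 / (-q; q)_n` by its Bailey expansion and summing over `n` first leaves a q-Gauss
sum for each `r`. -/
theorem lambdaSum_eq {q : K} (hq0 : q ≠ 0) (hq : ‖q‖ < 1) :
    lambdaSum q = eulerProd q (q ^ 2) / eulerProd (q ^ 2) (q ^ 2) *
      ∑' r : ℕ, (-1) ^ r * q ^ (3 * (r + 1).choose 2) * signedSum q r := by
  have hq2 : ‖q ^ 2‖ < 1 := by rw [norm_pow]; exact pow_lt_one₀ (norm_nonneg _) hq two_ne_zero
  have hpow : ∀ n : ℕ, ‖q ^ (n + 1)‖ < 1 := fun n => by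
    rw [norm_pow]; exact pow_lt_one₀ (norm_nonneg _) hq (by omega)
  let f : ℕ × ℕ → K := fun x => (-1) ^ (x.1 + x.2) * q ^ (x.1 + x.2) * poch q (q ^ 2) (x.1 + x.2) *
    (q ^ (x.1 + 1).choose 2 * (q ^ x.1 ^ 2 * (1 - q ^ (2 * x.1 + 1)) * signedSum q x.1) /
      (poch q q x.2 * poch q q (2 * x.1 + x.2 + 1)))
  have hf : ∀ x, ‖f x‖ ≤ ‖q‖ ^ x.1 * ‖q‖ ^ x.2 := by
    rintro ⟨r, s⟩
    have h1 : ‖q ^ (r + 1).choose 2‖ ≤ 1 := by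
      rw [norm_pow]; exact pow_le_one₀ (norm_nonneg _) hq.le
    have h2 := mul_le_one₀ h1 (norm_nonneg _) (norm_pow_sq_mul_signedSum_le hq0 hq r)
    rw [norm_mul] at h2
    simp only [f]
    rw [norm_mul, norm_mul, norm_mul, norm_div, norm_mul, norm_mul, norm_mul, norm_mul,
      norm_poch hq2 hq, norm_poch hq hq, norm_poch hq hq, norm_one_sub_of_norm_lt (hpow _), norm_pow,
      norm_pow q (r + s), norm_neg, norm_one, one_pow, pow_add, mul_one, mul_one, one_mul, mul_one,
      div_one]
    exact mul_le_of_le_one_right (by positivity) h2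
  have h1 : lambdaSum q = ∑' n, ∑ r ∈ Finset.range (n + 1), f (r, n - r) := by
    refine tsum_congr fun n => ?_
    rw [← mul_one_div, ← sum_signedSum_eq_one_div_poch hq0 hq, Finset.mul_sum]
    refine Finset.sum_congr rfl fun r hr => ?_
    obtain ⟨s, rfl⟩ := Nat.exists_eq_add_of_le (Nat.lt_succ_iff.mp (Finset.mem_range.mp hr))
    simp only [f, Nat.add_sub_cancel_left]
    rw [show r + s + r + 1 = 2 * r + s + 1 by ring]
  rw [h1, tsum_sum_range_eq (norm_nonneg _) hq hf, ← tsum_mul_left]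
  refine tsum_congr fun r => ?_
  -- With `A = q^(2r+1)` and `w = q` the resulting products are tails of products not depending on
  -- `r`; the missing initial factors are those already in front.
  have h2 := tsum_poch_sq_div hq (hpow (2 * r)) hq
  have e1 : eulerProd q (q ^ 2) = poch q (q ^ 2) r * ((1 - q ^ (2 * r + 1)) *
      eulerProd (q ^ (2 * r + 1) * q ^ 2) (q ^ 2)) := by
    rw [eulerProd_eq_poch_mul hq2 q r, show q * (q ^ 2) ^ r = q ^ (2 * r + 1) by ring,
      eulerProd_eq_mul hq2]
  have e2 : eulerProd q q = poch q q (2 * r + 1) * eulerProd (q ^ (2 * r + 1) * q) q := by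
    rw [eulerProd_eq_poch_mul hq q (2 * r + 1), mul_comm q]
  have e3 : eulerProd (q ^ 2) (q ^ 2) = eulerProd q q * eulerProd (-q) q := by
    refine tendsto_nhds_unique (tendsto_poch hq2 _) ?_
    exact ((tendsto_poch hq _).mul (tendsto_poch hq _)).congr fun n => poch_self_mul_poch_neg q n
  have hE : eulerProd q q ≠ 0 := eulerProd_ne_zero hq hq
  have hE' : eulerProd (-q) q ≠ 0 := eulerProd_ne_zero hq (by rwa [norm_neg])
  have h3 : ∀ s, f (r, s) = (-1) ^ r * q ^ r * poch q (q ^ 2) r * q ^ (r + 1).choose 2 * q ^ r ^ 2 *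
      (1 - q ^ (2 * r + 1)) * signedSum q r / poch q q (2 * r + 1) *
      (poch (q ^ (2 * r + 1)) (q ^ 2) s * (-q) ^ s /
        (poch q q s * poch (q ^ (2 * r + 1) * q) q s)) := by
    intro s
    simp only [f]
    rw [poch_add, show 2 * r + s + 1 = 2 * r + 1 + s by ring, poch_add q q,
      show q * (q ^ 2) ^ r = q ^ (2 * r + 1) by ring, neg_pow q s, mul_comm q (q ^ (2 * r + 1))]
    rw [mul_div_assoc', div_mul_div_comm]
    congr 1 <;> ring
  rw [tsum_congr h3, tsum_mul_left, h2, e1, e3, e2]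
  rw [e2] at hE
  have h5 := left_ne_zero_of_mul hE
  have h6 := right_ne_zero_of_mul hE
  have h7 : q ^ (3 * (r + 1).choose 2) = q ^ r * q ^ (r + 1).choose 2 * q ^ r ^ 2 := by
    rw [← pow_add, ← pow_add]
    congr 1
    have := two_mul_tri (r + 1)
    zify
    have h8 := tri_natCast (r + 1)
    push_cast at h8
    rw [← h8]
    linarith
  rw [h7]
  field_simp

/-- The argument for `λ` carried out in base `q²`. The quadratic exponent of `ψ` calls for the
confluent form of the q-Gauss sum. -/
theorem psiSum_eq {q : K} (hq0 : q ≠ 0) (hq : ‖q‖ < 1) :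
    psiSum q = q * (eulerProd q (q ^ 2) / eulerProd (q ^ 2) (q ^ 2)) *
      ∑' r : ℕ, (-1) ^ r * q ^ (6 * (r + 1).choose 2) * signedSum q r := by
  have hq2 : ‖q ^ 2‖ < 1 := by rw [norm_pow]; exact pow_lt_one₀ (norm_nonneg _) hq two_ne_zero
  have hpow : ∀ n : ℕ, ‖q ^ (n + 1)‖ < 1 := fun n => by
    rw [norm_pow]; exact pow_lt_one₀ (norm_nonneg _) hq (by omega)
  let f : ℕ × ℕ → K := fun x => (-1) ^ (x.1 + x.2) * q ^ (x.1 + x.2 + 1) ^ 2 *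
    poch q (q ^ 2) (x.1 + x.2) *
    ((q ^ 2) ^ (x.1 + 1).choose 2 * (q ^ x.1 ^ 2 * (1 - q ^ (2 * x.1 + 1)) * signedSum q x.1) /
      (poch (q ^ 2) (q ^ 2) x.2 * poch (q ^ 2) (q ^ 2) (2 * x.1 + x.2 + 1)))
  have hf : ∀ x, ‖f x‖ ≤ ‖q‖ ^ x.1 * ‖q‖ ^ x.2 := by
    rintro ⟨r, s⟩
    have h1 : ‖(q ^ 2) ^ (r + 1).choose 2‖ ≤ 1 := by
      rw [norm_pow]; exact pow_le_one₀ (norm_nonneg _) hq2.le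
    have h2 := mul_le_one₀ h1 (norm_nonneg _) (norm_pow_sq_mul_signedSum_le hq0 hq r)
    rw [norm_mul] at h2
    simp only [f]
    rw [norm_mul, norm_mul, norm_mul, norm_div, norm_mul, norm_mul, norm_mul, norm_mul,
      norm_poch hq2 hq, norm_poch hq2 hq2, norm_poch hq2 hq2, norm_one_sub_of_norm_lt (hpow _),
      norm_pow (-1 : K), norm_pow q ((r + s + 1) ^ 2), norm_neg, norm_one, one_pow, mul_one,
      mul_one, one_mul, mul_one, div_one, ← pow_add]
    refine (mul_le_of_le_one_right (by positivity) h2).trans ?_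
    exact pow_le_pow_of_le_one (norm_nonneg _) hq.le (by nlinarith)
  have h1 : psiSum q = ∑' n, ∑ r ∈ Finset.range (n + 1), f (r, n - r) := by
    refine tsum_congr fun n => ?_
    rw [← mul_one_div, ← sum_signedSum_eq_one_div_poch_sq hq0 hq, Finset.mul_sum]
    refine Finset.sum_congr rfl fun r hr => ?_
    obtain ⟨s, rfl⟩ := Nat.exists_eq_add_of_le (Nat.lt_succ_iff.mp (Finset.mem_range.mp hr))
    simp only [f, Nat.add_sub_cancel_left]
    rw [show r + s + r + 1 = 2 * r + s + 1 by ring]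
  rw [h1, tsum_sum_range_eq (norm_nonneg _) hq hf, ← tsum_mul_left]
  refine tsum_congr fun r => ?_
  -- Here `A = q^(2r+1)` and `w = q^(2r+3)`; the latter is the linear part in `s` of the exponent
  -- `(r + s + 1)²` once `(q²)^(s.choose 2)` is removed.
  have h2 := tsum_poch_div hq2 (hpow (2 * r)) (hpow (2 * r + 2))
  have e1 : eulerProd q (q ^ 2) = poch q (q ^ 2) r * ((1 - q ^ (2 * r + 1)) *
      eulerProd (q ^ (2 * r + 2 + 1)) (q ^ 2)) := by
    rw [eulerProd_eq_poch_mul hq2 q r, show q * (q ^ 2) ^ r = q ^ (2 * r + 1) by ring,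
      eulerProd_eq_mul hq2, ← pow_add, show 2 * r + 1 + 2 = 2 * r + 2 + 1 by ring]
  have e2 : eulerProd (q ^ 2) (q ^ 2) = poch (q ^ 2) (q ^ 2) (2 * r + 1) *
      eulerProd (q ^ (2 * r + 1) * q ^ (2 * r + 2 + 1)) (q ^ 2) := by
    rw [eulerProd_eq_poch_mul hq2 (q ^ 2) (2 * r + 1)]
    congr 2; ring
  have hE : eulerProd (q ^ 2) (q ^ 2) ≠ 0 := eulerProd_ne_zero hq2 hq2
  have h3 : ∀ s, f (r, s) = (-1) ^ r * q ^ (r + 1) ^ 2 * poch q (q ^ 2) r *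
      (q ^ 2) ^ (r + 1).choose 2 * q ^ r ^ 2 *
      (1 - q ^ (2 * r + 1)) * signedSum q r / poch (q ^ 2) (q ^ 2) (2 * r + 1) *
      (poch (q ^ (2 * r + 1)) (q ^ 2) s * (q ^ 2) ^ s.choose 2 * (-q ^ (2 * r + 2 + 1)) ^ s /
        (poch (q ^ 2) (q ^ 2) s * poch (q ^ (2 * r + 1) * q ^ (2 * r + 2 + 1)) (q ^ 2) s)) := by
    intro s
    have e4 : q ^ (r + s + 1) ^ 2 =
        q ^ (r + 1) ^ 2 * (q ^ 2) ^ s.choose 2 * (q ^ (2 * r + 2 + 1)) ^ s := by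
      rw [← pow_mul, ← pow_mul, ← pow_add, ← pow_add]
      congr 1
      have := two_mul_tri s
      zify
      rw [← tri_natCast]
      linear_combination -this
    simp only [f]
    rw [poch_add, show 2 * r + s + 1 = 2 * r + 1 + s by ring, poch_add (q ^ 2) (q ^ 2) (2 * r + 1),
      show q * (q ^ 2) ^ r = q ^ (2 * r + 1) by ring, neg_pow _ s,
      show q ^ 2 * (q ^ 2) ^ (2 * r + 1) = q ^ (2 * r + 1) * q ^ (2 * r + 2 + 1) by ring, e4]
    rw [mul_div_assoc', div_mul_div_comm]
    congr 1 <;> ring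
  rw [tsum_congr h3, tsum_mul_left, h2, e1, e2]
  rw [e2] at hE
  have h5 := left_ne_zero_of_mul hE
  have h6 := right_ne_zero_of_mul hE
  have h7 : q * q ^ (6 * (r + 1).choose 2) =
      q ^ (r + 1) ^ 2 * (q ^ 2) ^ (r + 1).choose 2 * q ^ r ^ 2 := by
    rw [← pow_mul, ← pow_add, ← pow_add, ← pow_succ']
    congr 1
    have := two_mul_tri (r + 1)
    zify
    have h8 := tri_natCast (r + 1)
    push_cast at h8
    rw [← h8]
    linear_combination 2 * this
  generalize q ^ (6 * (r + 1).choose 2) = T at *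
  generalize (q ^ 2) ^ (r + 1).choose 2 = T₁ at *
  generalize q ^ (r + 1) ^ 2 = T₂ at *
  generalize q ^ r ^ 2 = T₃ at *
  field_simp
  linear_combination (-poch q (q ^ 2) r * (1 - q ^ (2 * r + 1)) * signedSum q r *
    eulerProd (q ^ (2 * r + 2 + 1)) (q ^ 2)) * h7

end Telescoping

end MockTheta

namespace MockTheta
open Filter Topology

/-! ### The common prefactor of the Hecke-type series. -/

section EulerProducts

variable {K : Type*} [NormedField K] [IsUltrametricDist K] [CompleteSpace K]

theorem norm_pow_lt_one {q : K} (hq : ‖q‖ < 1) {n : ℕ} (hn : n ≠ 0) : ‖q ^ n‖ < 1 := by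
  rw [norm_pow]; exact pow_lt_one₀ (norm_nonneg _) hq hn

theorem eulerProd_eq_mul_sq {p : K} (hp : ‖p‖ < 1) (a : K) :
    eulerProd a p = eulerProd a (p ^ 2) * eulerProd (a * p) (p ^ 2) := by
  have hp2 := norm_pow_lt_one hp two_ne_zero
  refine tendsto_nhds_unique
    ((tendsto_poch hp a).comp (tendsto_id.const_mul_atTop' (by norm_num : 0 < 2))) ?_
  exact ((tendsto_poch hp2 a).mul (tendsto_poch hp2 (a * p))).congr fun n => (poch_two_mul a p n).symm

theorem eulerProd_mul_neg {p : K} (hp : ‖p‖ < 1) (a : K) :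
    eulerProd a p * eulerProd (-a) p = eulerProd (a ^ 2) (p ^ 2) := by
  have hp2 := norm_pow_lt_one hp two_ne_zero
  refine tendsto_nhds_unique ((tendsto_poch hp a).mul (tendsto_poch hp (-a))) ?_
  refine (tendsto_poch hp2 (a ^ 2)).congr fun n => ?_
  rw [poch, poch, poch, ← Finset.prod_mul_distrib]
  exact Finset.prod_congr rfl fun k _ => by ring

theorem theta_one_eq {q : K} (hq0 : q ≠ 0) (hq : ‖q‖ < 1) :
    theta q 1 * eulerProd q q = 2 * eulerProd (q ^ 2) (q ^ 2) ^ 2 := by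
  rw [theta_eq_eulerProd hq0 hq one_ne_zero, eulerProd_eq_mul hq, div_one, ← eulerProd_mul_neg hq q,
    neg_one_mul]
  ring

/-- The prefactor of both Hecke-type series is therefore `2 / theta q 1`, a form suited to
multiplying lattice sums. -/
theorem theta_one_mul {q : K} (hq0 : q ≠ 0) (hq : ‖q‖ < 1) :
    theta q 1 * (eulerProd q (q ^ 2) / eulerProd (q ^ 2) (q ^ 2)) = 2 := by
  have h1 := theta_one_eq hq0 hq
  have h2 := eulerProd_ne_zero (norm_pow_lt_one hq two_ne_zero) (norm_pow_lt_one hq two_ne_zero)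
  rw [eulerProd_eq_mul_sq hq q, ← pow_two] at h1
  rw [mul_div_assoc', div_eq_iff h2]
  apply mul_right_cancel₀ h2
  linear_combination h1

end EulerProducts

/-! ### The Appell-Lerch form of `ψ`. -/

section Appell

variable {K : Type*} [NormedField K]

/-- The Appell-Lerch type sum `∑ Q^{r(r-1)/2} z^r / (1 + Q^{r-1} z)`. -/
noncomputable def appell (Q z : K) : K := ∑' r : ℤ, Q ^ tri r * z ^ r / (1 + Q ^ (r - 1) * z)

variable [IsUltrametricDist K] [CompleteSpace K]

theorem summable_mul_partialTheta {q : K} (hq0 : q ≠ 0) (hq : ‖q‖ < 1) (M : ℤ → ℤ) :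
    Summable fun l : ℤ => q ^ tri l * partialTheta q (M l) :=
  summable_zpow_mul hq0 hq _ (by simpa using tendsto_tri_sub 0) _ fun l => norm_partialTheta_le hq _

/-- After a shift of `l` the two halves carry the partial theta function at neighbouring indices,
where its recurrence leaves only `q^(tri l)`. This expands `theta q 1 / (1 + q^m)` uniformly in the
sign of `m`. -/
theorem one_add_mul_tsum_partialTheta {q : K} (hq0 : q ≠ 0) (hq : ‖q‖ < 1) (m : ℤ) :
    (1 + q ^ m) * ∑' l : ℤ, q ^ tri l * partialTheta q (m + l - 1) = theta q 1 := by
  have h1 : q ^ m * ∑' l : ℤ, q ^ tri l * partialTheta q (m + l - 1) =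
      ∑' l : ℤ, q ^ tri l * (q ^ (m + l) * partialTheta q (m + l)) := by
    rw [← tsum_mul_left, ← (Equiv.addRight (1 : ℤ)).tsum_eq]
    refine tsum_congr fun l => ?_
    rw [Equiv.coe_addRight, tri_add_one, zpow_add₀ hq0, zpow_add₀ hq0,
      show m + (l + 1) - 1 = m + l by ring]
    ring
  have hs : Summable fun l : ℤ => q ^ tri l * (q ^ (m + l) * partialTheta q (m + l)) := by
    have := ((Equiv.addRight (1 : ℤ)).summable_iff.mpr
      (summable_mul_partialTheta hq0 hq fun l => m + l - 1)).mul_left (q ^ m)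
    refine this.congr fun l => ?_
    simp only [Function.comp, Equiv.coe_addRight]
    rw [tri_add_one, zpow_add₀ hq0, zpow_add₀ hq0, show m + (l + 1) - 1 = m + l by ring]
    ring
  rw [add_mul, one_mul, h1, ← (summable_mul_partialTheta hq0 hq fun l => m + l - 1).tsum_add hs, theta]
  refine tsum_congr fun l => ?_
  rw [partialTheta_step hq0 hq (m + l - 1), sub_add_cancel, one_zpow]
  ring

theorem zpow_ne_one_of_norm_lt {q : K} (hq0 : q ≠ 0) (hq : ‖q‖ < 1) {n : ℤ} (hn : n ≠ 0) : q ^ n ≠ 1 := by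
  intro h
  have h1 := congrArg norm h
  rw [norm_zpow, norm_one, zpow_eq_one_iff_right₀ (norm_nonneg _) hq.ne] at h1
  exact hn h1

theorem summable_quadratic {q : K} (hq0 : q ≠ 0) (hq : ‖q‖ < 1) (k : ℤ) (u : ℤ → K) (hu : ∀ t, ‖u t‖ ≤ 1) :
    Summable fun t : ℤ => q ^ (2 * t ^ 2 - k * t) * u t :=
  summable_zpow_mul hq0 hq _ (tendsto_cofinite_atTop_of_abs_le ((|k| + 1) ^ 2) fun t => by
    have h1 : k * t ≤ |k| * |t| := by rw [← abs_mul]; exact le_abs_self _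
    have h2 := sq_abs t
    nlinarith [sq_nonneg (|t| - (|k| + 1)), sq_nonneg (|k| + 1), abs_nonneg t, abs_nonneg k]) _ hu

theorem tsum_quadratic_partialTheta_step {q : K} (hq0 : q ≠ 0) (hq : ‖q‖ < 1) (k c w : ℤ)
    {M M' : ℤ → ℤ} (hM : ∀ t, M t + 1 = M' (c - t))
    (hw : ∀ t, 2 * t ^ 2 - k * t + (M t + 1) = w + (2 * (c - t) ^ 2 - k * (c - t))) :
    ∑' t : ℤ, q ^ (2 * t ^ 2 - k * t) * partialTheta q (M t) =
      ∑' t : ℤ, q ^ (2 * t ^ 2 - k * t) -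
        q ^ w * ∑' t : ℤ, q ^ (2 * t ^ 2 - k * t) * partialTheta q (M' t) := by
  have h1 : Summable fun t : ℤ => q ^ (2 * t ^ 2 - k * t) := by
    simpa using summable_quadratic hq0 hq k (fun _ => 1) (by simp)
  have h2 := summable_quadratic hq0 hq k (fun t => partialTheta q (M' t))
    fun t => norm_partialTheta_le hq _
  have h3 : Summable fun t : ℤ => q ^ w * (q ^ (2 * (c - t) ^ 2 - k * (c - t)) *
      partialTheta q (M' (c - t))) := ((Equiv.subLeft c).summable_iff.mpr h2).mul_left _
  have h4 : ∑' t : ℤ, q ^ (2 * t ^ 2 - k * t) * partialTheta q (M' t) =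
      ∑' t : ℤ, q ^ (2 * (c - t) ^ 2 - k * (c - t)) * partialTheta q (M' (c - t)) :=
    ((Equiv.subLeft c).tsum_eq _).symm
  rw [h4, ← tsum_mul_left, ← h1.tsum_sub h3]
  refine tsum_congr fun t => ?_
  rw [partialTheta_step hq0 hq, ← mul_assoc, ← zpow_add₀ hq0, ← hw, ← hM,
    zpow_add₀ hq0 (2 * t ^ 2 - k * t)]
  ring

/-- For `k = 2m` the reflection `t ↦ m - t` exchanges the sides. For `k = 2m + 1`, recurrence and
reflection express each side as the same theta sum minus `q^(3m-1)` times the other; since `3m - 1 ≠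
0` they must agree. -/
theorem tsum_quadratic_partialTheta_eq {q : K} (hq0 : q ≠ 0) (hq : ‖q‖ < 1) (k : ℤ) :
    ∑' t : ℤ, q ^ (2 * t ^ 2 - k * t) * partialTheta q (2 * k - 2 * t - 3) =
      ∑' t : ℤ, q ^ (2 * t ^ 2 - k * t) * partialTheta q (k + 2 * t - 3) := by
  rcases Int.even_or_odd' k with ⟨m, rfl | rfl⟩
  · rw [← (Equiv.subLeft m).tsum_eq]
    refine tsum_congr fun t => ?_
    rw [Equiv.subLeft_apply, show 2 * (2 * m) - 2 * (m - t) - 3 = 2 * m + 2 * t - 3 by ring,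
      show 2 * (m - t) ^ 2 - 2 * m * (m - t) = 2 * t ^ 2 - 2 * m * t by ring]
  · have e1 := tsum_quadratic_partialTheta_step hq0 hq (2 * m + 1) (m + 1) (3 * m - 1)
      (M := fun t => 2 * (2 * m + 1) - 2 * t - 3) (M' := fun t => 2 * m + 1 + 2 * t - 3)
      (fun t => by ring) (fun t => by ring)
    have e2 := tsum_quadratic_partialTheta_step hq0 hq (2 * m + 1) m (3 * m - 1)
      (M := fun t => 2 * m + 1 + 2 * t - 3) (M' := fun t => 2 * (2 * m + 1) - 2 * t - 3)
      (fun t => by ring) (fun t => by ring)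
    have h2 : 1 - q ^ (3 * m - 1) ≠ 0 :=
      sub_ne_zero.mpr (zpow_ne_one_of_norm_lt hq0 hq (by omega)).symm
    rw [← sub_eq_zero]
    refine (mul_eq_zero.mp ?_).resolve_left h2
    linear_combination e1 - e2

/-- Regrouping a double series over `ℤ × ℤ` along the lines `t + l = k`. -/
theorem tsum_tsum_eq_tsum_tsum_sub {f : ℤ × ℤ → K} (hf : Summable f) :
    ∑' t, ∑' l, f (t, l) = ∑' k, ∑' t, f (t, k - t) := by
  let e : ℤ × ℤ ≃ ℤ × ℤ :=
    ⟨fun x => (x.2, x.1 - x.2), fun y => (y.1 + y.2, y.1), fun x => by simp, fun y => by simp⟩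
  have h1 : Summable (f ∘ e) := e.summable_iff.mpr hf
  have h2 := h1.tsum_prod
  simp only [Function.comp] at h2
  rw [← hf.tsum_prod, ← e.tsum_eq f, h2]
  rfl

/-- Both sides are sums over the same quadratic form on `ℤ × ℤ`, weighted by different partial theta
values. They already agree on each line `t + l = k`. -/
theorem theta_mul_tsum_partialTheta {q : K} (hq0 : q ≠ 0) (hq : ‖q‖ < 1) (h2 : ‖(2 : K)‖ = 1) :
    theta (q ^ 3) q * ∑' l : ℤ, q ^ tri l * partialTheta q (2 * l - 3) =
      theta q 1 * appell (q ^ 3) q := by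
  have hsum : ∀ M : ℤ × ℤ → ℤ, Summable fun x : ℤ × ℤ =>
      q ^ (3 * tri x.1 + x.1 + tri x.2) * partialTheta q (M x) := fun M =>
    summable_zpow_mul hq0 hq _ (tendsto_cofinite_atTop_of_abs_add_abs_le 20 fun t l => by
      have h1 := mul_abs_le_tri 1 t
      have h2 := mul_abs_le_tri 1 l
      have h3 := neg_abs_le t
      have h4 := abs_nonneg t
      simp only
      linarith) _ fun x => norm_partialTheta_le hq _
  have hQ : ∀ n : ℤ, (q ^ 3) ^ n = q ^ (3 * n) := fun n => by
    rw [zpow_mul, ← zpow_natCast q 3]; rfl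
  have h3 : ∀ m : ℤ, 1 + q ^ m ≠ 0 := by
    intro m h
    rcases eq_or_ne m 0 with rfl | hm
    · rw [zpow_zero, one_add_one_eq_two] at h; rw [h, norm_zero] at h2; exact zero_ne_one h2
    · have h4 : q ^ (2 * m) = 1 := by
        rw [mul_comm, zpow_mul]
        have : q ^ m = -1 := by linear_combination h
        rw [this]; norm_num
      exact zpow_ne_one_of_norm_lt hq0 hq (by omega) h4
  have h4 : theta (q ^ 3) q * ∑' l : ℤ, q ^ tri l * partialTheta q (2 * l - 3) =
      ∑' t : ℤ, ∑' l : ℤ, q ^ (3 * tri t + t + tri l) * partialTheta q (2 * l - 3) := by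
    rw [theta, ← tsum_mul_right]
    refine tsum_congr fun t => ?_
    rw [← tsum_mul_left]
    refine tsum_congr fun l => ?_
    rw [hQ, zpow_add₀ hq0 (3 * tri t + t), zpow_add₀ hq0]; ring
  have h5 : theta q 1 * appell (q ^ 3) q =
      ∑' t : ℤ, ∑' l : ℤ, q ^ (3 * tri t + t + tri l) * partialTheta q (3 * t + l - 3) := by
    rw [appell, ← tsum_mul_left]
    refine tsum_congr fun t => ?_
    have h6 := one_add_mul_tsum_partialTheta hq0 hq (3 * t - 2)
    have h7 : (q ^ 3) ^ (t - 1) * q = q ^ (3 * t - 2) := by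
      rw [hQ, ← zpow_add_one₀ hq0]; congr 1; ring
    rw [h7, mul_div_assoc', div_eq_iff (h3 _), ← h6, hQ, ← zpow_add₀ hq0]
    have h8 : ∑' l : ℤ, q ^ (3 * tri t + t + tri l) * partialTheta q (3 * t + l - 3) =
        q ^ (3 * tri t + t) * ∑' l : ℤ, q ^ tri l * partialTheta q (3 * t - 2 + l - 1) := by
      rw [← tsum_mul_left]
      refine tsum_congr fun l => ?_
      rw [zpow_add₀ hq0 (3 * tri t + t), mul_assoc, show 3 * t - 2 + l - 1 = 3 * t + l - 3 by ring]
    rw [h8]; ring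
  rw [h4, h5, tsum_tsum_eq_tsum_tsum_sub (hsum fun x => 2 * x.2 - 3),
    tsum_tsum_eq_tsum_tsum_sub (hsum fun x => 3 * x.1 + x.2 - 3)]
  refine tsum_congr fun k => ?_
  have h9 : ∀ t : ℤ, 3 * tri t + t + tri (k - t) = tri k + (2 * t ^ 2 - k * t) := fun t => by
    have := two_mul_tri t
    rw [tri_sub]; linarith
  simp only [h9, zpow_add₀ hq0 (tri k), mul_assoc, tsum_mul_left]
  congr 1
  have := tsum_quadratic_partialTheta_eq hq0 hq k
  simp only [show ∀ t : ℤ, 2 * (k - t) - 3 = 2 * k - 2 * t - 3 by intro t; ring,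
    show ∀ t : ℤ, 3 * t + (k - t) - 3 = k + 2 * t - 3 by intro t; ring]
  exact this

theorem summable_signedSum {q : K} (hq0 : q ≠ 0) (hq : ‖q‖ < 1) {c : ℕ} (hc : 3 ≤ c) :
    Summable fun n : ℕ => (-1) ^ n * q ^ (c * (n + 1).choose 2) * signedSum q n := by
  refine Summable.of_norm_bounded (summable_geometric_of_lt_one (norm_nonneg _) hq) fun n => ?_
  obtain ⟨e, he⟩ : ∃ e, c * (n + 1).choose 2 = n + n ^ 2 + e := by
    refine Nat.exists_eq_add_of_le ?_
    have h1 := two_mul_tri (n + 1)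
    have h2 := tri_natCast (n + 1)
    push_cast at h2
    zify at hc ⊢
    rw [h2] at h1
    have h3 : (0 : ℤ) ≤ (((n + 1).choose 2 : ℕ) : ℤ) := by positivity
    nlinarith
  have h1 := norm_pow_sq_mul_signedSum_le hq0 hq n
  rw [norm_mul] at h1
  rw [he, pow_add, pow_add, norm_mul, norm_mul, norm_mul, norm_mul, norm_pow, norm_pow q n,
    norm_pow q e, norm_neg, norm_one, one_pow, one_mul]
  have h2 : ‖q‖ ^ e ≤ 1 := pow_le_one₀ (norm_nonneg _) hq.le
  calc ‖q‖ ^ n * ‖q ^ n ^ 2‖ * ‖q‖ ^ e * ‖signedSum q n‖ =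
      ‖q‖ ^ n * (‖q‖ ^ e * (‖q ^ n ^ 2‖ * ‖signedSum q n‖)) := by ring
    _ ≤ ‖q‖ ^ n := mul_le_of_le_one_right (by positivity) (mul_le_one₀ h2 (by positivity) h1)

/-- The terms of the double series for `ψ`. -/
noncomputable def pairTerm (q : K) (x : ℕ × ℕ) : K :=
  (-1) ^ x.2 * q ^ (tri (x.1 + 2) + tri (x.2 + 1) + (2 * x.1 + 1) * x.2)

/-- On the antidiagonal of total `2n`, with `j = k - n`, the exponent is `1 + 3n(n+1) - j²`. -/
theorem sum_range_pairTerm_even {q : K} (hq0 : q ≠ 0) (n : ℕ) :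
    ∑ k ∈ Finset.range (2 * n + 1), pairTerm q (k, 2 * n - k) =
    q * ((-1) ^ n * q ^ (6 * (n + 1).choose 2) * signedSum q n) := by
  rw [signedSum, Finset.mul_sum, Finset.mul_sum]
  refine Finset.sum_nbij' (fun k => (k : ℤ) - n) (fun j => (n + j).toNat) ?_ ?_ ?_ ?_ ?_
  · intro i hi; rw [Finset.mem_range] at hi; rw [Finset.mem_Icc]; omega
  · intro j hj; rw [Finset.mem_Icc] at hj; rw [Finset.mem_range]; omega
  · intro i hi; omega
  · intro j hj; rw [Finset.mem_Icc] at hj; omega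
  · intro k hk
    rw [Finset.mem_range] at hk
    obtain ⟨s, hs'⟩ := Nat.exists_eq_add_of_le (Nat.lt_succ_iff.mp hk)
    have hc : 2 * (n : ℤ) = k + s := by exact_mod_cast hs'
    have e1 : (-1 : K) ^ s = (-1) ^ n * (-1) ^ ((k : ℤ) - n) := by
      rw [← zpow_natCast, ← zpow_natCast, ← zpow_add₀ (by norm_num),
        show (n : ℤ) + (k - n) = s + 2 * (k - n) by linarith, zpow_add₀ (by norm_num), zpow_mul]
      norm_num
    have e2 : tri ((k : ℤ) + 2) + tri ((s : ℤ) + 1) + (2 * k + 1) * s =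
        1 + ((6 * (n + 1).choose 2 : ℕ) : ℤ) + -(((k : ℤ) - n) ^ 2) := by
      have h5 := two_mul_tri (n + 1)
      have h6 := tri_natCast (n + 1)
      push_cast at h6 ⊢
      rw [← h6]
      have h7 := two_mul_tri (k + 2)
      have h8 := two_mul_tri (s + 1)
      have h9 : (s : ℤ) = 2 * n - k := by linarith
      rw [h9] at h8 ⊢
      linarith
    simp only [pairTerm]
    rw [hs', Nat.add_sub_cancel_left, e1, e2, zpow_add₀ hq0, zpow_add₀ hq0, zpow_one, zpow_natCast]
    ring

/-- The exponent is symmetric in the two indices, while exchanging them reverses the sign when the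
total is odd. -/
theorem sum_range_pairTerm_odd {q : K} (hc2 : ‖(2 : K)‖ = 1) (n : ℕ) :
    ∑ k ∈ Finset.range (2 * n + 1 + 1), pairTerm q (k, 2 * n + 1 - k) = 0 := by
  have h5 : ∑ k ∈ Finset.range (2 * n + 1 + 1), pairTerm q (k, 2 * n + 1 - k) =
      -∑ k ∈ Finset.range (2 * n + 1 + 1), pairTerm q (k, 2 * n + 1 - k) := by
    conv_lhs => rw [← Finset.sum_range_reflect]
    rw [← Finset.sum_neg_distrib]
    refine Finset.sum_congr rfl fun k hk => ?_
    obtain ⟨s, hs'⟩ := Nat.exists_eq_add_of_le (Nat.lt_succ_iff.mp (Finset.mem_range.mp hk))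
    rw [hs', show k + s + 1 - 1 - k = s by omega, show k + s - s = k by omega,
      show k + s - k = s by omega]
    have e1 : (-1 : K) ^ k = -(-1) ^ s := by
      have : (-1 : K) ^ (k + s) = -1 := by rw [← hs']; exact Odd.neg_one_pow ⟨n, rfl⟩
      have h6 : (-1 : K) ^ s * (-1) ^ s = 1 := by rw [← mul_pow]; norm_num
      rw [pow_add] at this
      linear_combination (-1) ^ s * this - (-1) ^ k * h6
    simp only [pairTerm]
    rw [e1, neg_mul]
    congr 3
    have h7 := two_mul_tri (k + 2)
    have h8 := two_mul_tri (s + 1)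
    have h9 := two_mul_tri (s + 2)
    have h10 := two_mul_tri (k + 1)
    linarith
  have h7 : (2 : K) * ∑ k ∈ Finset.range (2 * n + 1 + 1), pairTerm q (k, 2 * n + 1 - k) = 0 := by
    linear_combination h5
  refine (mul_eq_zero.mp h7).resolve_left fun h => ?_
  rw [h, norm_zero] at hc2; exact zero_ne_one hc2

theorem tri_add_two (n : ℤ) : tri (n + 2) = tri n + 2 * n + 1 := by
  rw [tri_add, show tri 2 = 1 from rfl]; ring

theorem norm_pairTerm_le {q : K} (hq : ‖q‖ < 1) (x : ℕ × ℕ) :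
    ‖pairTerm q x‖ ≤ ‖q‖ ^ x.1 * ‖q‖ ^ x.2 := by
  obtain ⟨k, s⟩ := x
  have h1 : (0 : ℤ) ≤ tri (k + 2) + tri (s + 1) + (2 * k + 1) * s - (k + s) := by
    have := tri_nonneg k; have := tri_nonneg (s + 1)
    rw [tri_add_two]
    have : (0 : ℤ) ≤ k * s := by positivity
    linarith
  obtain ⟨e, he⟩ := Int.eq_ofNat_of_zero_le h1
  simp only [pairTerm]
  rw [show tri ((k : ℤ) + 2) + tri (s + 1) + (2 * k + 1) * s = ((k + s + e : ℕ) : ℤ) by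
    push_cast; linarith, zpow_natCast, norm_mul, norm_pow, norm_neg, norm_one, one_pow, one_mul,
    norm_pow, pow_add, pow_add]
  exact mul_le_of_le_one_right (by positivity) (pow_le_one₀ (norm_nonneg _) hq.le)

theorem tsum_pairTerm {q : K} (hq0 : q ≠ 0) (n : ℕ) :
    q ^ tri ((n : ℤ) + 2) * partialTheta q (2 * ((n : ℤ) + 2) - 3) =
    ∑' i, pairTerm q (n, i) := by
  rw [partialTheta, if_pos (by omega), ← tsum_mul_left]
  refine tsum_congr fun i => ?_
  simp only [pairTerm]
  rw [mul_left_comm, ← zpow_add₀ hq0]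
  congr 2; ring

/-- Reflection of the partial theta function makes the terms `l = n + 2` and `l = 1 - n` equal,
hence the factor 2. The remaining quadrant is summed along antidiagonals, of which only the even
ones contribute. -/
theorem tsum_partialTheta_eq {q : K} (hq0 : q ≠ 0) (hq : ‖q‖ < 1) (hc2 : ‖(2 : K)‖ = 1) :
    ∑' l : ℤ, q ^ tri l * partialTheta q (2 * l - 3) =
      2 * (q * ∑' n : ℕ, (-1) ^ n * q ^ (6 * (n + 1).choose 2) * signedSum q n) := by
  have hs : Summable fun l : ℤ => q ^ tri (l + 2) * partialTheta q (2 * (l + 2) - 3) := by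
    have h1 := (Equiv.addRight (2 : ℤ)).summable_iff.mpr
      (summable_mul_partialTheta hq0 hq fun l => 2 * l - 3)
    simpa only [Function.comp_def, Equiv.coe_addRight] using h1
  have h2 : ∀ n : ℕ, q ^ tri (-((n : ℤ) + 1) + 2) * partialTheta q (2 * (-((n : ℤ) + 1) + 2) - 3) =
      ∑' i, pairTerm q (n, i) := by
    intro n
    rw [← tsum_pairTerm hq0, show -((n : ℤ) + 1) + 2 = 1 - n by ring, tri_one_sub, tri_add_two,
      show 2 * (1 - (n : ℤ)) - 3 = -(2 * (n + 2) - 3) by ring, partialTheta_neg hq0, ← mul_assoc,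
      ← zpow_add₀ hq0]
    congr 2; ring
  have h3 : ∑' l : ℤ, q ^ tri l * partialTheta q (2 * l - 3) = 2 * ∑' n, ∑' i, pairTerm q (n, i) := by
    have h5 := (Equiv.addRight (2 : ℤ)).tsum_eq fun l => q ^ tri l * partialTheta q (2 * l - 3)
    have h4 := tsum_of_nat_of_neg_add_one
      (f := fun l : ℤ => q ^ tri (l + 2) * partialTheta q (2 * (l + 2) - 3))
      (by simpa only [Function.comp_def] using hs.comp_injective (Nat.cast_injective (R := ℤ)))
      (by simpa only [Function.comp_def] using
        hs.comp_injective (i := fun n : ℕ => -((n : ℤ) + 1)) fun a b h => by simpa using h)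
    simp only [Equiv.coe_addRight] at h5
    rw [← h5, h4, tsum_congr (tsum_pairTerm hq0), tsum_congr h2]; ring
  have h5 : Summable fun n : ℕ => ∑ k ∈ Finset.range (2 * n + 1), pairTerm q (k, 2 * n - k) := by
    simp_rw [sum_range_pairTerm_even hq0]
    exact (summable_signedSum hq0 hq (by norm_num)).mul_left q
  have h6 : Summable fun n : ℕ =>
      ∑ k ∈ Finset.range (2 * n + 1 + 1), pairTerm q (k, 2 * n + 1 - k) := by
    simp_rw [sum_range_pairTerm_odd hc2]
    exact summable_zero
  have h7 := tsum_even_add_odd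
    (f := fun N : ℕ => ∑ k ∈ Finset.range (N + 1), pairTerm q (k, N - k)) h5 h6
  rw [tsum_congr (sum_range_pairTerm_even hq0), tsum_congr (sum_range_pairTerm_odd hc2), tsum_zero,
    add_zero, tsum_mul_left] at h7
  rw [h3, h7, tsum_sum_range_eq (norm_nonneg _) hq (norm_pairTerm_le hq)]

theorem psiSum_mul_theta {q : K} (hq0 : q ≠ 0) (hq : ‖q‖ < 1) (h2 : ‖(2 : K)‖ = 1) :
    psiSum q * theta (q ^ 3) q = appell (q ^ 3) q := by
  have h3 := theta_one_mul hq0 hq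
  have h4 := theta_mul_tsum_partialTheta hq0 hq h2
  rw [tsum_partialTheta_eq hq0 hq h2] at h4
  have h5 : theta q 1 ≠ 0 := fun h => by
    rw [h, zero_mul] at h3; rw [← h3, norm_zero] at h2; exact zero_ne_one h2
  apply mul_left_cancel₀ h5
  rw [← h4, psiSum_eq hq0 hq, ← h3]
  ring

end Appell

end MockTheta

namespace MockTheta
open Filter Topology

/-! ### The Appell-Lerch form of `λ`. -/

section ThetaAppell

variable {K : Type*} [NormedField K] [IsUltrametricDist K] [CompleteSpace K]

/-- The assumption on `2` serves the exponent zero only, where `1 + q^0 = 2`; otherwise the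
ultrametric inequality decides. -/
theorem one_le_norm_one_add_zpow {q : K} (hq0 : q ≠ 0) (hq : ‖q‖ < 1) (h2 : ‖(2 : K)‖ = 1) (m : ℤ) :
    1 ≤ ‖1 + q ^ m‖ := by
  have hr0 : 0 < ‖q‖ := norm_pos_iff.mpr hq0
  rcases lt_trichotomy m 0 with h | rfl | h
  · have h3 : 1 < ‖q ^ m‖ := by rw [norm_zpow]; exact one_lt_zpow_of_neg₀ hr0 hq h
    rw [IsUltrametricDist.norm_add_eq_max_of_norm_ne_norm (by rw [norm_one]; exact h3.ne)]
    exact le_max_of_le_right h3.le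
  · rw [zpow_zero, one_add_one_eq_two, h2]
  · rw [norm_one_add_of_norm_lt]
    obtain ⟨n, rfl⟩ := Int.eq_ofNat_of_zero_le h.le
    exact_mod_cast norm_pow_lt_one hq (by omega)

theorem one_add_zpow_ne_zero {q : K} (hq0 : q ≠ 0) (hq : ‖q‖ < 1) (h2 : ‖(2 : K)‖ = 1) (m : ℤ) :
    1 + q ^ m ≠ 0 :=
  norm_pos_iff.mp (zero_lt_one.trans_le (one_le_norm_one_add_zpow hq0 hq h2 m))

theorem norm_inv_one_add_zpow_le {q : K} (hq0 : q ≠ 0) (hq : ‖q‖ < 1) (h2 : ‖(2 : K)‖ = 1) (m : ℤ) :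
    ‖(1 + q ^ m)⁻¹‖ ≤ 1 := by
  rw [norm_inv]; exact inv_le_one_of_one_le₀ (one_le_norm_one_add_zpow hq0 hq h2 m)

theorem tsum_int_eq_three {f : ℤ → K} (hf : Summable f) :
    ∑' u, f u = ∑' r, f (3 * r) + ∑' r, f (3 * r + 1) + ∑' r, f (3 * r - 1) := by
  have h0 : ∀ a : ℤ, Function.Injective fun r : ℤ => 3 * r + a := fun a x y h => by simpa using h
  let e : Fin 3 × ℤ ≃ ℤ := (Equiv.prodComm _ _).trans (Int.divModEquiv 3).symm
  have h1 : Summable (f ∘ e) := e.summable_iff.mpr hf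
  have h2 := h1.tsum_prod
  simp only [Function.comp_def] at h2
  rw [← e.tsum_eq f, h2, tsum_fintype, Fin.sum_univ_three, ← (Equiv.addRight (1 : ℤ)).tsum_eq
    (fun r => f (3 * r - 1))]
  congr 1
  · congr 1
    · refine tsum_congr fun r => congrArg f ?_
      simp [e, Int.divModEquiv]; ring
    · refine tsum_congr fun r => congrArg f ?_
      simp [e, Int.divModEquiv]; ring
  · refine tsum_congr fun r => congrArg f ?_
    simp [e, Int.divModEquiv]; ring

theorem zpow_pow_eq {q : K} (n : ℕ) (m : ℤ) : (q ^ n) ^ m = q ^ (n * m) := by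
  rw [← zpow_natCast q n, ← zpow_mul]

theorem theta_div {Q z : K} (hQ0 : Q ≠ 0) (hz : z ≠ 0) : theta Q (Q / z) = theta Q z := by
  have h1 := theta_eq_mul hQ0 (inv_ne_zero hz) 1
  rw [theta_inv hz, tri_one, zpow_zero, zpow_one, zpow_one, one_mul] at h1
  rw [div_eq_mul_inv, mul_comm]
  exact (mul_left_cancel₀ (inv_ne_zero hz) h1).symm

theorem theta_cube_zpow {q : K} (hq0 : q ≠ 0) (a r : ℤ) :
    q ^ ((3 * r + a) ^ 2) * theta (q ^ 3) (q ^ (2 * (3 * r + a))) =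
      q ^ (3 * r ^ 2 + 3 * r + 2 * a * r + a ^ 2) * theta (q ^ 3) (q ^ (2 * a)) := by
  rw [theta_eq_mul (pow_ne_zero 3 hq0) (zpow_ne_zero (2 * a) hq0) (2 * r), zpow_pow_eq, zpow_pow_eq,
    ← zpow_mul, ← zpow_add₀ hq0, ← zpow_add₀ hq0, ← mul_assoc, ← zpow_add₀ hq0]
  have h1 := two_mul_tri (2 * r)
  congr 2
  · push_cast; linarith
  · congr 1; push_cast; ring

theorem summable_quadratic_pair {q : K} (hq0 : q ≠ 0) (hq : ‖q‖ < 1) {v : ℤ → K} (hv : ∀ u, ‖v u‖ ≤ 1) :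
    Summable fun x : ℤ × ℤ => q ^ (x.1 ^ 2 + 2 * x.1 * x.2 + 3 * tri x.2) * v x.1 :=
  summable_zpow_mul hq0 hq _ (tendsto_cofinite_atTop_of_abs_add_abs_le 20 fun u k => by
    have h1 := mul_abs_le_tri 3 k
    have h2 := two_mul_tri k
    have h3 := le_abs_self k
    have h4 := abs_add_le (u + k) (-k)
    rw [add_neg_cancel_right, abs_neg] at h4
    have h5 := sq_abs (u + k)
    simp only
    nlinarith [sq_nonneg (|u + k| - 1), abs_nonneg (u + k)]) _ fun x => hv _

theorem tsum_quadratic_eq_theta {q : K} (hq0 : q ≠ 0) (u : ℤ) (c : K) :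
    ∑' k, q ^ (u ^ 2 + 2 * u * k + 3 * tri k) * c = q ^ (u ^ 2) * theta (q ^ 3) (q ^ (2 * u)) * c := by
  rw [theta, tsum_mul_right, ← tsum_mul_left]
  congr 1
  refine tsum_congr fun k => ?_
  rw [zpow_pow_eq, ← zpow_mul, ← zpow_add₀ hq0, ← zpow_add₀ hq0]
  congr 1; push_cast; ring

/-- Summing over `k` first gives `theta (q³)` at `q^(2u)`, which by quasi-periodicity depends, up to
a monomial, only on `u` modulo 3. The weight `v` is free: the constant `1` gives a theta identity,
and `1 / (1 + q^(2u))` gives `λ`, with the same coefficients. -/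
theorem tsum_quadratic_pair_eq {q : K} (hq0 : q ≠ 0) (hq : ‖q‖ < 1) {v : ℤ → K} (hv : ∀ u, ‖v u‖ ≤ 1) :
    ∑' k, ∑' u, q ^ (u ^ 2 + 2 * u * k + 3 * tri k) * v u =
      theta (q ^ 3) 1 * ∑' r : ℤ, q ^ (3 * r ^ 2 + 3 * r) * v (3 * r) +
      q⁻¹ * theta (q ^ 3) q * ∑' r : ℤ, q ^ (3 * r ^ 2 + 5 * r + 2) * v (3 * r + 1) +
      q⁻¹ * theta (q ^ 3) q * ∑' r : ℤ, q ^ (3 * r ^ 2 + r) * v (3 * r - 1) := by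
  have h0 := (summable_quadratic_pair hq0 hq hv).tsum_comm
    (f := fun u k => q ^ (u ^ 2 + 2 * u * k + 3 * tri k) * v u)
  have h1 := (summable_quadratic_pair hq0 hq hv).prod
  have h2 : Summable fun u : ℤ => q ^ (u ^ 2) * theta (q ^ 3) (q ^ (2 * u)) * v u := by
    simpa only [tsum_quadratic_eq_theta hq0] using h1
  have h3 : theta (q ^ 3) (q ^ (2 * (1 : ℤ))) = theta (q ^ 3) q := by
    rw [← theta_div (pow_ne_zero 3 hq0) hq0]
    congr 1; field_simp; norm_cast
  have h4 : theta (q ^ 3) (q ^ (2 * (-1 : ℤ))) = q ^ (-2 : ℤ) * theta (q ^ 3) q := by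
    rw [show 2 * (-1 : ℤ) = -(2 * 1) by ring, zpow_neg, theta_inv (zpow_ne_zero _ hq0), h3, zpow_neg]
    rfl
  rw [h0, tsum_congr fun u => tsum_quadratic_eq_theta hq0 u (v u), tsum_int_eq_three h2, ← tsum_mul_left, ← tsum_mul_left, ← tsum_mul_left]
  congr 1
  · congr 1
    · refine tsum_congr fun r => ?_
      have h5 := theta_cube_zpow hq0 0 r
      simp only [add_zero, mul_zero, zpow_zero, zero_mul, ne_eq, OfNat.ofNat_ne_zero,
        not_false_eq_true, zero_pow] at h5
      rw [h5]; ring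
    · refine tsum_congr fun r => ?_
      rw [theta_cube_zpow hq0 1 r, h3, show 3 * r ^ 2 + 3 * r + 2 * 1 * r + 1 ^ 2 =
        -1 + (3 * r ^ 2 + 5 * r + 2) by ring, zpow_add₀ hq0, zpow_neg_one]
      ring
  · refine tsum_congr fun r => ?_
    rw [sub_eq_add_neg, theta_cube_zpow hq0 (-1) r, h4, show 3 * r ^ 2 + 3 * r + 2 * (-1) * r + (-1) ^ 2 =
        2 + -1 + (3 * r ^ 2 + r) by ring, zpow_add₀ hq0, zpow_add₀ hq0, zpow_neg_one, zpow_neg]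
    have := zpow_ne_zero 2 hq0
    field_simp

theorem appell_eq {q : K} (hq0 : q ≠ 0) (a : ℕ) :
    appell (q ^ 6) (q ^ a) =
      ∑' r : ℤ, q ^ (3 * r ^ 2 + 3 * r + a * (r + 1)) * (1 + q ^ (6 * r + a))⁻¹ := by
  rw [appell, ← (Equiv.addRight (1 : ℤ)).tsum_eq]
  refine tsum_congr fun r => ?_
  rw [Equiv.coe_addRight, zpow_pow_eq, zpow_pow_eq, zpow_pow_eq, ← zpow_add₀ hq0, ← zpow_natCast q a,
    ← zpow_add₀ hq0, div_eq_mul_inv, add_sub_cancel_right]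
  have h1 := two_mul_tri (r + 1)
  congr 2
  push_cast; linarith

theorem theta_sq_self {q : K} (hq0 : q ≠ 0) : theta (q ^ 2) q = ∑' u : ℤ, q ^ (u ^ 2) := by
  refine tsum_congr fun u => ?_
  have h1 := two_mul_tri u
  rw [zpow_pow_eq, ← zpow_add₀ hq0]
  congr 1; push_cast; linarith

theorem theta_sq_shift {q : K} (hq0 : q ≠ 0) (k : ℤ) :
    ∑' u : ℤ, q ^ (u ^ 2 + 2 * u * k) = q ^ (-(k ^ 2)) * theta (q ^ 2) q := by
  rw [theta_sq_self hq0, ← (Equiv.addRight k).tsum_eq fun u => q ^ (u ^ 2), ← tsum_mul_left]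
  refine tsum_congr fun u => ?_
  rw [Equiv.coe_addRight, ← zpow_add₀ hq0]
  congr 1; ring

theorem theta_sq_mul_theta {q : K} (hq0 : q ≠ 0) (hq : ‖q‖ < 1) :
    theta (q ^ 2) q * theta q 1 =
      q * theta (q ^ 3) 1 * theta (q ^ 6) 1 + 2 * theta (q ^ 3) q * theta (q ^ 6) (q ^ 2) := by
  have h1 := tsum_quadratic_pair_eq hq0 hq (v := fun _ => 1) (by simp)
  have h2 : ∑' k : ℤ, ∑' u : ℤ, q ^ (u ^ 2 + 2 * u * k + 3 * tri k) * (1 : K) =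
      q⁻¹ * (theta (q ^ 2) q * theta q 1) := by
    have h3 : theta q 1 = ∑' k : ℤ, q ^ tri (k - 1) := by
      rw [theta, ← (Equiv.subRight (1 : ℤ)).tsum_eq]
      exact tsum_congr fun k => by rw [Equiv.subRight_apply, one_zpow, mul_one]
    rw [h3, ← tsum_mul_left, ← tsum_mul_left]
    refine tsum_congr fun k => ?_
    simp only [mul_one]
    rw [tsum_congr fun u => zpow_add₀ hq0 _ _, tsum_mul_right, theta_sq_shift hq0,
      mul_right_comm, ← zpow_add₀ hq0, mul_left_comm, ← zpow_neg_one, ← zpow_add₀ hq0,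
      mul_comm]
    congr 2
    have h4 := two_mul_tri k
    have h5 := two_mul_tri (k - 1)
    linarith
  have h3 : ∑' r : ℤ, q ^ (3 * r ^ 2 + 3 * r) = theta (q ^ 6) 1 := by
    rw [theta, ← (Equiv.addRight (1 : ℤ)).tsum_eq fun r => (q ^ 6) ^ tri r * 1 ^ r]
    refine tsum_congr fun r => ?_
    have h4 := two_mul_tri (r + 1)
    rw [Equiv.coe_addRight, zpow_pow_eq, one_zpow, mul_one]
    congr 1; push_cast; linarith
  have h6 : ∑' r : ℤ, q ^ (3 * r ^ 2 + 5 * r + 2) = theta (q ^ 6) (q ^ 2) := by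
    rw [theta, ← (Equiv.addRight (1 : ℤ)).tsum_eq fun r => (q ^ 6) ^ tri r * (q ^ 2) ^ r]
    refine tsum_congr fun r => ?_
    have h4 := two_mul_tri (r + 1)
    rw [Equiv.coe_addRight, zpow_pow_eq, zpow_pow_eq, ← zpow_add₀ hq0]
    congr 1; push_cast; linarith
  have h7 : ∑' r : ℤ, q ^ (3 * r ^ 2 + r) = theta (q ^ 6) (q ^ 2) := by
    rw [theta, ← (Equiv.neg ℤ).tsum_eq fun r => (q ^ 6) ^ tri r * (q ^ 2) ^ r]
    refine tsum_congr fun r => ?_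
    have h4 := two_mul_tri (-r)
    rw [Equiv.neg_apply, zpow_pow_eq, zpow_pow_eq, ← zpow_add₀ hq0]
    congr 1; push_cast; linarith
  rw [h2] at h1
  simp only [mul_one] at h1
  rw [h3, h6, h7] at h1
  field_simp at h1
  linear_combination h1

/-- `∑ q^{u²} w^k / (1 + w)` with `w = q^{2u}`. -/
noncomputable def thetaRatio (q : K) (k : ℤ) : K :=
  ∑' u : ℤ, q ^ (u ^ 2 + 2 * u * k) * (1 + q ^ (2 * u))⁻¹

theorem summable_thetaRatio {q : K} (hq0 : q ≠ 0) (hq : ‖q‖ < 1) (h2 : ‖(2 : K)‖ = 1) (k : ℤ) :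
    Summable fun u : ℤ => q ^ (u ^ 2 + 2 * u * k) * (1 + q ^ (2 * u))⁻¹ :=
  summable_zpow_mul hq0 hq _ (tendsto_cofinite_atTop_of_abs_le ((2 * |k| + 1) ^ 2) fun u => by
    have h1 : -(|u| * |k|) ≤ u * k := by rw [← abs_mul]; exact neg_abs_le _
    have h3 := sq_abs u
    nlinarith [sq_nonneg (|u| - (2 * |k| + 1)), sq_nonneg (2 * |k| + 1), abs_nonneg u, abs_nonneg k])
    _ fun u => norm_inv_one_add_zpow_le hq0 hq h2 _

theorem thetaRatio_add {q : K} (hq0 : q ≠ 0) (hq : ‖q‖ < 1) (h2 : ‖(2 : K)‖ = 1) (k : ℤ) :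
    thetaRatio q k + thetaRatio q (k + 1) = q ^ (-(k ^ 2)) * theta (q ^ 2) q := by
  rw [thetaRatio, thetaRatio, ← (summable_thetaRatio hq0 hq h2 k).tsum_add
    (summable_thetaRatio hq0 hq h2 (k + 1)), ← theta_sq_shift hq0]
  refine tsum_congr fun u => ?_
  have h3 := one_add_zpow_ne_zero hq0 hq h2 (2 * u)
  rw [show u ^ 2 + 2 * u * (k + 1) = u ^ 2 + 2 * u * k + 2 * u by ring,
    zpow_add₀ hq0 (u ^ 2 + 2 * u * k) (2 * u)]
  field_simp

theorem thetaRatio_one_sub {q : K} (hq0 : q ≠ 0) (hq : ‖q‖ < 1) (h2 : ‖(2 : K)‖ = 1) (k : ℤ) :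
    thetaRatio q (1 - k) = thetaRatio q k := by
  rw [thetaRatio, thetaRatio, ← (Equiv.neg ℤ).tsum_eq]
  refine tsum_congr fun u => ?_
  have h3 := one_add_zpow_ne_zero hq0 hq h2 (2 * u)
  have h4 := one_add_zpow_ne_zero hq0 hq h2 (2 * -u)
  have h5 : 1 + q ^ (2 * u) = q ^ (2 * u) * (1 + q ^ (2 * -u)) := by
    rw [mul_add, mul_one, ← zpow_add₀ hq0]; simp [add_comm]
  rw [Equiv.neg_apply, h5, show (-u) ^ 2 + 2 * -u * (1 - k) = u ^ 2 + 2 * u * k + -(2 * u) by ring,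
    zpow_add₀ hq0 _ (-(2 * u)), zpow_neg, mul_inv]
  ring

/-- Adding neighbouring values cancels the denominator and produces one term `q^(-k²)`. The
reflection `k ↦ 1 - k` makes the values at `0` and `1` equal, which fixes the start; iterating then
builds the signed sum. -/
theorem two_mul_thetaRatio {q : K} (hq0 : q ≠ 0) (hq : ‖q‖ < 1) (h2 : ‖(2 : K)‖ = 1) (n : ℕ) :
    2 * thetaRatio q (n + 1) = (-1) ^ n * signedSum q n * theta (q ^ 2) q := by
  induction n with
  | zero =>
    have h1 := thetaRatio_add hq0 hq h2 0
    have h3 := thetaRatio_one_sub hq0 hq h2 0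
    simp [signedSum] at h1 h3 ⊢
    linear_combination h1 + h3
  | succ n ih =>
    have h1 := thetaRatio_add hq0 hq h2 (n + 1)
    rw [zpow_neg] at h1
    rw [signedSum_succ, Nat.cast_succ]
    have h3 : q ^ (((n : ℤ) + 1) ^ 2) = q ^ (n + 1) ^ 2 := by
      rw [← zpow_natCast]; push_cast; rfl
    have h4 : (-1 : K) ^ n * (-1) ^ n = 1 := by rw [← mul_pow]; norm_num
    rw [h3] at h1
    rw [pow_succ]
    linear_combination 2 * h1 - ih - 2 * (q ^ (n + 1) ^ 2)⁻¹ * theta (q ^ 2) q * h4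

/-- Summing over `u` first produces `thetaRatio`, and over `k` first the Appell-Lerch sums. The
reflection folds `k = n + 1` onto `k = -n`, which absorbs the halves from `two_mul_thetaRatio`. -/
theorem theta_sq_mul_tsum {q : K} (hq0 : q ≠ 0) (hq : ‖q‖ < 1) (h2 : ‖(2 : K)‖ = 1) :
    theta (q ^ 2) q * ∑' n : ℕ, (-1) ^ n * q ^ (3 * (n + 1).choose 2) * signedSum q n =
      theta (q ^ 3) 1 * appell (q ^ 6) 1 + 2 * q⁻¹ * theta (q ^ 3) q * appell (q ^ 6) (q ^ 2) := by
  have h1 := tsum_quadratic_pair_eq hq0 hq (v := fun u => (1 + q ^ (2 * u))⁻¹)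
    fun u => norm_inv_one_add_zpow_le hq0 hq h2 _
  have h3 := (summable_quadratic_pair hq0 hq (v := fun u => (1 + q ^ (2 * u))⁻¹)
    fun u => norm_inv_one_add_zpow_le hq0 hq h2 _).prod_symm.prod
  have h4 : ∀ k : ℤ, ∑' u : ℤ, q ^ (u ^ 2 + 2 * u * k + 3 * tri k) * (1 + q ^ (2 * u))⁻¹ =
      q ^ (3 * tri k) * thetaRatio q k := by
    intro k
    rw [thetaRatio, ← tsum_mul_left]
    refine tsum_congr fun u => ?_
    rw [zpow_add₀ hq0 _ (3 * tri k)]; ring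
  simp only [Prod.fst_swap, Prod.snd_swap, h4] at h1 h3
  have h5 : ∀ n : ℕ, q ^ (3 * tri ((n : ℤ) + 1)) * thetaRatio q (n + 1) =
      theta (q ^ 2) q * ((-1) ^ n * q ^ (3 * (n + 1).choose 2) * signedSum q n) / 2 := by
    intro n
    have h6 := two_mul_thetaRatio hq0 hq h2 n
    have h7 : q ^ (3 * tri ((n : ℤ) + 1)) = q ^ (3 * (n + 1).choose 2) := by
      have := tri_natCast (n + 1)
      push_cast at this
      rw [this, ← zpow_natCast]; push_cast; rfl
    have h20 : (2 : K) ≠ 0 := norm_pos_iff.mp (by rw [h2]; exact one_pos)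
    rw [h7, eq_div_iff h20]
    linear_combination q ^ (3 * (n + 1).choose 2) * h6
  have h6 : ∀ n : ℕ, q ^ (3 * tri (-((n : ℤ) + 1) + 1)) * thetaRatio q (-((n : ℤ) + 1) + 1) =
      theta (q ^ 2) q * ((-1) ^ n * q ^ (3 * (n + 1).choose 2) * signedSum q n) / 2 := by
    intro n
    rw [← h5, show -((n : ℤ) + 1) + 1 = 1 - (n + 1) by ring, tri_one_sub,
      thetaRatio_one_sub hq0 hq h2]
  have h7 : Summable fun k : ℤ => q ^ (3 * tri (k + 1)) * thetaRatio q (k + 1) := by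
    have := (Equiv.addRight (1 : ℤ)).summable_iff.mpr h3
    simpa only [Function.comp_def, Equiv.coe_addRight] using this
  have h8 := tsum_of_nat_of_neg_add_one
    (f := fun k : ℤ => q ^ (3 * tri (k + 1)) * thetaRatio q (k + 1))
    (by simpa only [Function.comp_def] using h7.comp_injective (Nat.cast_injective (R := ℤ)))
    (by simpa only [Function.comp_def] using
      h7.comp_injective (i := fun n : ℕ => -((n : ℤ) + 1)) fun a b h => by simpa using h)
  have h9 := (Equiv.addRight (1 : ℤ)).tsum_eq fun k => q ^ (3 * tri k) * thetaRatio q k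
  simp only [Equiv.coe_addRight] at h9
  rw [tsum_congr h5, tsum_congr h6, h9, h1, tsum_div_const, tsum_mul_left] at h8
  have h20 : (2 : K) ≠ 0 := norm_pos_iff.mp (by rw [h2]; exact one_pos)
  rw [← two_mul, mul_div_cancel₀ _ h20] at h8
  rw [← h8]
  have a1 := appell_eq hq0 0
  have a2 := appell_eq hq0 2
  have a3 : ∑' r : ℤ, q ^ (3 * r ^ 2 + r) * (1 + q ^ (2 * (3 * r - 1)))⁻¹ = appell (q ^ 6) (q ^ 2) := by
    rw [a2, ← (Equiv.neg ℤ).tsum_eq]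
    refine tsum_congr fun r => ?_
    have h10 : 1 + q ^ (6 * r + (2 : ℕ)) = q ^ (6 * r + 2) * (1 + q ^ (2 * (3 * -r - 1))) := by
      rw [mul_add, mul_one, ← zpow_add₀ hq0, add_comm]
      congr 1
      rw [show 6 * r + 2 + 2 * (3 * -r - 1) = 0 by ring, zpow_zero]
    rw [Equiv.neg_apply, h10, mul_inv, ← mul_assoc, ← zpow_neg, ← zpow_add₀ hq0]
    congr 2; push_cast; ring
  have a4 : ∑' r : ℤ, q ^ (3 * r ^ 2 + 5 * r + 2) * (1 + q ^ (2 * (3 * r + 1)))⁻¹ =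
      appell (q ^ 6) (q ^ 2) := by
    rw [a2]
    refine tsum_congr fun r => ?_
    rw [show 3 * r ^ 2 + 3 * r + (2 : ℕ) * (r + 1) = 3 * r ^ 2 + 5 * r + 2 by push_cast; ring,
      show 6 * r + (2 : ℕ) = 2 * (3 * r + 1) by push_cast; ring]
  have a5 : ∑' r : ℤ, q ^ (3 * r ^ 2 + 3 * r) * (1 + q ^ (2 * (3 * r)))⁻¹ = appell (q ^ 6) 1 := by
    rw [pow_zero] at a1
    rw [a1]
    refine tsum_congr fun r => ?_
    rw [show 3 * r ^ 2 + 3 * r + (0 : ℕ) * (r + 1) = 3 * r ^ 2 + 3 * r by push_cast; ring,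
      show 6 * r + (0 : ℕ) = 2 * (3 * r) by push_cast; ring]
  rw [a3, a4, a5]
  ring

theorem theta_sq_mul_lambdaSum {q : K} (hq0 : q ≠ 0) (hq : ‖q‖ < 1) (h2 : ‖(2 : K)‖ = 1) :
    theta (q ^ 2) q * theta q 1 * lambdaSum q =
      2 * (theta (q ^ 3) 1 * appell (q ^ 6) 1 +
        2 * q⁻¹ * theta (q ^ 3) q * appell (q ^ 6) (q ^ 2)) := by
  rw [← theta_sq_mul_tsum hq0 hq h2, lambdaSum_eq hq0 hq, ← theta_one_mul hq0 hq]
  ring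

end ThetaAppell

end MockTheta

namespace MockTheta
open Filter Topology

/-! ### Lerch sums and differences of pole sums. -/

section Lerch

variable {K : Type*} [NormedField K]

/-- The points `x` such that `1 + x Q^n` is never small. -/
def Nondegenerate (Q x : K) : Prop := ∀ n : ℤ, 1 ≤ ‖1 + x * Q ^ n‖

/-- The sum `∑ y / (1 + y)^2` over `y = z Q^n`. -/
noncomputable def poleSum (Q z : K) : K := ∑' n : ℤ, z * Q ^ n / (1 + z * Q ^ n) ^ 2

/-- The bilateral Lerch sum `∑ z^n / (1 + x Q^n)`. -/
noncomputable def lerch (Q x z : K) : K := ∑' n : ℤ, z ^ n * (1 + x * Q ^ n)⁻¹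

variable [IsUltrametricDist K] [CompleteSpace K]

theorem max_le_norm_one_add {y : K} (h : 1 ≤ ‖1 + y‖) : max 1 ‖y‖ ≤ ‖1 + y‖ := by
  rcases le_or_gt ‖y‖ 1 with h1 | h1
  · rwa [max_eq_left h1]
  · rw [IsUltrametricDist.norm_add_eq_max_of_norm_ne_norm (by rw [norm_one]; exact h1.ne), norm_one]

namespace Nondegenerate

variable {Q x : K}

theorem ne_zero (hx : Nondegenerate Q x) (n : ℤ) : 1 + x * Q ^ n ≠ 0 :=
  norm_pos_iff.mp (zero_lt_one.trans_le (hx n))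

theorem norm_inv_le (hx : Nondegenerate Q x) (n : ℤ) : ‖(1 + x * Q ^ n)⁻¹‖ ≤ 1 := by
  rw [norm_inv]; exact inv_le_one_of_one_le₀ (hx n)

theorem norm_mul_inv_le (hx : Nondegenerate Q x) (n : ℤ) :
    ‖x * Q ^ n * (1 + x * Q ^ n)⁻¹‖ ≤ 1 := by
  rw [norm_mul, norm_inv, ← div_eq_mul_inv]
  exact div_le_one_of_le₀ ((le_max_right _ _).trans (max_le_norm_one_add (hx n))) (norm_nonneg _)

theorem inv (hQ0 : Q ≠ 0) (hx0 : x ≠ 0) (hx : Nondegenerate Q x) : Nondegenerate Q x⁻¹ := by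
  intro n
  have h1 := hx (-n)
  have h2 := (le_max_right _ _).trans (max_le_norm_one_add h1)
  have h3 : 1 + x⁻¹ * Q ^ n = x⁻¹ * Q ^ n * (1 + x * Q ^ (-n)) := by
    have := zpow_ne_zero n hQ0
    rw [zpow_neg]; field_simp; ring
  rw [h3, norm_mul]
  have h4 : ‖x⁻¹ * Q ^ n‖ * ‖x * Q ^ (-n)‖ = 1 := by
    have := zpow_ne_zero n hQ0
    rw [← norm_mul, zpow_neg, show x⁻¹ * Q ^ n * (x * (Q ^ n)⁻¹) = 1 by field_simp, norm_one]
  rw [← h4]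
  exact mul_le_mul_of_nonneg_left h2 (norm_nonneg _)

theorem of_norm {z : K} (hz1 : ‖z‖ < 1) (hQz : ‖Q‖ < ‖z‖) (hQ0 : Q ≠ 0) : Nondegenerate Q z := by
  intro n
  have hr0 : 0 < ‖Q‖ := norm_pos_iff.mpr hQ0
  have hQ1 := hQz.trans hz1
  have h1 : ‖z * Q ^ n‖ ≠ 1 := by
    rw [norm_mul, norm_zpow]
    rcases le_or_gt 0 n with h | h
    · exact ((mul_le_of_le_one_right (norm_nonneg _)
        (zpow_le_one₀ hr0 hQ1.le h)).trans_lt hz1).ne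
    · have h2 : ‖Q‖ ^ (-1 : ℤ) ≤ ‖Q‖ ^ n := zpow_le_zpow_right_of_le_one₀ hr0 hQ1.le (by omega)
      rw [zpow_neg_one] at h2
      refine ne_of_gt (lt_of_lt_of_le ?_ (mul_le_mul_of_nonneg_left h2 (norm_nonneg _)))
      rw [← div_eq_mul_inv, one_lt_div hr0]; exact hQz
  rw [IsUltrametricDist.norm_add_eq_max_of_norm_ne_norm (by rw [norm_one]; exact h1.symm), norm_one]
  exact le_max_left _ _

end Nondegenerate

instance nonarchimedeanRing_of_isUltrametricDist : NonarchimedeanRing K where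
  is_nonarchimedean := NonarchimedeanAddGroup.is_nonarchimedean

theorem summable_of_norm_le_mul {t : ℤ × ℤ → K} {f g : ℤ → K} (hf : Summable f) (hg : Summable g)
    (h : ∀ x, ‖t x‖ ≤ ‖f x.1‖ * ‖g x.2‖) : Summable t := by
  apply NonarchimedeanAddGroup.summable_of_tendsto_cofinite_zero
  have h1 := (hf.mul_of_nonarchimedean hg).tendsto_cofinite_zero.norm
  rw [norm_zero] at h1
  refine squeeze_zero_norm (fun x => ?_) h1
  rw [norm_mul]; exact h x

/-- The shear `(n, i) ↦ (n + i, i)` of `ℤ × ℤ`. -/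
def shear : ℤ × ℤ ≃ ℤ × ℤ :=
  ⟨fun x => (x.1 + x.2, x.2), fun y => (y.1 - y.2, y.2), fun x => by simp, fun y => by simp⟩

theorem tsum_tsum_add_eq {f : ℤ × ℤ → K} (hf : Summable f) :
    ∑' n, ∑' i, f (n + i, i) = ∑' x, f x := by
  have h1 : Summable (f ∘ shear) := shear.summable_iff.mpr hf
  have h2 := h1.tsum_prod
  simp only [Function.comp_def] at h2
  rw [← shear.tsum_eq f, h2]
  rfl

/-- For `i ≥ 0` the decay is that of `(Q / z)^i`. For `i < 0` the reflected partial theta function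
removes `Q^i` and leaves `z^(-i)`. Hence the annulus `‖Q‖ < ‖z‖ < 1`. -/
theorem summable_dual {Q z : K} (hQ0 : Q ≠ 0) (hz1 : ‖z‖ < 1) (hQz : ‖Q‖ < ‖z‖) :
    Summable fun i : ℤ => Q ^ i * z ^ (-i) * partialTheta Q i := by
  have hr0 : 0 < ‖Q‖ := norm_pos_iff.mpr hQ0
  have hz0 : 0 < ‖z‖ := hr0.trans hQz
  have hQ1 := hQz.trans hz1
  set ρ := max (‖Q‖ / ‖z‖) ‖z‖ with hρ
  have hρ0 : 0 < ρ := lt_max_of_lt_right hz0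
  have hρ1 : ρ < 1 := max_lt ((div_lt_one hz0).mpr hQz) hz1
  refine summable_of_norm_le_zpow hρ0 hρ1 1 (fun i => |i|)
    (tendsto_cofinite_atTop_of_abs_le 0 fun n => by simp) fun i => ?_
  rw [one_mul]
  rcases le_or_gt 0 i with hi | hi
  · rw [norm_mul, abs_of_nonneg hi]
    refine (mul_le_of_le_one_right (norm_nonneg _) (norm_partialTheta_le hQ1 i)).trans ?_
    rw [norm_mul, norm_zpow, norm_zpow, zpow_neg, ← inv_zpow, ← mul_zpow, ← div_eq_mul_inv]
    exact zpow_le_zpow_left₀ hi (by positivity) (le_max_left _ _)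
  · have h1 := partialTheta_neg hQ0 (-i)
    rw [neg_neg] at h1
    rw [abs_of_neg hi, h1, show Q ^ i * z ^ (-i) * (Q ^ (-i) * partialTheta Q (-i)) =
      (Q ^ i * Q ^ (-i)) * z ^ (-i) * partialTheta Q (-i) by ring, ← zpow_add₀ hQ0, add_neg_cancel,
      zpow_zero, one_mul, norm_mul]
    refine (mul_le_of_le_one_right (norm_nonneg _) (norm_partialTheta_le hQ1 _)).trans ?_
    rw [norm_zpow]
    exact zpow_le_zpow_left₀ (by omega) hz0.le (le_max_right _ _)

theorem tsum_mul_kernel {Q x z : K} (hQ0 : Q ≠ 0) (hz1 : ‖z‖ < 1) (hQz : ‖Q‖ < ‖z‖) (hx : x ≠ 0) :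
    ∑' n : ℤ, z ^ n * (Q ^ tri n * x ^ n * kernel Q (x * Q ^ n)) =
      theta Q (x * z) * ∑' i : ℤ, Q ^ i * z ^ (-i) * partialTheta Q i := by
  have hQ1 := hQz.trans hz1
  have hz : z ≠ 0 := norm_pos_iff.mp ((norm_pos_iff.mpr hQ0).trans hQz)
  have h1 := summable_theta hQ0 hQ1 (mul_ne_zero hx hz)
  have h2 := summable_dual hQ0 hz1 hQz
  rw [theta, tsum_mul_tsum_of_nonarchimedean h1 h2, ← tsum_tsum_add_eq (h1.mul_of_nonarchimedean h2)]
  refine tsum_congr fun n => ?_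
  rw [kernel, ← tsum_mul_left, ← tsum_mul_left]
  refine tsum_congr fun i => ?_
  simp only [kernelCoeff]
  rw [tri_add_one, tri_add, mul_zpow x z, zpow_add₀ hx, zpow_add₀ hz, zpow_add₀ hQ0, zpow_add₀ hQ0,
    zpow_add₀ hQ0, mul_zpow, ← zpow_mul, zpow_neg]
  have := zpow_ne_zero i hz
  field_simp

/-- At `x = -1` the kernel vanishes at every `-Q^n` with `n ≠ 0`, since theta does and the linear
factor does not. Only `n = 0` survives, with value `kernel Q (-1)`. -/
theorem dual_mul_theta [CharZero K] {Q z : K} (hQ0 : Q ≠ 0) (hz1 : ‖z‖ < 1) (hQz : ‖Q‖ < ‖z‖) :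
    theta Q (-z) * ∑' i : ℤ, Q ^ i * z ^ (-i) * partialTheta Q i = eulerProd Q Q ^ 3 := by
  have hQ1 := hQz.trans hz1
  have h1 := tsum_mul_kernel hQ0 hz1 hQz (neg_ne_zero.mpr (one_ne_zero (α := K)))
  rw [neg_one_mul] at h1
  rw [← h1, tsum_eq_single 0]
  · simp [kernel_neg_one hQ0 hQ1]
  · intro n hn
    have h2 := one_add_mul_kernel hQ0 hQ1 (y := -1 * Q ^ n)
      (mul_ne_zero (by norm_num) (zpow_ne_zero _ hQ0))
    rw [neg_one_mul, theta_neg_zpow hQ0] at h2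
    have h3 : 1 + -Q ^ n ≠ 0 := by
      rw [← sub_eq_add_neg]
      exact sub_ne_zero.mpr (zpow_ne_one_of_norm_lt hQ0 hQ1 hn).symm
    rw [neg_one_mul, (mul_eq_zero.mp h2).resolve_left h3]
    ring

/-- A case of Ramanujan's bilateral sum, also known as Kronecker's formula. Expanding `theta / (1 +
y)` at `y = xQ^n` makes `theta Q (x * z)` split off as a factor, and the cofactor is known from `x =
-1`. -/
theorem theta_mul_lerch [CharZero K] {Q x z : K} (hQ0 : Q ≠ 0) (hz1 : ‖z‖ < 1) (hQz : ‖Q‖ < ‖z‖)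
    (hx0 : x ≠ 0) (hx : Nondegenerate Q x) :
    theta Q x * theta Q (-z) * lerch Q x z = theta Q (x * z) * eulerProd Q Q ^ 3 := by
  have hQ1 := hQz.trans hz1
  rw [← dual_mul_theta hQ0 hz1 hQz, mul_left_comm, ← tsum_mul_kernel hQ0 hz1 hQz hx0,
    mul_comm (theta Q x), mul_assoc, lerch, ← tsum_mul_left]
  congr 1
  refine tsum_congr fun n => ?_
  rw [theta_eq_mul hQ0 hx0 n, ← one_add_mul_kernel hQ0 hQ1 (mul_ne_zero hx0 (zpow_ne_zero n hQ0))]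
  have := hx.ne_zero n
  field_simp

section Telescope

variable {Q x : K}

theorem tendsto_zpow_atTop_nhds_zero (hQ0 : Q ≠ 0) (hQ1 : ‖Q‖ < 1) :
    Tendsto (fun n : ℤ => x * Q ^ n) atTop (𝓝 0) := by
  rw [tendsto_zero_iff_norm_tendsto_zero]
  have h := (tendsto_zpow_atTop_zero (norm_pos_iff.mpr hQ0) hQ1).const_mul ‖x‖
  simpa only [norm_mul, norm_zpow, mul_zero] using h

theorem tendsto_inv_one_add_atTop (hQ0 : Q ≠ 0) (hQ1 : ‖Q‖ < 1) :
    Tendsto (fun n : ℤ => (1 + x * Q ^ n)⁻¹) atTop (𝓝 1) := by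
  have h := ((tendsto_zpow_atTop_nhds_zero (x := x) hQ0 hQ1).const_add 1).inv₀ (by simp)
  simpa using h

theorem tendsto_inv_one_add_atBot (hQ0 : Q ≠ 0) (hQ1 : ‖Q‖ < 1) (hx0 : x ≠ 0)
    (hx : Nondegenerate Q x) : Tendsto (fun n : ℤ => (1 + x * Q ^ n)⁻¹) atBot (𝓝 0) := by
  have h1 := (tendsto_zpow_atTop_nhds_zero (x := x⁻¹) hQ0 hQ1).comp tendsto_neg_atBot_atTop
  rw [tendsto_zero_iff_norm_tendsto_zero] at h1
  refine squeeze_zero_norm (fun n => ?_) h1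
  have h2 := hx.norm_mul_inv_le n
  have h3 : (1 + x * Q ^ n)⁻¹ = x⁻¹ * Q ^ (-n) * (x * Q ^ n * (1 + x * Q ^ n)⁻¹) := by
    have := zpow_ne_zero n hQ0
    rw [zpow_neg]; field_simp
  rw [h3, norm_mul]
  exact mul_le_of_le_one_right (norm_nonneg _) h2

/-- The sequence tends to `1` at `+∞` and to `0` at `-∞`, so each unit shift contributes one. -/
theorem hasSum_telescope (hQ0 : Q ≠ 0) (hQ1 : ‖Q‖ < 1) (hx0 : x ≠ 0) (hx : Nondegenerate Q x) (d : ℤ) :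
    HasSum (fun m : ℤ => (1 + x * Q ^ m)⁻¹ - (1 + x * Q ^ (m - d))⁻¹) (d : K) := by
  set u : ℤ → K := fun m => (1 + x * Q ^ m)⁻¹ with hu
  have ht := tendsto_inv_one_add_atTop (x := x) hQ0 hQ1
  have hb := tendsto_inv_one_add_atBot hQ0 hQ1 hx0 hx
  have h1 : HasSum (fun m : ℤ => u m - u (m - 1)) 1 := by
    have hs : Summable fun m : ℤ => u m - u (m - 1) := by
      apply NonarchimedeanAddGroup.summable_of_tendsto_cofinite_zero
      rw [Int.cofinite_eq, tendsto_sup]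
      constructor
      · simpa [hu, sub_eq_add_neg] using hb.sub (hb.comp (tendsto_atBot_add_const_right _ (-1) tendsto_id))
      · simpa [hu, sub_eq_add_neg] using ht.sub (ht.comp (tendsto_atTop_add_const_right _ (-1) tendsto_id))
    have e1 : HasSum (fun n : ℕ => u n - u (n - 1)) (1 - u (-1)) := by
      have h2 : Summable fun n : ℕ => u n - u (n - 1) := by
        simpa only [Function.comp_def] using hs.comp_injective (Nat.cast_injective (R := ℤ))
      rw [h2.hasSum_iff_tendsto_nat]
      have h3 : ∀ N : ℕ, ∑ n ∈ Finset.range N, (u n - u (n - 1)) = u (N - 1) - u (-1) := by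
        intro N
        induction N with
        | zero => simp
        | succ N ih => rw [Finset.sum_range_succ, ih]; push_cast; rw [add_sub_cancel_right]; ring
      simp_rw [h3]
      have h4 : Tendsto (fun N : ℕ => (N : ℤ) - 1) atTop atTop :=
        tendsto_atTop_add_const_right _ (-1) tendsto_natCast_atTop_atTop
      exact (ht.comp h4).sub_const _
    have e2 : HasSum (fun n : ℕ => u (-((n : ℤ) + 1)) - u (-((n : ℤ) + 1) - 1)) (u (-1) - 0) := by
      have h2 : Summable fun n : ℕ => u (-((n : ℤ) + 1)) - u (-((n : ℤ) + 1) - 1) := by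
        simpa only [Function.comp_def] using
          hs.comp_injective (i := fun n : ℕ => -((n : ℤ) + 1)) fun a b h => by simpa using h
      rw [h2.hasSum_iff_tendsto_nat]
      have h3 : ∀ N : ℕ, ∑ n ∈ Finset.range N, (u (-((n : ℤ) + 1)) - u (-((n : ℤ) + 1) - 1)) =
          u (-1) - u (-((N : ℤ) + 1)) := by
        intro N
        induction N with
        | zero => simp
        | succ N ih =>
          rw [Finset.sum_range_succ, ih, show -((N : ℤ) + 1) - 1 = -(((N + 1 : ℕ) : ℤ) + 1) by
            push_cast; ring]
          ring
      simp_rw [h3]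
      have h4 : Tendsto (fun N : ℕ => -((N : ℤ) + 1)) atTop atBot :=
        tendsto_neg_atTop_atBot.comp (tendsto_atTop_add_const_right _ 1 tendsto_natCast_atTop_atTop)
      exact (hb.comp h4).const_sub _
    have e3 := HasSum.of_nat_of_neg_add_one (f := fun m : ℤ => u m - u (m - 1)) e1 e2
    simpa using e3
  have h2 : ∀ d : ℤ, HasSum (fun m : ℤ => u (m - d) - u (m - d - 1)) 1 := fun d => by
    have := (Equiv.subRight d).hasSum_iff.mpr h1
    simpa only [Function.comp_def, Equiv.subRight_apply] using this
  change HasSum (fun m : ℤ => u m - u (m - d)) (d : K)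
  induction d using Int.induction_on with
  | zero => simp
  | succ d ih =>
    convert ih.add (h2 d) using 1
    · funext m
      rw [sub_sub m]; ring
    · push_cast; ring
  | pred d ih =>
    have h3 := ih.sub (h2 (-d - 1))
    have h4 : (fun m : ℤ => u m - u (m - -(d : ℤ)) - (u (m - (-d - 1)) - u (m - (-d - 1) - 1))) =
        fun m => u m - u (m - (-d - 1)) := by
      funext m
      rw [sub_sub m (-(d : ℤ) - 1), sub_add_cancel]; ring
    have h5 : ((-(d : ℤ) - 1 : ℤ) : K) = ((-(d : ℤ) : ℤ) : K) - 1 := by push_cast; ring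
    rw [h4] at h3
    rw [h5]
    exact h3

theorem summable_lerch {z : K} (hQ0 : Q ≠ 0) (hz1 : ‖z‖ < 1) (hQz : ‖Q‖ < ‖z‖) (hx0 : x ≠ 0)
    (hx : Nondegenerate Q x) : Summable fun n : ℤ => z ^ n * (1 + x * Q ^ n)⁻¹ := by
  have hr0 : 0 < ‖Q‖ := norm_pos_iff.mpr hQ0
  have hz0 : 0 < ‖z‖ := hr0.trans hQz
  set ρ := max (‖Q‖ / ‖z‖) ‖z‖ with hρ
  have hρ0 : 0 < ρ := lt_max_of_lt_right hz0
  have hρ1 : ρ < 1 := max_lt ((div_lt_one hz0).mpr hQz) hz1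
  refine summable_of_norm_le_zpow hρ0 hρ1 (max 1 ‖x⁻¹‖) (fun i => |i|)
    (tendsto_cofinite_atTop_of_abs_le 0 fun n => by simp) fun i => ?_
  rcases le_or_gt 0 i with hi | hi
  · rw [norm_mul, abs_of_nonneg hi]
    refine (mul_le_of_le_one_right (norm_nonneg _) (hx.norm_inv_le i)).trans ?_
    rw [norm_zpow]
    refine (zpow_le_zpow_left₀ hi hz0.le (le_max_right (‖Q‖ / ‖z‖) _)).trans ?_
    exact le_mul_of_one_le_left (by positivity) (le_max_left _ _)
  · have h3 : z ^ i * (1 + x * Q ^ i)⁻¹ =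
        x⁻¹ * (Q ^ (-i) * z ^ i) * (x * Q ^ i * (1 + x * Q ^ i)⁻¹) := by
      have := zpow_ne_zero i hQ0
      rw [zpow_neg]; field_simp
    rw [abs_of_neg hi, h3, norm_mul]
    refine (mul_le_of_le_one_right (norm_nonneg _) (hx.norm_mul_inv_le i)).trans ?_
    rw [norm_mul]
    refine mul_le_mul (le_max_right _ _) ?_ (norm_nonneg _) (by positivity)
    have h4 : Q ^ (-i) * z ^ i = (Q / z) ^ (-i) := by
      rw [div_zpow, zpow_neg z, div_inv_eq_mul]
    rw [h4, norm_zpow, norm_div]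
    exact zpow_le_zpow_left₀ (by omega) (by positivity) (le_max_left _ _)

/-- Partial fractions turn the product, times `1 - Q^d`, into a telescoping difference. The value
does not depend on `x`. -/
theorem tsum_inv_mul_inv (hQ0 : Q ≠ 0) (hQ1 : ‖Q‖ < 1) (hx0 : x ≠ 0) (hx : Nondegenerate Q x) (d : ℤ) :
    (1 - Q ^ d) * ∑' t : ℤ, (1 + x * Q ^ t)⁻¹ * (1 + x⁻¹ * Q ^ (d - t))⁻¹ = d := by
  rw [← (hasSum_telescope hQ0 hQ1 hx0 hx d).tsum_eq, ← tsum_mul_left]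
  refine tsum_congr fun t => ?_
  have h1 := hx.ne_zero t
  have h2 := hx.ne_zero (t - d)
  have h3 := (hx.inv hQ0 hx0).ne_zero (d - t)
  have h4 := zpow_ne_zero t hQ0
  have h5 := zpow_ne_zero d hQ0
  rw [zpow_sub₀ hQ0] at h2 h3 ⊢
  rw [zpow_sub₀ hQ0 t d]
  have h6 : 1 + x⁻¹ * (Q ^ d / Q ^ t) = x⁻¹ * (Q ^ d / Q ^ t) * (1 + x * (Q ^ t / Q ^ d)) := by
    field_simp; ring
  have h7 : Q ^ d + x * Q ^ t ≠ 0 := fun h => h2 (by field_simp; rw [h, mul_zero])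
  rw [h6]
  field_simp
  ring

theorem tsum_inv_mul_inv_zero (hQ0 : Q ≠ 0) (hx0 : x ≠ 0) (hx : Nondegenerate Q x) :
    ∑' t : ℤ, (1 + x * Q ^ t)⁻¹ * (1 + x⁻¹ * Q ^ (0 - t))⁻¹ = poleSum Q x := by
  refine tsum_congr fun t => ?_
  have h1 := hx.ne_zero t
  have h4 := zpow_ne_zero t hQ0
  have h6 : 1 + x⁻¹ * Q ^ (0 - t) = x⁻¹ * (Q ^ t)⁻¹ * (1 + x * Q ^ t) := by
    rw [zero_sub, zpow_neg]; field_simp; ring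
  rw [h6]
  field_simp

theorem hasSum_lerch_mul_lerch {z : K} (hQ0 : Q ≠ 0) (hz1 : ‖z‖ < 1) (hQz : ‖Q‖ < ‖z‖) (hx0 : x ≠ 0)
    (hx : Nondegenerate Q x) :
    HasSum (fun d : ℤ => z ^ d * ∑' t : ℤ, (1 + x * Q ^ t)⁻¹ * (1 + x⁻¹ * Q ^ (d - t))⁻¹)
      (lerch Q x z * lerch Q x⁻¹ z) := by
  have hz : z ≠ 0 := norm_pos_iff.mp ((norm_pos_iff.mpr hQ0).trans hQz)
  have h1 := summable_lerch hQ0 hz1 hQz hx0 hx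
  have h2 := summable_lerch hQ0 hz1 hQz (inv_ne_zero hx0) (hx.inv hQ0 hx0)
  have h3 := h1.mul_of_nonarchimedean h2
  let e : ℤ × ℤ ≃ ℤ × ℤ :=
    ⟨fun x => (x.2, x.1 - x.2), fun y => (y.1 + y.2, y.1), fun x => by simp, fun y => by simp⟩
  have h4 := e.summable_iff.mpr h3
  have h5 := h4.prod.hasSum
  have h6 := e.tsum_eq (fun i : ℤ × ℤ => (z ^ i.1 * (1 + x * Q ^ i.1)⁻¹) *
    (z ^ i.2 * (1 + x⁻¹ * Q ^ i.2)⁻¹))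
  rw [← h4.tsum_prod] at h5
  simp only [Function.comp_def] at h5
  rw [h6, ← tsum_mul_tsum_of_nonarchimedean h1 h2] at h5
  refine h5.congr_fun fun d => ?_
  rw [← tsum_mul_left]
  refine tsum_congr fun t => ?_
  simp only [e, Equiv.coe_fn_mk]
  rw [show z ^ d = z ^ t * z ^ (d - t) by rw [← zpow_add₀ hz]; congr 1; ring]
  ring

/-- As a Laurent series in `z`, the product has coefficients `d / (1 - Q^d)` for `d ≠ 0`, the same
for every `x`. Only the constant coefficient depends on `x`, and it is the pole sum. -/
theorem lerch_mul_lerch_sub {z : K} (hQ0 : Q ≠ 0) (hz1 : ‖z‖ < 1) (hQz : ‖Q‖ < ‖z‖) (hx0 : x ≠ 0)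
    (hx : Nondegenerate Q x) {y : K} (hy0 : y ≠ 0) (hy : Nondegenerate Q y) :
    lerch Q x z * lerch Q x⁻¹ z - lerch Q y z * lerch Q y⁻¹ z = poleSum Q x - poleSum Q y := by
  have hQ1 := hQz.trans hz1
  have h1 := (hasSum_lerch_mul_lerch hQ0 hz1 hQz hx0 hx).sub
    (hasSum_lerch_mul_lerch hQ0 hz1 hQz hy0 hy)
  rw [← h1.tsum_eq, tsum_eq_single 0]
  · rw [tsum_inv_mul_inv_zero hQ0 hx0 hx, tsum_inv_mul_inv_zero hQ0 hy0 hy]; simp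
  · intro d hd
    have h2 : 1 - Q ^ d ≠ 0 := sub_ne_zero.mpr (zpow_ne_one_of_norm_lt hQ0 hQ1 hd).symm
    have h3 := tsum_inv_mul_inv hQ0 hQ1 hx0 hx d
    rw [← tsum_inv_mul_inv hQ0 hQ1 hy0 hy d] at h3
    rw [mul_left_cancel₀ h2 h3, sub_self]

theorem theta_ne_zero {z : K} (hz1 : ‖z‖ < 1) (hQz : ‖Q‖ < ‖z‖) (hQ0 : Q ≠ 0) : theta Q z ≠ 0 := by
  have hQ1 := hQz.trans hz1
  have hz0 : 0 < ‖z‖ := (norm_pos_iff.mpr hQ0).trans hQz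
  rw [theta_eq_eulerProd hQ0 hQ1 (norm_pos_iff.mp hz0)]
  refine mul_ne_zero (mul_ne_zero (eulerProd_ne_zero hQ1 ?_) (eulerProd_ne_zero hQ1 ?_))
    (eulerProd_ne_zero hQ1 hQ1)
  · rwa [norm_neg]
  · rw [norm_neg, norm_div]; exact (div_lt_one hz0).mpr hQz

/-- Taking the second point to be `-z` annihilates one of its Lerch sums, because `theta Q (-1) =
0`. A single product of Lerch sums remains, and Kronecker's formula evaluates it. -/
theorem poleSum_sub_poleSum_neg [CharZero K] {z : K} (hQ0 : Q ≠ 0) (hz1 : ‖z‖ < 1) (hQz : ‖Q‖ < ‖z‖)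
    (hx0 : x ≠ 0) (hx : Nondegenerate Q x) :
    theta Q x ^ 2 * theta Q (-z) ^ 2 * (poleSum Q x - poleSum Q (-z)) =
      eulerProd Q Q ^ 6 * (x * theta Q (x * z) * theta Q (x⁻¹ * z)) := by
  have hz : z ≠ 0 := norm_pos_iff.mp ((norm_pos_iff.mpr hQ0).trans hQz)
  have hnz1 : ‖-z‖ < 1 := by rwa [norm_neg]
  have hnQz : ‖Q‖ < ‖-z‖ := by rwa [norm_neg]
  have hnz : -z ≠ 0 := neg_ne_zero.mpr hz
  have hy := Nondegenerate.of_norm hnz1 hnQz hQ0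
  have hθ := theta_ne_zero hnz1 hnQz hQ0
  have h1 : lerch Q (-z)⁻¹ z = 0 := by
    have h2 := theta_mul_lerch hQ0 hz1 hQz (inv_ne_zero hnz) (hy.inv hQ0 hnz)
    rw [show (-z)⁻¹ * z = -1 by field_simp, theta_neg_one, zero_mul, theta_inv hnz] at h2
    exact (mul_eq_zero.mp h2).resolve_left (mul_ne_zero (mul_ne_zero (inv_ne_zero hnz) hθ) hθ)
  have h3 := lerch_mul_lerch_sub hQ0 hz1 hQz hx0 hx hnz hy
  rw [h1, mul_zero, sub_zero] at h3
  have h4 := theta_mul_lerch hQ0 hz1 hQz hx0 hx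
  have h5 := theta_mul_lerch hQ0 hz1 hQz (inv_ne_zero hx0) (hx.inv hQ0 hx0)
  rw [theta_inv hx0] at h5
  have h6 : theta Q x * theta Q (-z) * lerch Q x⁻¹ z =
      x * (theta Q (x⁻¹ * z) * eulerProd Q Q ^ 3) := by
    rw [← h5]; field_simp
  rw [← h3]
  linear_combination theta Q x * theta Q (-z) * lerch Q x⁻¹ z * h4 +
    theta Q (x * z) * eulerProd Q Q ^ 3 * h6

end Telescope

end Lerch

end MockTheta

namespace MockTheta
open Filter Topology

/-! ### Differences of Appell-Lerch sums as differences of pole sums. -/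

section AppellRelation

variable {K : Type*} [NormedField K]

/-- The sums `∑ Q^{r(r-1)/2} z^r y^{i+1} / (1 + y)` with `y = z Q^r`. -/
noncomputable def appellMoment (Q z : K) (i : ℤ) : K :=
  ∑' r : ℤ, Q ^ tri r * z ^ r * (z * Q ^ r) ^ i * (z * Q ^ r * (1 + z * Q ^ r)⁻¹)

variable [IsUltrametricDist K] [CompleteSpace K]

theorem summable_mul_of_norm_le_one {ι : Type*} {f u : ι → K} (hf : Summable f) (hu : ∀ i, ‖u i‖ ≤ 1) :
    Summable fun i => f i * u i := by
  apply NonarchimedeanAddGroup.summable_of_tendsto_cofinite_zero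
  have h1 := hf.tendsto_cofinite_zero.norm
  rw [norm_zero] at h1
  refine squeeze_zero_norm (fun i => ?_) h1
  rw [norm_mul]
  exact mul_le_of_le_one_right (norm_nonneg _) (hu i)

variable {Q z : K}

theorem summable_theta_shift (hQ0 : Q ≠ 0) (hQ1 : ‖Q‖ < 1) (hz : z ≠ 0) (i : ℤ) :
    Summable fun r : ℤ => Q ^ tri r * z ^ r * (z * Q ^ r) ^ i := by
  refine ((summable_theta hQ0 hQ1 (mul_ne_zero hz (zpow_ne_zero i hQ0))).mul_left (z ^ i)).congr
    fun r => ?_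
  rw [mul_zpow, mul_zpow, ← zpow_mul, ← zpow_mul, mul_comm r i]; ring

theorem summable_appellMoment (hQ0 : Q ≠ 0) (hQ1 : ‖Q‖ < 1) (hz0 : z ≠ 0) (hz : Nondegenerate Q z)
    (i : ℤ) : Summable fun r : ℤ =>
      Q ^ tri r * z ^ r * (z * Q ^ r) ^ i * (z * Q ^ r * (1 + z * Q ^ r)⁻¹) :=
  summable_mul_of_norm_le_one (summable_theta_shift hQ0 hQ1 hz0 i) hz.norm_mul_inv_le

/-- Adding neighbouring moments cancels the denominator and leaves a shifted theta series. -/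
theorem appellMoment_add (hQ0 : Q ≠ 0) (hQ1 : ‖Q‖ < 1) (hz0 : z ≠ 0) (hz : Nondegenerate Q z) (i : ℤ) :
    Q ^ tri (i + 1) * (appellMoment Q z (i + 1) + appellMoment Q z i) = theta Q z := by
  rw [theta_eq_mul hQ0 hz0 (i + 1), mul_assoc]
  congr 1
  rw [appellMoment, appellMoment, ← (summable_appellMoment hQ0 hQ1 hz0 hz (i + 1)).tsum_add
    (summable_appellMoment hQ0 hQ1 hz0 hz i), theta, ← tsum_mul_left]
  refine tsum_congr fun r => ?_
  have h1 := hz.ne_zero r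
  have h2 : z * Q ^ r ≠ 0 := mul_ne_zero hz0 (zpow_ne_zero _ hQ0)
  have h3 : z ^ (i + 1) * (Q ^ tri r * (z * Q ^ (i + 1)) ^ r) =
      Q ^ tri r * z ^ r * (z * Q ^ r) ^ i * (z * Q ^ r) := by
    rw [mul_assoc _ ((z * Q ^ r) ^ i), ← zpow_add_one₀ h2, mul_zpow, mul_zpow, ← zpow_mul, ← zpow_mul,
      mul_comm r (i + 1)]
    ring
  rw [h3, zpow_add_one₀ h2]
  field_simp
  ring

theorem appellMoment_zero (hQ0 : Q ≠ 0) (hz0 : z ≠ 0) : appellMoment Q z 0 = appell Q z := by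
  rw [appell, ← (Equiv.addRight (1 : ℤ)).tsum_eq]
  refine tsum_congr fun r => ?_
  rw [Equiv.coe_addRight, tri_add_one, zpow_add₀ hQ0, zpow_add_one₀ hz0, add_sub_cancel_right, zpow_zero,
    mul_comm (Q ^ r) z, div_eq_mul_inv]
  ring

theorem summable_appellMoment_pair (hQ0 : Q ≠ 0) (hQ1 : ‖Q‖ < 1) (hz0 : z ≠ 0) (hz : Nondegenerate Q z) :
    Summable fun x : ℤ × ℤ => kernelCoeff Q x.2 *
      (Q ^ tri x.1 * z ^ x.1 * (z * Q ^ x.1) ^ x.2 * (z * Q ^ x.1 * (1 + z * Q ^ x.1)⁻¹)) := by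
  have hr0 : 0 < ‖Q‖ := norm_pos_iff.mpr hQ0
  let w : ℤ → K := fun r => z * Q ^ r * (1 + z * Q ^ r)⁻¹
  have hw1 : ∀ r, ‖w r‖ ≤ 1 := hz.norm_mul_inv_le
  have hw2 : ∀ r, ‖w r‖ ≤ ‖z * Q ^ r‖ := fun r => by
    rw [norm_mul]; exact mul_le_of_le_one_right (norm_nonneg _) (hz.norm_inv_le r)
  classical
  -- `c s` has norm `max 1 ‖z Q^s‖`. For negative `i` the partial theta factor has lost its power of
  -- `Q`, so the decay in `i` comes from `z Q^(s-i)`, at the cost of this factor, which the theta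
  -- terms absorb.
  let c : ℤ → K := fun s => if ‖z * Q ^ s‖ ≤ 1 then 1 else z * Q ^ s
  have hc1 : ∀ s, 1 ≤ ‖c s‖ := fun s => by
    simp only [c]; split_ifs with h
    · rw [norm_one]
    · exact (not_le.mp h).le
  have hc2 : ∀ s, ‖z * Q ^ s‖ ≤ ‖c s‖ := fun s => by
    simp only [c]; split_ifs with h
    · rwa [norm_one]
    · exact le_rfl
  have hf : Summable fun s : ℤ => Q ^ tri s * z ^ s * c s := by
    apply NonarchimedeanAddGroup.summable_of_tendsto_cofinite_zero
    have h1 := (summable_theta hQ0 hQ1 hz0).tendsto_cofinite_zero.norm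
    have h2 := (summable_theta_shift hQ0 hQ1 hz0 1).tendsto_cofinite_zero.norm
    have h3 := h1.add h2
    rw [norm_zero, add_zero] at h3
    refine squeeze_zero_norm (fun s => ?_) h3
    simp only [c, zpow_one]
    split_ifs
    · rw [mul_one]; exact le_add_of_nonneg_right (norm_nonneg _)
    · exact le_add_of_nonneg_left (norm_nonneg _)
  have hg : Summable fun i : ℤ => Q ^ |i| :=
    summable_zpow hQ0 hQ1 _ (tendsto_cofinite_atTop_of_abs_le 0 fun n => by simp)
  have hG : Summable fun x : ℤ × ℤ =>
      (Q ^ tri x.1 * z ^ x.1) * (Q ^ x.2 * partialTheta Q x.2) * w (x.1 - x.2) := by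
    refine summable_of_norm_le_mul hf hg fun x => ?_
    obtain ⟨s, i⟩ := x
    simp only
    have key : ‖Q ^ i * partialTheta Q i‖ * ‖w (s - i)‖ ≤ ‖c s‖ * ‖Q ^ |i|‖ := by
      rcases le_or_gt 0 i with hi | hi
      · rw [abs_of_nonneg hi, norm_mul, mul_comm ‖c s‖]
        refine mul_le_mul ?_ ((hw1 _).trans (hc1 s)) (norm_nonneg _) (norm_nonneg _)
        exact mul_le_of_le_one_right (norm_nonneg _) (norm_partialTheta_le hQ1 i)
      · have h1 := partialTheta_neg hQ0 (-i)
        rw [neg_neg] at h1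
        rw [abs_of_neg hi, h1, ← mul_assoc, ← zpow_add₀ hQ0, add_neg_cancel, zpow_zero, one_mul]
        refine (mul_le_of_le_one_left (norm_nonneg _) (norm_partialTheta_le hQ1 _)).trans ?_
        refine (hw2 _).trans ?_
        rw [sub_eq_add_neg, zpow_add₀ hQ0, ← mul_assoc, norm_mul]
        exact mul_le_mul_of_nonneg_right (hc2 s) (norm_nonneg _)
    rw [norm_mul, norm_mul, norm_mul _ (c s), mul_assoc, mul_assoc]
    exact mul_le_mul_of_nonneg_left key (norm_nonneg _)
  refine (shear.summable_iff.mpr hG).congr fun x => ?_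
  obtain ⟨n, i⟩ := x
  simp only [shear, Function.comp, Equiv.coe_fn_mk, kernelCoeff, w, add_sub_cancel_right]
  rw [tri_add_one, tri_add, zpow_add₀ hz0, zpow_add₀ hQ0, zpow_add₀ hQ0, zpow_add₀ hQ0, mul_zpow,
    ← zpow_mul]
  ring

/-- One of the two factors `1 + y` under each term divides theta; expanding that quotient as the
kernel series and summing over `n` first produces the moments. -/
theorem theta_mul_poleSum (hQ0 : Q ≠ 0) (hQ1 : ‖Q‖ < 1) (hz0 : z ≠ 0) (hz : Nondegenerate Q z) :
    theta Q z * poleSum Q z = ∑' i : ℤ, kernelCoeff Q i * appellMoment Q z i := by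
  have h1 := (summable_appellMoment_pair hQ0 hQ1 hz0 hz).tsum_comm (f := fun n i => kernelCoeff Q i *
      (Q ^ tri n * z ^ n * (z * Q ^ n) ^ i * (z * Q ^ n * (1 + z * Q ^ n)⁻¹)))
  simp only [tsum_mul_left (a := kernelCoeff Q _)] at h1
  simp only [appellMoment]
  rw [h1, poleSum, ← tsum_mul_left]
  refine tsum_congr fun n => ?_
  have h2 : z * Q ^ n ≠ 0 := mul_ne_zero hz0 (zpow_ne_zero _ hQ0)
  have h3 : ∑' i : ℤ, kernelCoeff Q i *
      (Q ^ tri n * z ^ n * (z * Q ^ n) ^ i * (z * Q ^ n * (1 + z * Q ^ n)⁻¹)) =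
      Q ^ tri n * z ^ n * (z * Q ^ n * (1 + z * Q ^ n)⁻¹) * kernel Q (z * Q ^ n) := by
    rw [kernel, ← tsum_mul_left]
    exact tsum_congr fun i => by ring
  have h4 := hz.ne_zero n
  rw [h3, theta_eq_mul hQ0 hz0 n, ← one_add_mul_kernel hQ0 hQ1 h2]
  field_simp

/-- The inhomogeneous part of the moment recurrence is the theta function itself, so the cross
difference of moments at `z` and `z'` only alternates in sign with `i`. Pairing it with the kernel
coefficients gives `kernel Q (-1)`, the cube on the left. -/
theorem appell_sub {z' : K} (hQ0 : Q ≠ 0) (hQ1 : ‖Q‖ < 1) (hz0 : z ≠ 0) (hz : Nondegenerate Q z)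
    (hz0' : z' ≠ 0) (hz' : Nondegenerate Q z') :
    eulerProd Q Q ^ 3 * (appell Q z * theta Q z' - appell Q z' * theta Q z) =
      theta Q z * theta Q z' * (poleSum Q z - poleSum Q z') := by
  let d : ℤ → K := fun i => appellMoment Q z i * theta Q z' - appellMoment Q z' i * theta Q z
  have hd : ∀ i, d (i + 1) = -d i := by
    intro i
    have h1 := appellMoment_add hQ0 hQ1 hz0 hz i
    have h2 := appellMoment_add hQ0 hQ1 hz0' hz' i
    have h3 := zpow_ne_zero (tri (i + 1)) hQ0
    simp only [d]
    apply mul_left_cancel₀ h3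
    linear_combination theta Q z' * h1 - theta Q z * h2
  have hd' : ∀ i, d i = (-1) ^ i * d 0 := by
    intro i
    induction i using Int.induction_on with
    | zero => simp
    | succ i ih => rw [hd, ih, zpow_add_one₀ (by norm_num)]; ring
    | pred i ih =>
      have h1 := hd (-i - 1)
      rw [sub_add_cancel, ih] at h1
      rw [zpow_sub_one₀ (by norm_num)]
      linear_combination h1
  have hs : ∀ {y : K}, y ≠ 0 → Nondegenerate Q y →
      Summable fun i : ℤ => kernelCoeff Q i * appellMoment Q y i := by
    intro y hy0 hy
    have h1 := (summable_appellMoment_pair hQ0 hQ1 hy0 hy).prod_symm.prod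
    refine h1.congr fun i => ?_
    simp only [Prod.fst_swap, Prod.snd_swap]
    rw [appellMoment, tsum_mul_left]
  have h1 := theta_mul_poleSum hQ0 hQ1 hz0 hz
  have h2 := theta_mul_poleSum hQ0 hQ1 hz0' hz'
  have h3 : theta Q z * theta Q z' * (poleSum Q z - poleSum Q z') =
      theta Q z' * (theta Q z * poleSum Q z) - theta Q z * (theta Q z' * poleSum Q z') := by ring
  rw [h3, h1, h2, ← tsum_mul_left, ← tsum_mul_left,
    ← ((hs hz0 hz).mul_left _).tsum_sub ((hs hz0' hz').mul_left _), ← kernel_neg_one hQ0 hQ1, kernel,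
    ← tsum_mul_right]
  refine tsum_congr fun i => ?_
  have h4 := hd' i
  simp only [d, appellMoment_zero hQ0 hz0, appellMoment_zero hQ0 hz0'] at h4
  linear_combination -kernelCoeff Q i * h4

end AppellRelation

end MockTheta

namespace MockTheta
open Filter Topology

/-! ### Symmetries of pole sums and doubling of the base. -/

section PoleSum

variable {K : Type*} [NormedField K] [IsUltrametricDist K] [CompleteSpace K] {Q z : K}

theorem summable_poleSum (hQ0 : Q ≠ 0) (hQ1 : ‖Q‖ < 1) (hz0 : z ≠ 0) (hz : Nondegenerate Q z) :
    Summable fun n : ℤ => z * Q ^ n / (1 + z * Q ^ n) ^ 2 := by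
  have h1 : ∀ n : ℤ, z * Q ^ n / (1 + z * Q ^ n) ^ 2 =
      z * Q ^ n * (1 + z * Q ^ n)⁻¹ * (1 + z * Q ^ n)⁻¹ := fun n => by
    have := hz.ne_zero n
    field_simp
  apply NonarchimedeanAddGroup.summable_of_tendsto_cofinite_zero
  simp_rw [h1]
  rw [Int.cofinite_eq, tendsto_sup]
  constructor
  · have h2 := (tendsto_inv_one_add_atBot hQ0 hQ1 hz0 hz).norm
    rw [norm_zero] at h2
    refine squeeze_zero_norm (fun n => ?_) h2
    rw [norm_mul]
    exact mul_le_of_le_one_left (norm_nonneg _) (hz.norm_mul_inv_le n)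
  · have h2 := (tendsto_zpow_atTop_nhds_zero (x := z) hQ0 hQ1).norm
    rw [norm_zero] at h2
    refine squeeze_zero_norm (fun n => ?_) h2
    rw [mul_assoc, norm_mul]
    refine mul_le_of_le_one_right (norm_nonneg _) ?_
    rw [norm_mul]
    exact mul_le_one₀ (hz.norm_inv_le n) (norm_nonneg _) (hz.norm_inv_le n)

theorem tsum_int_eq_two {f : ℤ → K} (hf : Summable f) :
    ∑' u, f u = ∑' r, f (2 * r) + ∑' r, f (2 * r + 1) := by
  let e : Fin 2 × ℤ ≃ ℤ := (Equiv.prodComm _ _).trans (Int.divModEquiv 2).symm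
  have h1 : Summable (f ∘ e) := e.summable_iff.mpr hf
  have h2 := h1.tsum_prod
  simp only [Function.comp_def] at h2
  rw [← e.tsum_eq f, h2, tsum_fintype, Fin.sum_univ_two]
  congr 1
  · refine tsum_congr fun r => congrArg f ?_
    simp [e, Int.divModEquiv]; ring
  · refine tsum_congr fun r => congrArg f ?_
    simp [e, Int.divModEquiv]; ring

theorem poleSum_eq_add (hQ0 : Q ≠ 0) (hQ1 : ‖Q‖ < 1) (hz0 : z ≠ 0) (hz : Nondegenerate Q z) :
    poleSum Q z = poleSum (Q ^ 2) z + poleSum (Q ^ 2) (z * Q) := by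
  rw [poleSum, tsum_int_eq_two (summable_poleSum hQ0 hQ1 hz0 hz), poleSum, poleSum]
  congr 1
  · refine tsum_congr fun n => ?_
    rw [zpow_pow_eq]; rfl
  · refine tsum_congr fun n => ?_
    rw [zpow_pow_eq, zpow_add_one₀ hQ0, mul_assoc z Q, mul_comm Q]; rfl

theorem poleSum_inv (hQ0 : Q ≠ 0) (hz0 : z ≠ 0) : poleSum Q z⁻¹ = poleSum Q z := by
  rw [poleSum, poleSum, ← (Equiv.neg ℤ).tsum_eq]
  refine tsum_congr fun n => ?_
  have h1 := zpow_ne_zero n hQ0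
  rw [Equiv.neg_apply, zpow_neg, show z⁻¹ * (Q ^ n)⁻¹ = (z * Q ^ n)⁻¹ by rw [mul_inv],
    show 1 + (z * Q ^ n)⁻¹ = (z * Q ^ n)⁻¹ * (1 + z * Q ^ n) by field_simp; ring, mul_pow]
  field_simp

theorem poleSum_mul (hQ0 : Q ≠ 0) : poleSum Q (z * Q) = poleSum Q z := by
  rw [poleSum, poleSum, ← (Equiv.addRight (1 : ℤ)).tsum_eq fun n => z * Q ^ n / (1 + z * Q ^ n) ^ 2]
  refine tsum_congr fun n => ?_
  rw [Equiv.coe_addRight, zpow_add_one₀ hQ0, mul_assoc z, mul_comm Q]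

/-- Termwise, `y/(1+y)² - y/(1-y)² = -4y²/(1-y²)²`. -/
theorem poleSum_add_neg (hQ0 : Q ≠ 0) (hQ1 : ‖Q‖ < 1) (hz0 : z ≠ 0) (hz : Nondegenerate Q z)
    (hz' : Nondegenerate Q (-z)) :
    poleSum Q z + poleSum Q (-z) = 4 * poleSum (Q ^ 2) (-z ^ 2) := by
  rw [poleSum, poleSum, poleSum, ← (summable_poleSum hQ0 hQ1 hz0 hz).tsum_add
    (summable_poleSum hQ0 hQ1 (neg_ne_zero.mpr hz0) hz'), ← tsum_mul_left]
  refine tsum_congr fun n => ?_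
  have h1 := hz.ne_zero n
  have h2 := hz'.ne_zero n
  have h3 : -z ^ 2 * (Q ^ 2) ^ n = -(z * Q ^ n) ^ 2 := by
    have h4 : (Q ^ 2) ^ n = (Q ^ n) ^ 2 := by
      rw [zpow_pow_eq, ← zpow_natCast (Q ^ n), ← zpow_mul, mul_comm]
    rw [h4]
    ring
  rw [h3, show 1 + -(z * Q ^ n) ^ 2 = (1 + z * Q ^ n) * (1 + -z * Q ^ n) by ring]
  rw [neg_mul] at h2 ⊢
  generalize z * Q ^ n = y at *
  field_simp
  ring

end PoleSum

/-! ### Eta quotients for the theta products. -/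

section Products

variable {K : Type*} [NormedField K] [IsUltrametricDist K] [CompleteSpace K]

theorem poch_three_mul {R : Type*} [CommRing R] (a p : R) (n : ℕ) :
    poch a p (3 * n) = poch a (p ^ 3) n * poch (a * p) (p ^ 3) n * poch (a * p ^ 2) (p ^ 3) n := by
  induction n with
  | zero => simp
  | succ n ih =>
    rw [show 3 * (n + 1) = 3 * n + 1 + 1 + 1 by ring, poch_succ, poch_succ, poch_succ, ih, poch_succ,
      poch_succ, poch_succ]
    ring

theorem eulerProd_eq_mul_cube {p : K} (hp : ‖p‖ < 1) (a : K) :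
    eulerProd a p = eulerProd a (p ^ 3) * eulerProd (a * p) (p ^ 3) * eulerProd (a * p ^ 2) (p ^ 3) := by
  have hp3 := norm_pow_lt_one hp three_ne_zero
  refine tendsto_nhds_unique
    ((tendsto_poch hp a).comp (tendsto_id.const_mul_atTop' (by norm_num : 0 < 3))) ?_
  exact (((tendsto_poch hp3 a).mul (tendsto_poch hp3 (a * p))).mul
    (tendsto_poch hp3 (a * p ^ 2))).congr fun n => (poch_three_mul a p n).symm

variable {q : K}

theorem eulerProd_pow_eq_mul_sq (hq : ‖q‖ < 1) (a : ℕ) {k : ℕ} (hk : k ≠ 0) :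
    eulerProd (q ^ a) (q ^ k) =
      eulerProd (q ^ a) (q ^ (2 * k)) * eulerProd (q ^ (a + k)) (q ^ (2 * k)) := by
  rw [eulerProd_eq_mul_sq (norm_pow_lt_one hq hk), ← pow_add, ← pow_mul, mul_comm k]

theorem eulerProd_pow_eq_mul_cube (hq : ‖q‖ < 1) (a : ℕ) {k : ℕ} (hk : k ≠ 0) :
    eulerProd (q ^ a) (q ^ k) = eulerProd (q ^ a) (q ^ (3 * k)) *
      eulerProd (q ^ (a + k)) (q ^ (3 * k)) * eulerProd (q ^ (a + 2 * k)) (q ^ (3 * k)) := by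
  rw [eulerProd_eq_mul_cube (norm_pow_lt_one hq hk), show (q ^ k) ^ 3 = q ^ (3 * k) by ring,
    show q ^ a * (q ^ k) ^ 2 = q ^ (a + 2 * k) by ring, ← pow_add]

theorem eulerProd_pow_mul_neg (hq : ‖q‖ < 1) (a : ℕ) {k : ℕ} (hk : k ≠ 0) :
    eulerProd (-q ^ a) (q ^ k) * eulerProd (q ^ a) (q ^ k) = eulerProd (q ^ (2 * a)) (q ^ (2 * k)) := by
  rw [mul_comm, eulerProd_mul_neg (norm_pow_lt_one hq hk), ← pow_mul, ← pow_mul, mul_comm a, mul_comm k]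

theorem theta_neg_pow_eq (hq0 : q ≠ 0) (hq : ‖q‖ < 1) (a b : ℕ) (hab : a + b ≠ 0) :
    theta (q ^ (a + b)) (-q ^ a) = eulerProd (q ^ a) (q ^ (a + b)) * eulerProd (q ^ b) (q ^ (a + b)) *
      eulerProd (q ^ (a + b)) (q ^ (a + b)) := by
  rw [theta_eq_eulerProd (pow_ne_zero _ hq0) (norm_pow_lt_one hq hab)
    (neg_ne_zero.mpr (pow_ne_zero a hq0)), neg_neg, div_neg, neg_neg, pow_add, mul_div_cancel_left₀ _
    (pow_ne_zero a hq0)]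

theorem theta_pow_mul (hq0 : q ≠ 0) (hq : ‖q‖ < 1) (a b : ℕ) (hab : a + b ≠ 0) :
    theta (q ^ (a + b)) (q ^ a) *
      (eulerProd (q ^ a) (q ^ (a + b)) * eulerProd (q ^ b) (q ^ (a + b))) =
      eulerProd (q ^ (2 * a)) (q ^ (2 * (a + b))) * eulerProd (q ^ (2 * b)) (q ^ (2 * (a + b))) *
      eulerProd (q ^ (a + b)) (q ^ (a + b)) := by
  rw [theta_eq_eulerProd (pow_ne_zero _ hq0) (norm_pow_lt_one hq hab) (pow_ne_zero a hq0),
    ← eulerProd_pow_mul_neg hq a hab, ← eulerProd_pow_mul_neg hq b hab,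
    show q ^ (a + b) / q ^ a = q ^ b by rw [pow_add, mul_div_cancel_left₀ _ (pow_ne_zero a hq0)]]
  ring

theorem theta_sq_self_mul (hq0 : q ≠ 0) (hq : ‖q‖ < 1) :
    theta (q ^ 2) q * (eulerProd (q ^ 1) (q ^ 1) ^ 2 * eulerProd (q ^ 4) (q ^ 4) ^ 2) =
      eulerProd (q ^ 2) (q ^ 2) ^ 5 := by
  have h1 := theta_pow_mul hq0 hq 1 1 (by norm_num)
  have h2 := eulerProd_pow_eq_mul_sq hq 1 (k := 1) (by norm_num)
  have h3 := eulerProd_pow_eq_mul_sq hq 2 (k := 2) (by norm_num)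
  norm_num at h1 h2 h3 ⊢
  rw [h2]
  linear_combination eulerProd (q ^ 2) (q ^ 2) ^ 2 * eulerProd (q ^ 4) (q ^ 4) ^ 2 * h1 -
    eulerProd (q ^ 2) (q ^ 2) ^ 3 * (eulerProd (q ^ 2) (q ^ 2) + eulerProd (q ^ 2) (q ^ 4) *
    eulerProd (q ^ 4) (q ^ 4)) * h3

theorem eulerProd_pow_ne_zero (hq : ‖q‖ < 1) {a k : ℕ} (ha : a ≠ 0) (hk : k ≠ 0) :
    eulerProd (q ^ a) (q ^ k) ≠ 0 :=
  eulerProd_ne_zero (norm_pow_lt_one hq hk) (norm_pow_lt_one hq ha)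

/-- The three identities between theta functions to the base `q ^ 6` that are needed to evaluate
products of them as eta quotients. -/
theorem theta_product_identities (hq0 : q ≠ 0) (hq : ‖q‖ < 1) :
    2 * theta (q ^ 3) 1 * theta (q ^ 6) (-q ^ 2) ^ 2 * theta (q ^ 6) q ^ 2 =
      theta (q ^ 2) q * theta q 1 * theta (q ^ 6) 1 * theta (q ^ 6) (-q ^ 3) * theta (q ^ 6) (-q) ∧
    eulerProd (q ^ 6) (q ^ 6) * theta (q ^ 6) (q ^ 2) * theta (q ^ 6) 1 *
      (eulerProd (q ^ 2) (q ^ 2) ^ 3 * eulerProd (q ^ 12) (q ^ 12)) =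
      2 * eulerProd (q ^ 4) (q ^ 4) ^ 3 * theta (q ^ 6) q ^ 2 * theta (q ^ 6) (-q) ^ 2 ∧
    eulerProd (q ^ 6) (q ^ 6) ^ 3 * theta (q ^ 6) 1 *
      (eulerProd (q ^ 2) (q ^ 2) * eulerProd (q ^ 4) (q ^ 4)) =
      2 * eulerProd (q ^ 12) (q ^ 12) ^ 3 * theta (q ^ 6) (q ^ 2) * theta (q ^ 6) (-q ^ 2) ^ 2 := by
  have e0 (n : ℕ) (hn : n ≠ 0) := theta_one_eq (pow_ne_zero n hq0) (norm_pow_lt_one hq hn)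
  have t0 := e0 6 (by norm_num)
  have s0 := e0 3 (by norm_num)
  have r0 := e0 1 (by norm_num)
  have t1 := theta_pow_mul hq0 hq 1 5 (by norm_num)
  have t2 := theta_pow_mul hq0 hq 2 4 (by norm_num)
  have m1 := theta_neg_pow_eq hq0 hq 1 5 (by norm_num)
  have m2 := theta_neg_pow_eq hq0 hq 2 4 (by norm_num)
  have m3 := theta_neg_pow_eq hq0 hq 3 3 (by norm_num)
  have ph := theta_sq_self_mul hq0 hq
  have j1 := eulerProd_pow_eq_mul_cube hq 1 (k := 1) (by norm_num)
  have j11 := eulerProd_pow_eq_mul_sq hq 1 (k := 3) (by norm_num)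
  have j12 := eulerProd_pow_eq_mul_sq hq 2 (k := 3) (by norm_num)
  have j3 := eulerProd_pow_eq_mul_sq hq 3 (k := 3) (by norm_num)
  have j2 := eulerProd_pow_eq_mul_cube hq 2 (k := 2) (by norm_num)
  have j4 := eulerProd_pow_eq_mul_cube hq 4 (k := 4) (by norm_num)
  have a2 := eulerProd_pow_eq_mul_sq hq 2 (k := 6) (by norm_num)
  have a4 := eulerProd_pow_eq_mul_sq hq 4 (k := 6) (by norm_num)
  have a6 := eulerProd_pow_eq_mul_sq hq 6 (k := 6) (by norm_num)
  have n1 := eulerProd_pow_ne_zero hq (a := 1) (k := 6) (by norm_num) (by norm_num)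
  have n3 := eulerProd_pow_ne_zero hq (a := 3) (k := 6) (by norm_num) (by norm_num)
  have n5 := eulerProd_pow_ne_zero hq (a := 5) (k := 6) (by norm_num) (by norm_num)
  have k2 := eulerProd_pow_ne_zero hq (a := 2) (k := 12) (by norm_num) (by norm_num)
  have k4 := eulerProd_pow_ne_zero hq (a := 4) (k := 12) (by norm_num) (by norm_num)
  have k6 := eulerProd_pow_ne_zero hq (a := 6) (k := 12) (by norm_num) (by norm_num)
  have k8 := eulerProd_pow_ne_zero hq (a := 8) (k := 12) (by norm_num) (by norm_num)
  have k10 := eulerProd_pow_ne_zero hq (a := 10) (k := 12) (by norm_num) (by norm_num)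
  have k12 := eulerProd_pow_ne_zero hq (a := 12) (k := 12) (by norm_num) (by norm_num)
  simp only [← pow_mul] at t0 s0 r0
  simp only [Nat.reduceAdd, Nat.reduceMul, pow_one] at *
  clear e0 hq hq0
  -- Every product is resolved into residue classes modulo 6 or 12. With the class products as free
  -- symbols, the three claims become identities of rational monomials.
  generalize eulerProd q (q ^ 6) = A1 at *
  generalize eulerProd (q ^ 2) (q ^ 6) = A2 at *
  generalize eulerProd (q ^ 3) (q ^ 6) = A3 at *
  generalize eulerProd (q ^ 4) (q ^ 6) = A4 at *
  generalize eulerProd (q ^ 5) (q ^ 6) = A5 at *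
  generalize eulerProd (q ^ 6) (q ^ 6) = A6 at *
  generalize eulerProd (q ^ 2) (q ^ 12) = B2 at *
  generalize eulerProd (q ^ 4) (q ^ 12) = B4 at *
  generalize eulerProd (q ^ 6) (q ^ 12) = B6 at *
  generalize eulerProd (q ^ 8) (q ^ 12) = B8 at *
  generalize eulerProd (q ^ 10) (q ^ 12) = B10 at *
  generalize eulerProd (q ^ 12) (q ^ 12) = B12 at *
  rw [j11, j12, j3] at j1
  rw [m1, m2, m3, j2, j4]
  rw [j3] at s0
  rw [j1, j2] at r0
  rw [j1, j2, j4] at ph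
  clear m1 m2 m3 j1 j2 j3 j4 j11 j12
  subst a2 a4 a6
  replace t0 := eq_div_of_mul_eq (mul_ne_zero k6 k12) t0
  replace t1 := eq_div_of_mul_eq (mul_ne_zero n1 n5) t1
  replace s0 := eq_div_of_mul_eq (by simp [*]) s0
  replace r0 := eq_div_of_mul_eq (by simp [*]) r0
  replace t2 := eq_div_of_mul_eq (by simp [*]) t2
  replace ph := eq_div_of_mul_eq (by simp [*]) ph
  rw [t0, t1, s0, r0, t2, ph]
  refine ⟨?_, ?_, ?_⟩ <;> field_simp

end Products

end MockTheta

/-! ### The eta quotient formula for `qλ(q) - 2ψ(q²)`. -/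

namespace MockTheta

variable {K : Type*} [NormedField K] [IsUltrametricDist K] [CompleteSpace K] {q : K}

theorem norm_pow_lt_norm_pow (hq0 : q ≠ 0) (hq : ‖q‖ < 1) {a b : ℕ} (hab : a < b) :
    ‖q ^ b‖ < ‖q ^ a‖ := by
  rw [norm_pow, norm_pow]
  exact pow_lt_pow_right_of_lt_one₀ (norm_pos_iff.mpr hq0) hq hab

theorem nondegenerate_pow (hq0 : q ≠ 0) (hq : ‖q‖ < 1) (h2 : ‖(2 : K)‖ = 1) (a b : ℕ) :
    Nondegenerate (q ^ b) (q ^ a) := fun n => by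
  rw [zpow_pow_eq, ← zpow_natCast q a, ← zpow_add₀ hq0]
  exact one_le_norm_one_add_zpow hq0 hq h2 _

theorem nondegenerate_neg_pow (hq0 : q ≠ 0) (hq : ‖q‖ < 1) {a b : ℕ} (ha : a ≠ 0) (hab : a < b) :
    Nondegenerate (q ^ b) (-q ^ a) :=
  .of_norm (by rw [norm_neg]; exact norm_pow_lt_one hq ha)
    (by rw [norm_neg]; exact norm_pow_lt_norm_pow hq0 hq hab) (pow_ne_zero _ hq0)

/-- In base `q¹²`, write `R` for the pole sum. Pairing signs gives `4R(-q²)` and `4R(-q⁴)`, while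
splitting `P(-q²)` by parity gives `R(-q²) + R(-q⁸)`. Inversion and periodicity identify `R(-q⁸)`
with `R(-q⁴)`. The combination is chosen so that each difference on the right has opposite
arguments. -/
theorem two_mul_poleSum_sub (hq0 : q ≠ 0) (hq : ‖q‖ < 1) (h2 : ‖(2 : K)‖ = 1) :
    2 * (poleSum (q ^ 6) q - poleSum (q ^ 6) (q ^ 2)) =
      (poleSum (q ^ 6) q - poleSum (q ^ 6) (-q)) -
        3 * (poleSum (q ^ 6) (q ^ 2) - poleSum (q ^ 6) (-q ^ 2)) := by
  have hQ0 : q ^ 6 ≠ 0 := pow_ne_zero 6 hq0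
  have hQ1 : ‖q ^ 6‖ < 1 := norm_pow_lt_one hq (by norm_num)
  have hq2 : q ^ 2 ≠ 0 := pow_ne_zero 2 hq0
  have h3 := poleSum_add_neg hQ0 hQ1 hq0 (by simpa using nondegenerate_pow hq0 hq h2 1 6)
    (by simpa using nondegenerate_neg_pow hq0 hq (a := 1) (b := 6) (by norm_num) (by norm_num))
  have h4 := poleSum_add_neg hQ0 hQ1 hq2 (nondegenerate_pow hq0 hq h2 2 6)
    (nondegenerate_neg_pow hq0 hq (by norm_num) (by norm_num))
  have h5 := poleSum_eq_add hQ0 hQ1 (neg_ne_zero.mpr hq2)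
    (nondegenerate_neg_pow hq0 hq (by norm_num) (by norm_num))
  have h6 : poleSum ((q ^ 6) ^ 2) (-q ^ 2 * q ^ 6) = poleSum ((q ^ 6) ^ 2) (-(q ^ 2) ^ 2) := by
    have hn : -(q ^ 2) ^ 2 ≠ 0 := neg_ne_zero.mpr (pow_ne_zero 2 hq2)
    rw [← poleSum_inv (pow_ne_zero 2 hQ0) hn, ← poleSum_mul (z := (-(q ^ 2) ^ 2)⁻¹) (pow_ne_zero 2 hQ0)]
    congr 1
    field_simp
  rw [h6] at h5
  linear_combination h3 + h4 - 4 * h5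

/-- The theta identity has the coefficients of the formula for `λ`, so eliminating `ψ(q²)` leaves a
multiple of `P(1) - P(q²)`. Both this and `P(q) - P(q²)` are theta quotients, and the first product
identity matches them. -/
theorem eulerProd_cube_mul_lambdaSum_sub [CharZero K] (hq0 : q ≠ 0) (hq : ‖q‖ < 1)
    (h2 : ‖(2 : K)‖ = 1) :
    eulerProd (q ^ 6) (q ^ 6) ^ 3 * (q * lambdaSum q - 2 * psiSum (q ^ 2)) =
      poleSum (q ^ 6) q - poleSum (q ^ 6) (q ^ 2) := by
  have hQ0 : q ^ 6 ≠ 0 := pow_ne_zero 6 hq0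
  have hQ1 : ‖q ^ 6‖ < 1 := norm_pow_lt_one hq (by norm_num)
  have hq2 : q ^ 2 ≠ 0 := pow_ne_zero 2 hq0
  have hp2 : ‖q ^ 2‖ < 1 := norm_pow_lt_one hq (by norm_num)
  have hQ2 : ‖q ^ 6‖ < ‖q ^ 2‖ := norm_pow_lt_norm_pow hq0 hq (by norm_num)
  have n1 : Nondegenerate (q ^ 6) 1 := by simpa using nondegenerate_pow hq0 hq h2 0 6
  have nq : Nondegenerate (q ^ 6) q := by simpa using nondegenerate_pow hq0 hq h2 1 6
  have t1 : theta (q ^ 6) q ≠ 0 :=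
    theta_ne_zero hq (by simpa using norm_pow_lt_norm_pow hq0 hq (a := 1) (b := 6) (by norm_num)) hQ0
  have t2 : theta (q ^ 6) (q ^ 2) ≠ 0 := theta_ne_zero hp2 hQ2 hQ0
  have hE {n : ℕ} (hn : n ≠ 0) : eulerProd (q ^ n) (q ^ n) ≠ 0 := eulerProd_pow_ne_zero hq hn hn
  have t0 {n : ℕ} (hn : n ≠ 0) : theta (q ^ n) 1 ≠ 0 := by
    have h3 := theta_one_eq (pow_ne_zero n hq0) (norm_pow_lt_one hq hn)
    refine left_ne_zero_of_mul (b := eulerProd (q ^ n) (q ^ n)) ?_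
    rw [h3, ← pow_mul]
    exact mul_ne_zero two_ne_zero (pow_ne_zero 2 (hE (by omega)))
  have ph : theta (q ^ 2) q ≠ 0 :=
    left_ne_zero_of_mul ((theta_sq_self_mul hq0 hq).trans_ne (pow_ne_zero 5 (hE two_ne_zero)))
  have tq : theta q 1 ≠ 0 := by simpa using t0 one_ne_zero
  have tQ := t0 (n := 6) (by norm_num)
  -- With `z = -q²` the reference point `-z` is `q²` in both evaluations.
  have b := poleSum_sub_poleSum_neg (x := 1) (z := -q ^ 2) hQ0 (by rwa [norm_neg])
    (by rwa [norm_neg]) one_ne_zero n1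
  have c := poleSum_sub_poleSum_neg (z := -q ^ 2) hQ0 (by rwa [norm_neg]) (by rwa [norm_neg]) hq0 nq
  have e1 : q * -q ^ 2 = -q ^ 3 := by ring
  have e2 : q⁻¹ * -q ^ 2 = -q := by field_simp
  simp only [neg_neg, e1, e2, inv_one, one_mul] at b c
  have s := appell_sub hQ0 hQ1 one_ne_zero n1 hq2 (nondegenerate_pow hq0 hq h2 2 6)
  have p := psiSum_mul_theta hq2 hp2 h2
  rw [← pow_mul, show 2 * 3 = 6 from rfl] at p
  have l := theta_sq_mul_lambdaSum hq0 hq h2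
  have w := theta_sq_mul_theta hq0 hq
  have A := (theta_product_identities hq0 hq).1
  generalize poleSum (q ^ 6) q = P1 at *
  generalize poleSum (q ^ 6) (q ^ 2) = P2 at *
  generalize poleSum (q ^ 6) 1 = P0 at *
  generalize eulerProd (q ^ 6) (q ^ 6) = E at *
  have l' : theta (q ^ 2) q * theta q 1 * (q * lambdaSum q) =
      2 * (q * theta (q ^ 3) 1 * appell (q ^ 6) 1 + 2 * theta (q ^ 3) q * appell (q ^ 6) (q ^ 2)) := by
    rw [mul_left_comm, l]
    field_simp
  have d : theta (q ^ 2) q * theta q 1 * theta (q ^ 6) (q ^ 2) * (E ^ 3 *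
      (q * lambdaSum q - 2 * psiSum (q ^ 2))) =
      2 * q * theta (q ^ 3) 1 * (theta (q ^ 6) 1 * theta (q ^ 6) (q ^ 2) * (P0 - P2)) := by
    rw [← s]
    linear_combination theta (q ^ 6) (q ^ 2) * E ^ 3 * l' -
      2 * E ^ 3 * theta (q ^ 6) (q ^ 2) * psiSum (q ^ 2) * w -
      (2 * E ^ 3 * q * theta (q ^ 3) 1 * theta (q ^ 6) 1 +
        4 * theta (q ^ 6) (q ^ 2) * E ^ 3 * theta (q ^ 3) q) * p
  have hne : theta (q ^ 2) q * theta q 1 * theta (q ^ 6) 1 * theta (q ^ 6) q ^ 2 *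
      theta (q ^ 6) (q ^ 2) ^ 2 ≠ 0 :=
    mul_ne_zero (mul_ne_zero (mul_ne_zero (mul_ne_zero ph tq) tQ) (pow_ne_zero 2 t1))
      (pow_ne_zero 2 t2)
  refine mul_left_cancel₀ hne ?_
  linear_combination theta (q ^ 6) 1 * theta (q ^ 6) q ^ 2 * theta (q ^ 6) (q ^ 2) * d +
    2 * q * theta (q ^ 3) 1 * theta (q ^ 6) q ^ 2 * b + q * E ^ 6 * A -
    theta (q ^ 2) q * theta q 1 * theta (q ^ 6) 1 * c

/-- The two differences with opposite arguments are evaluated with `x = z` equal to `q` and `q²`.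
The theta value at `x⁻¹z = 1` then appears, and the remaining product identities turn each into an
eta quotient. -/
theorem lambdaSum_sub_psiSum_sq [CharZero K] (hq0 : q ≠ 0) (hq : ‖q‖ < 1) (h2 : ‖(2 : K)‖ = 1) :
    (q * lambdaSum q - 2 * psiSum (q ^ 2)) * (eulerProd (q ^ 2) (q ^ 2) ^ 3 *
      eulerProd (q ^ 4) (q ^ 4) * eulerProd (q ^ 12) (q ^ 12)) =
    q * (eulerProd (q ^ 4) (q ^ 4) ^ 4 * eulerProd (q ^ 6) (q ^ 6) ^ 2) -
      3 * q ^ 2 * (eulerProd (q ^ 2) (q ^ 2) ^ 2 * eulerProd (q ^ 12) (q ^ 12) ^ 4) := by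
  have hQ0 : q ^ 6 ≠ 0 := pow_ne_zero 6 hq0
  have hq2 : q ^ 2 ≠ 0 := pow_ne_zero 2 hq0
  have hp2 : ‖q ^ 2‖ < 1 := norm_pow_lt_one hq (by norm_num)
  have hQ2 : ‖q ^ 6‖ < ‖q ^ 2‖ := norm_pow_lt_norm_pow hq0 hq (by norm_num)
  have hQ1 : ‖q ^ 6‖ < ‖q‖ := by
    simpa using norm_pow_lt_norm_pow hq0 hq (a := 1) (b := 6) (by norm_num)
  have nq : Nondegenerate (q ^ 6) q := by simpa using nondegenerate_pow hq0 hq h2 1 6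
  have d := poleSum_sub_poleSum_neg hQ0 hq hQ1 hq0 nq
  have e := poleSum_sub_poleSum_neg hQ0 hp2 hQ2 hq2 (nondegenerate_pow hq0 hq h2 2 6)
  have e1 : theta (q ^ 6) (q ^ 2 * q ^ 2) = theta (q ^ 6) (q ^ 2) := by
    rw [← theta_div hQ0 hq2]
    congr 1
    field_simp
  rw [inv_mul_cancel₀ hq0, show q * q = q ^ 2 by ring] at d
  rw [inv_mul_cancel₀ hq2, e1] at e
  have m := eulerProd_cube_mul_lambdaSum_sub hq0 hq h2
  have f := two_mul_poleSum_sub hq0 hq h2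
  obtain ⟨-, B, C⟩ := theta_product_identities hq0 hq
  have hE {n : ℕ} (hn : n ≠ 0) : eulerProd (q ^ n) (q ^ n) ≠ 0 := eulerProd_pow_ne_zero hq hn hn
  have t1 : theta (q ^ 6) q ≠ 0 := theta_ne_zero hq hQ1 hQ0
  have t2 : theta (q ^ 6) (q ^ 2) ≠ 0 := theta_ne_zero hp2 hQ2 hQ0
  have t3 : theta (q ^ 6) (-q) ≠ 0 :=
    theta_ne_zero (by rwa [norm_neg]) (by rwa [norm_neg]) hQ0
  have t4 : theta (q ^ 6) (-q ^ 2) ≠ 0 :=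
    theta_ne_zero (by rwa [norm_neg]) (by rwa [norm_neg]) hQ0
  have hE2 := hE (n := 2) (by norm_num)
  have hE4 := hE (n := 4) (by norm_num)
  have hE6 := hE (n := 6) (by norm_num)
  have hE12 := hE (n := 12) (by norm_num)
  clear hE hQ1 hQ2 hp2 e1 nq
  generalize eulerProd (q ^ 2) (q ^ 2) = J2 at *
  generalize eulerProd (q ^ 4) (q ^ 4) = J4 at *
  generalize eulerProd (q ^ 6) (q ^ 6) = J6 at *
  generalize eulerProd (q ^ 12) (q ^ 12) = J12 at *
  generalize theta (q ^ 6) q = T1 at *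
  generalize theta (q ^ 6) (q ^ 2) = T2 at *
  generalize theta (q ^ 6) (-q) = T3 at *
  generalize theta (q ^ 6) (-q ^ 2) = T4 at *
  generalize theta (q ^ 6) 1 = T0 at *
  generalize poleSum (q ^ 6) q - poleSum (q ^ 6) (-q) = U at *
  generalize poleSum (q ^ 6) (q ^ 2) - poleSum (q ^ 6) (-q ^ 2) = V at *
  generalize poleSum (q ^ 6) q - poleSum (q ^ 6) (q ^ 2) = W at *
  generalize q * lambdaSum q - 2 * psiSum (q ^ 2) = D at *
  have hU : J2 ^ 3 * J12 * U = 2 * q * J4 ^ 3 * J6 ^ 5 := by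
    have h3 : T1 ^ 2 * T3 ^ 2 ≠ 0 := by simp [*]
    refine mul_left_cancel₀ h3 ?_
    linear_combination J2 ^ 3 * J12 * d + q * J6 ^ 5 * B
  have hV : J2 * J4 * V = 2 * q ^ 2 * J12 ^ 3 * J6 ^ 3 := by
    have h3 : T2 ^ 2 * T4 ^ 2 ≠ 0 := by simp [*]
    refine mul_left_cancel₀ h3 ?_
    linear_combination J2 * J4 * e + q ^ 2 * T2 * J6 ^ 3 * C
  have h3 : 2 * J6 ^ 3 ≠ 0 := by simp [*]
  refine mul_left_cancel₀ h3 ?_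
  linear_combination 2 * J2 ^ 3 * J4 * J12 * m + J2 ^ 3 * J4 * J12 * f + J4 * hU - 3 * J2 ^ 2 * J12 * hV

end MockTheta

/-! ### An ultrametric field containing the integral power series. -/

namespace MockTheta
open PowerSeries

open scoped PowerSeries.WithPiTopology in
-- Laurent series over `ℚ` with the X-adic absolute value. Rational coefficients make `2` a unit of
-- the valuation ring, and continuity holds because divisibility by `X^N` bounds the norm by
-- `‖X‖^N`.
theorem exists_ultrametric_model :
    ∃ (K : Type) (_ : NormedField K) (_ : IsUltrametricDist K) (_ : CompleteSpace K)
      (ι : ℤ⟦X⟧ →+* K), Function.Injective ι ∧ Continuous ι ∧ ι X ≠ 0 ∧ ‖ι X‖ < 1 ∧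
        ‖(2 : K)‖ = 1 ∧ CharZero K := by
  let L := LaurentSeries ℚ
  let v : Valuation L (WithZero (Multiplicative ℤ)) := Valued.v
  have hvX : ∀ n : ℕ, v (((X : ℚ⟦X⟧) : L) ^ n) = WithZero.exp (-(n : ℤ)) :=
    fun n => LaurentSeries.valuation_X_pow ℚ n
  let hr : v.RankOne :=
    -- The base `2` only normalises the absolute value; it is unrelated to the prime 2.
    { hom' := (WithZeroMulInt.toNNReal (e := 2) two_ne_zero).comp
        MonoidWithZeroHom.ValueGroup₀.embedding
      strictMono' := (WithZeroMulInt.toNNReal_strictMono one_lt_two).comp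
        MonoidWithZeroHom.ValueGroup₀.embedding_strictMono
      exists_val_nontrivial := ⟨((X : ℚ⟦X⟧) : L), by
        have := hvX 1
        rw [pow_one] at this
        rw [this]
        refine ⟨WithZero.exp_ne_zero, ?_⟩
        rw [← WithZero.exp_zero, Ne, WithZero.exp_inj]
        norm_num⟩ }
  let nf : NormedField L := Valued.toNormedField L (WithZero (Multiplicative ℤ))
  have hle : ∀ x y : L, ‖x‖ ≤ ‖y‖ ↔ v x ≤ v y := fun x y => Valued.toNormedField.norm_le_iff
  let ι : ℤ⟦X⟧ →+* L := (algebraMap ℚ⟦X⟧ L).comp (PowerSeries.map (Int.castRingHom ℚ))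
  have hιX : ι X = ((X : ℚ⟦X⟧) : L) := by
    change algebraMap ℚ⟦X⟧ L (PowerSeries.map (Int.castRingHom ℚ) X) = _
    rw [PowerSeries.map_X, LaurentSeries.coe_algebraMap]
  have hX0 : ι X ≠ 0 := by
    intro h
    have := hvX 1
    rw [pow_one, ← hιX, h, map_zero] at this
    exact WithZero.exp_ne_zero this.symm
  have hX1 : ‖ι X‖ < 1 := by
    rw [Valued.toNormedField.norm_lt_one_iff, hιX]
    have := hvX 1
    rw [pow_one] at this
    change v _ < 1
    rw [this, ← WithZero.exp_zero]
    exact WithZero.exp_lt_exp.mpr (by norm_num)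
  have hint : ∀ f : ℤ⟦X⟧, ‖ι f‖ ≤ 1 := by
    intro f
    rw [Valued.toNormedField.norm_le_one_iff]
    exact IsDedekindDomain.HeightOneSpectrum.valuation_le_one _ _
  have hinj : Function.Injective ι := by
    have h1 : Function.Injective (PowerSeries.map (Int.castRingHom ℚ)) :=
      PowerSeries.map_injective _ (RingHom.injective_int _)
    exact (IsFractionRing.injective ℚ⟦X⟧ L).comp h1
  have hcz : CharZero L :=
    charZero_of_injective_ringHom (f := ι.comp (PowerSeries.C (R := ℤ)))
      (hinj.comp PowerSeries.C_injective)
  refine ⟨L, nf, inferInstance, inferInstance, ι, hinj, ?_, hX0, hX1, ?_, hcz⟩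
  · refine continuous_of_continuousAt_zero ι.toAddMonoidHom ?_
    change Filter.Tendsto ι (nhds 0) (nhds (ι 0))
    rw [map_zero, Metric.tendsto_nhds]
    intro ε hε
    obtain ⟨N, hN⟩ := exists_pow_lt_of_lt_one hε hX1
    have h1 : ∀ᶠ f : ℤ⟦X⟧ in nhds 0, ∀ m ∈ Finset.range N, coeff m f = 0 := by
      rw [Filter.eventually_all_finset]
      intro m _
      have := (WithPiTopology.continuous_coeff ℤ m).tendsto (0 : ℤ⟦X⟧)
      rw [map_zero] at this
      have h2 := this.eventually (show ∀ᶠ x : ℤ in nhds 0, x = 0 by simp)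
      exact h2
    filter_upwards [h1] with f hf
    have hd : X ^ N ∣ f := X_pow_dvd_iff.mpr fun m hm => hf m (Finset.mem_range.mpr hm)
    obtain ⟨g, rfl⟩ := hd
    rw [dist_zero_right, map_mul, map_pow, norm_mul, norm_pow]
    calc _ ≤ ‖ι X‖ ^ N * 1 := by gcongr; exact hint g
      _ < ε := by simpa using hN
  · have h2 : ‖(2 : L)‖ ≤ 1 := by
      have := hint 2
      rwa [map_ofNat] at this
    have h3 : ‖(2 : L)⁻¹‖ ≤ 1 := by
      rw [Valued.toNormedField.norm_le_one_iff]
      have : (2 : L)⁻¹ = algebraMap ℚ⟦X⟧ L (PowerSeries.C (2⁻¹ : ℚ)) := by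
        apply inv_eq_of_mul_eq_one_right
        have : (2 : L) = algebraMap ℚ⟦X⟧ L (PowerSeries.C (2 : ℚ)) := by
          rw [map_ofNat, map_ofNat]
        rw [this, ← map_mul, ← map_mul]
        norm_num
      rw [this]
      exact IsDedekindDomain.HeightOneSpectrum.valuation_le_one _ _
    rw [norm_inv] at h3
    have h4 : ‖(2 : L)‖ ≠ 0 := norm_ne_zero_iff.mpr two_ne_zero
    have h5 : 0 < ‖(2 : L)‖ := lt_of_le_of_ne (norm_nonneg _) h4.symm
    have := (inv_le_one₀ h5).mp h3
    linarith
end MockTheta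

/-! ### Transfer between power series and the field. -/

namespace MockTheta
open PowerSeries
open scoped PowerSeries.WithPiTopology

theorem continuous_expand {p : ℕ} (hp : p ≠ 0) : Continuous (expand p hp : ℤ⟦X⟧ → ℤ⟦X⟧) := by
  rw [continuous_iff_continuousAt]
  intro f
  rw [ContinuousAt, WithPiTopology.tendsto_iff_coeff_tendsto]
  intro d
  simp_rw [coeff_expand]
  split_ifs
  · exact (WithPiTopology.continuous_coeff ℤ _).tendsto f
  · exact tendsto_const_nhds

/-- The generating function of the triangular numbers. -/
noncomputable def triangularSeries : ℤ⟦X⟧ := ∑' n : ℕ, X ^ (n + 1).choose 2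

theorem le_choose_two (n : ℕ) : n ≤ (n + 1).choose 2 := by
  rw [Nat.choose_succ_succ, Nat.choose_one_right]
  omega

theorem summable_triangular : Summable fun n : ℕ => (X : ℤ⟦X⟧) ^ (n + 1).choose 2 :=
  summable_of_X_pow_dvd _ fun n => pow_dvd_pow X (le_choose_two n)

theorem coeff_triangularSeries (n : ℕ) [Decidable (∃ k : ℕ, n = (k + 1).choose 2)] :
    coeff n triangularSeries = if ∃ k : ℕ, n = (k + 1).choose 2 then 1 else 0 := by
  rw [triangularSeries, summable_triangular.map_tsum _ (WithPiTopology.continuous_coeff ℤ n)]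
  simp_rw [coeff_X_pow]
  have hmono : StrictMono fun k : ℕ => (k + 1).choose 2 := strictMono_nat_of_lt_succ fun k => by
    have h := Nat.choose_succ_succ' (k + 1) 1
    rw [Nat.choose_one_right, show 1 + 1 = 2 from rfl] at h
    omega
  split_ifs with h
  · obtain ⟨k, hk⟩ := h
    rw [tsum_eq_single k, if_pos hk]
    exact fun j hj => if_neg fun hj' => hj (hmono.injective (hj'.symm.trans hk))
  · push Not at h
    simp [h]

/-- The integral power series `Z` for which
`(-1)^r X^(3r(r+1)) (1 + 2 ∑_{1 ≤ j ≤ r} (-1)^j X^(-j²)) = X^(3r(r+1)) + 2 Z`. -/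
noncomputable def psiRemainder (r : ℕ) : ℤ⟦X⟧ :=
  (if Even r then 0 else -X ^ (6 * (r + 1).choose 2)) +
    ∑ j ∈ Finset.range r, (-1) ^ (r + j + 1) * X ^ (6 * (r + 1).choose 2 - (j + 1) ^ 2)

theorem sq_add_le_choose (r j : ℕ) (hj : j < r) : r + (j + 1) ^ 2 ≤ 6 * (r + 1).choose 2 := by
  have h := Nat.triangle_succ r
  have h1 : 2 * (r + 1).choose 2 = (r + 1) * r := by
    rw [Nat.choose_two_right, Nat.mul_div_cancel']
    · rfl
    · exact (Nat.even_mul_pred_self (r + 1)).two_dvd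
  have h2 : (j + 1) ^ 2 ≤ r ^ 2 := Nat.pow_le_pow_left hj 2
  nlinarith

theorem summable_psiRemainder : Summable psiRemainder := by
  refine summable_of_X_pow_dvd _ fun r => dvd_add ?_ (Finset.dvd_sum fun j hj => ?_)
  · split_ifs
    · exact dvd_zero _
    · exact (dvd_neg).mpr (pow_dvd_pow X (by have := le_choose_two r; omega))
  · have := sq_add_le_choose r j (Finset.mem_range.mp hj)
    exact Dvd.dvd.mul_left (pow_dvd_pow X (by omega)) _

section Evaluation

variable {K : Type*} [NormedField K] [IsUltrametricDist K] [CompleteSpace K]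

theorem theta_one_eq_tsum {q : K} (hq0 : q ≠ 0) (hq : ‖q‖ < 1) :
    theta q 1 = 2 * ∑' n : ℕ, q ^ (n + 1).choose 2 := by
  have hs := summable_theta hq0 hq one_ne_zero
  simp only [one_zpow, mul_one] at hs
  have h1 (n : ℕ) : q ^ tri ((n : ℤ) + 1) = q ^ (n + 1).choose 2 := by
    rw [← Nat.cast_succ, tri_natCast, zpow_natCast]
  have h2 (n : ℕ) : q ^ tri (-((n : ℤ) + 1) + 1) = q ^ (n + 1).choose 2 := by
    rw [neg_add_eq_sub, tri_one_sub, h1]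
  have hs' : Summable fun n : ℕ => q ^ (n + 1).choose 2 := by
    refine (hs.comp_injective (i := fun n : ℕ => (n : ℤ) + 1) fun a b h => by simpa using h).congr
      fun n => ?_
    exact h1 n
  rw [theta, ← (Equiv.addRight (1 : ℤ)).tsum_eq]
  simp only [one_zpow, mul_one, Equiv.coe_addRight]
  have h3 := HasSum.of_nat_of_neg_add_one (f := fun n : ℤ => q ^ tri (n + 1))
    (hs'.hasSum.congr_fun h1) (hs'.hasSum.congr_fun h2)
  rw [h3.tsum_eq, two_mul]

theorem signedSum_eq (q : K) (r : ℕ) :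
    signedSum q r = 1 + 2 * ∑ j ∈ Finset.range r, (-1) ^ (j + 1) * (q ^ (j + 1) ^ 2)⁻¹ := by
  induction r with
  | zero => simp [signedSum]
  | succ r ih => rw [signedSum_succ, ih, Finset.sum_range_succ]; ring

variable {ι : ℤ⟦X⟧ →+* K}

theorem map_qPoch (a b : ℤ⟦X⟧) (n : ℕ) : ι (qPoch a b n) = poch (ι a) (ι b) n := by
  simp [qPoch, poch, map_prod]

theorem map_qDiv (f : ℤ⟦X⟧) {g : ℤ⟦X⟧} (hg : constantCoeff g = 1) : ι (qDiv f g) = ι f / ι g := by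
  have h1 : ι g ≠ 0 := by
    refine left_ne_zero_of_mul (b := ι (invOfUnit g 1)) ?_
    rw [← map_mul, mul_invOfUnit g 1 (by simpa using hg), map_one]
    exact one_ne_zero
  rw [eq_div_iff h1, ← map_mul, qDiv_mul_cancel f g hg]

theorem map_J (hι : Continuous ι) {m : ℕ} (hm : 0 < m) :
    ι (J m) = eulerProd (ι X ^ m) (ι X ^ m) := by
  rw [J, qPochInf, (multipliable_J m hm).map_tprod ι hι, eulerProd]
  simp

theorem map_lambda6 (hι : Continuous ι) : ι lambda6 = lambdaSum (ι X) := by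
  rw [lambda6, summable_lambdaTerm.map_tsum ι hι, lambdaSum]
  refine tsum_congr fun n => ?_
  rw [lambdaTerm, map_qDiv _ (constantCoeff_qPoch _ _ (by simp) n), map_mul, map_qPoch, map_qPoch]
  simp

theorem map_psi6 (hι : Continuous ι) : ι psi6 = psiSum (ι X) := by
  rw [psi6, summable_psiTerm.map_tsum ι hι, psiSum]
  refine tsum_congr fun n => ?_
  rw [psiTerm, map_qDiv _ (constantCoeff_qPoch _ _ (by simp) _), map_mul, map_qPoch, map_qPoch]
  simp

theorem map_triangularSeries (hι : Continuous ι) :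
    ι triangularSeries = ∑' n : ℕ, ι X ^ (n + 1).choose 2 := by
  rw [triangularSeries, summable_triangular.map_tsum ι hι]
  simp

/-- The terms `±j` of `signedSum` are equal, so everything off the centre is even; the central terms
give the triangular series in `X⁶`, their signs being correct modulo 2. The remainder is kept
integral so that reduction is possible. -/
theorem map_tsum_psiRemainder (hι : Continuous ι) (hX : ι X ≠ 0) :
    ∑' r : ℕ, (-1) ^ r * ι X ^ (6 * (r + 1).choose 2) * signedSum (ι X) r =
      ι (expand 6 (by norm_num) triangularSeries + 2 * ∑' r, psiRemainder r) := by
  let ε : ℤ⟦X⟧ →+* K := ι.comp (expand 6 (by norm_num) : ℤ⟦X⟧ →ₐ[ℤ] ℤ⟦X⟧)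
  have hε : Continuous ε := hι.comp (continuous_expand (p := 6) (by norm_num))
  have h1 := (summable_triangular.hasSum.map ε hε).add
    ((summable_psiRemainder.hasSum.map ι hι).mul_left 2)
  have h2 : ι (expand 6 (by norm_num) triangularSeries + 2 * ∑' r, psiRemainder r) =
      ε (∑' n : ℕ, X ^ (n + 1).choose 2) + 2 * ι (∑' r, psiRemainder r) := by
    rw [map_add, map_mul, map_ofNat]; rfl
  rw [h2, ← h1.tsum_eq]
  refine tsum_congr fun r => ?_
  have h3 : ε X = ι X ^ 6 := by
    change ι (expand 6 (by norm_num) X) = _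
    rw [expand_X, map_pow]
  have h4 : ∑ j ∈ Finset.range r, (-1 : K) ^ (r + j + 1) *
      ι X ^ (6 * (r + 1).choose 2 - (j + 1) ^ 2) = (-1) ^ r * ι X ^ (6 * (r + 1).choose 2) *
        ∑ j ∈ Finset.range r, (-1) ^ (j + 1) * (ι X ^ (j + 1) ^ 2)⁻¹ := by
    rw [Finset.mul_sum]
    refine Finset.sum_congr rfl fun j hj => ?_
    have := sq_add_le_choose r j (Finset.mem_range.mp hj)
    rw [pow_sub₀ _ hX (by omega)]
    ring
  have h5 : ι (psiRemainder r) = (if Even r then 0 else -ι X ^ (6 * (r + 1).choose 2)) +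
      ∑ j ∈ Finset.range r, (-1 : K) ^ (r + j + 1) *
        ι X ^ (6 * (r + 1).choose 2 - (j + 1) ^ 2) := by
    rw [psiRemainder, map_add, map_sum]
    congr 1
    · split_ifs <;> simp
    · simp
  rw [Function.comp_apply, Function.comp_apply, map_pow, h3, h5, h4, signedSum_eq, ← pow_mul]
  rcases Nat.even_or_odd r with h | h
  · rw [if_pos h, h.neg_one_pow]; ring
  · rw [if_neg (Nat.not_even_iff_odd.mpr h), h.neg_one_pow]; ring

end Evaluation

end MockTheta

/-! ### The 2-dissection and the parity statements. -/

namespace MockTheta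
open PowerSeries
open scoped PowerSeries.WithPiTopology

/-- The embedding composed with `X ↦ X²` is again a continuous ring homomorphism, so the evaluation
formulas apply to it with `ι X ^ 2` in place of `ι X`. -/
theorem J_two_mul {m : ℕ} (hm : 0 < m) : J (2 * m) = expand 2 two_ne_zero (J m) := by
  obtain ⟨K, _, _, _, ι, hinj, hι, -, -, -, -⟩ := exists_ultrametric_model
  let ε : ℤ⟦X⟧ →+* K := ι.comp (expand 2 two_ne_zero : ℤ⟦X⟧ →ₐ[ℤ] ℤ⟦X⟧)
  have hε : Continuous ε := hι.comp (continuous_expand two_ne_zero)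
  apply hinj
  change _ = ε (J m)
  have h3 : ε X = ι X ^ 2 := by
    change ι (expand 2 two_ne_zero X) = _
    rw [expand_X, map_pow]
  rw [map_J hι (by omega), map_J hε hm, h3, ← pow_mul]

theorem triangularSeries_mul_J : triangularSeries * J 1 = J 2 ^ 2 := by
  obtain ⟨K, _, _, _, ι, hinj, hι, hX, hX1, -, _⟩ := exists_ultrametric_model
  apply hinj
  have h := theta_one_eq hX hX1
  rw [theta_one_eq_tsum hX hX1, mul_assoc] at h
  rw [map_mul, map_pow, map_triangularSeries hι, map_J hι one_pos, map_J hι two_pos, pow_one]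
  exact mul_left_cancel₀ two_ne_zero h

theorem expand_triangularSeries_mul_J {m : ℕ} (hm : m ≠ 0) :
    expand m hm triangularSeries * J m = J (2 * m) ^ 2 := by
  obtain ⟨K, _, _, _, ι, hinj, hι, hX, hX1, -, _⟩ := exists_ultrametric_model
  let ε : ℤ⟦X⟧ →+* K := ι.comp (expand m hm : ℤ⟦X⟧ →ₐ[ℤ] ℤ⟦X⟧)
  have hε : Continuous ε := hι.comp (continuous_expand hm)
  have h3 : ε X = ι X ^ m := by
    change ι (expand m hm X) = _
    rw [expand_X, map_pow]
  have h4 := congrArg ε triangularSeries_mul_J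
  rw [map_mul, map_pow, map_J hε one_pos, map_J hε two_pos, h3, pow_one] at h4
  apply hinj
  rw [map_mul, map_pow, map_J hι (by omega), map_J hι (by omega), mul_comm 2, pow_mul]
  exact h4

/-- The dissection sees `ψ` only through `2ψ`, so its parity must come from the Hecke-type series.
-/
theorem psi6_mul : psi6 * J 2 ^ 2 = X * J 1 *
    (expand 6 (by norm_num) triangularSeries + 2 * ∑' r, psiRemainder r) := by
  obtain ⟨K, _, _, _, ι, hinj, hι, hX, hX1, -, _⟩ := exists_ultrametric_model
  apply hinj
  have h2 := eulerProd_ne_zero (norm_pow_lt_one hX1 two_ne_zero) (norm_pow_lt_one hX1 two_ne_zero)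
  have h3 := eulerProd_eq_mul_sq hX1 (ι X)
  rw [map_mul, map_psi6 hι, psiSum_eq hX hX1, map_tsum_psiRemainder hι hX, map_mul, map_mul, map_pow,
    map_J hι one_pos, map_J hι two_pos, pow_one, h3, ← pow_two]
  field_simp

theorem X_mul_lambda6_sub : (X * lambda6 - 2 * expand 2 two_ne_zero psi6) *
    (J 2 ^ 3 * J 4 * J 12) = X * (J 4 ^ 4 * J 6 ^ 2) - 3 * X ^ 2 * (J 2 ^ 2 * J 12 ^ 4) := by
  obtain ⟨K, _, _, _, ι, hinj, hι, hX, hX1, h2, _⟩ := exists_ultrametric_model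
  let ε : ℤ⟦X⟧ →+* K := ι.comp (expand 2 two_ne_zero : ℤ⟦X⟧ →ₐ[ℤ] ℤ⟦X⟧)
  have hε : Continuous ε := hι.comp (continuous_expand two_ne_zero)
  have h3 : ε X = ι X ^ 2 := by
    change ι (expand 2 two_ne_zero X) = _
    rw [expand_X, map_pow]
  have h4 : ι (expand 2 two_ne_zero psi6) = psiSum (ι X ^ 2) := by
    rw [← h3, ← map_psi6 hε]; rfl
  apply hinj
  have h := lambdaSum_sub_psiSum_sq hX hX1 h2
  simp only [map_mul, map_sub, map_pow, map_ofNat, h4, map_lambda6 hι, map_J hι two_pos,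
    map_J hι (show 0 < 4 by norm_num), map_J hι (show 0 < 6 by norm_num),
    map_J hι (show 0 < 12 by norm_num)]
  exact h

theorem constantCoeff_lambda_denom : constantCoeff (J 1 ^ 3 * J 6) = 1 := by
  simp [constantCoeff_J]

theorem constantCoeff_psi_denom : constantCoeff (J 1 * J 2) = 1 := by
  simp [constantCoeff_J]

theorem J_ne_zero {m : ℕ} (hm : 0 < m) : J m ≠ 0 := fun h => by
  have := constantCoeff_J m hm
  rw [h, map_zero] at this
  exact zero_ne_one this

/-- The `2`-dissection of `X * lambda6`. -/
theorem X_mul_lambda6_eq : X * lambda6 =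
    X * expand 2 two_ne_zero (qDiv (J 2 ^ 3 * J 3 ^ 2) (J 1 ^ 3 * J 6)) +
      expand 2 two_ne_zero (2 * psi6 - 3 * X * qDiv (J 6 ^ 3) (J 1 * J 2)) := by
  have h := X_mul_lambda6_sub
  have hA := congrArg (expand 2 two_ne_zero)
    (qDiv_mul_cancel (J 2 ^ 3 * J 3 ^ 2) _ constantCoeff_lambda_denom)
  have hB := congrArg (expand 2 two_ne_zero) (qDiv_mul_cancel (J 6 ^ 3) _ constantCoeff_psi_denom)
  simp only [map_mul, map_pow, ← J_two_mul (show 0 < 1 by norm_num),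
    ← J_two_mul (show 0 < 2 by norm_num), ← J_two_mul (show 0 < 3 by norm_num),
    ← J_two_mul (show 0 < 6 by norm_num), Nat.reduceMul] at hA hB
  simp only [map_sub, map_mul, map_ofNat, expand_X]
  have h2 := J_ne_zero (m := 2) (by norm_num)
  have h4 := J_ne_zero (m := 4) (by norm_num)
  have h12 := J_ne_zero (m := 12) (by norm_num)
  refine mul_right_cancel₀ (mul_ne_zero (mul_ne_zero (pow_ne_zero 3 h2) h4) h12) ?_
  linear_combination h - X * J 4 * hA + 3 * X ^ 2 * J 2 ^ 2 * J 12 * hB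

theorem coeff_lambda6_even (n : ℕ) :
    coeff (2 * n) lambda6 = coeff n (qDiv (J 2 ^ 3 * J 3 ^ 2) (J 1 ^ 3 * J 6)) := by
  have h := congrArg (coeff (2 * n + 1)) X_mul_lambda6_eq
  rwa [map_add, coeff_succ_X_mul, coeff_succ_X_mul, coeff_expand_mul, coeff_expand_of_not_dvd 2 _ _
    (by omega), add_zero] at h

theorem coeff_lambda6_odd {n : ℕ} (hn : 1 ≤ n) :
    coeff (2 * n - 1) lambda6 =
      2 * coeff n psi6 - coeff n (3 * X * qDiv (J 6 ^ 3) (J 1 * J 2)) := by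
  obtain ⟨m, rfl⟩ := Nat.exists_eq_add_of_le' hn
  have h := congrArg (coeff (2 * m + 1 + 1)) X_mul_lambda6_eq
  rw [map_add, coeff_succ_X_mul, coeff_succ_X_mul, coeff_expand_of_not_dvd 2 _ _ (by omega), zero_add,
    show 2 * m + 1 + 1 = 2 * (m + 1) by ring, coeff_expand_mul, map_sub, two_mul psi6, map_add,
    ← two_mul] at h
  exact h

/-- Reduction of integral power series modulo `2`. -/
noncomputable def red : ℤ⟦X⟧ →+* (ZMod 2)⟦X⟧ := map (Int.castRingHom (ZMod 2))

/-- Frobenius is the identity on the coefficients, so squaring modulo 2 is the substitution `X ↦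
X²`. -/
theorem red_expand_two (f : ℤ⟦X⟧) : red (expand 2 two_ne_zero f) = red f ^ 2 := by
  rw [red, map_expand]
  have h := MvPowerSeries.map_frobenius_expand 2 two_ne_zero
    (f := map (Int.castRingHom (ZMod 2)) f)
  rw [ZMod.frobenius_zmod] at h
  rw [← h]
  exact (congrFun (congrArg DFunLike.coe (MvPowerSeries.map_id (σ := Unit) (R := ZMod 2))) _).symm

theorem red_J_two_mul {m : ℕ} (hm : 0 < m) : red (J (2 * m)) = red (J m) ^ 2 := by
  rw [J_two_mul hm, red_expand_two]

theorem red_J_ne_zero {m : ℕ} (hm : 0 < m) : red (J m) ≠ 0 := fun h => by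
  have h1 := congrArg constantCoeff h
  rw [red, ← coeff_zero_eq_constantCoeff_apply, coeff_map, coeff_zero_eq_constantCoeff_apply,
    constantCoeff_J m hm] at h1
  simp at h1

theorem red_two_mul (f : ℤ⟦X⟧) : red (2 * f) = 0 := by
  rw [two_mul, map_add]
  ext n
  rw [map_add, map_zero]
  exact CharTwo.add_self_eq_zero _

theorem coeff_modEq_of_red_eq {f g : ℤ⟦X⟧} (h : red f = red g) (n : ℕ) :
    coeff n f ≡ coeff n g [ZMOD 2] := by
  refine (ZMod.intCast_eq_intCast_iff _ _ 2).mp ?_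
  simpa [red, coeff_map] using congrArg (coeff n) h

/-- With `J 2 ≡ (J 1)²` and `J 6 ≡ (J 3)²`, both sides reduce to `(J 1)³`. -/
theorem red_lambda6_quotient :
    red (qDiv (J 2 ^ 3 * J 3 ^ 2) (J 1 ^ 3 * J 6)) = red triangularSeries := by
  have h1 := congrArg red (qDiv_mul_cancel (J 2 ^ 3 * J 3 ^ 2) _ constantCoeff_lambda_denom)
  have h2 := congrArg red triangularSeries_mul_J
  have h3 := red_J_two_mul one_pos
  have h4 := red_J_two_mul (show 0 < 3 by norm_num)
  rw [mul_one] at h3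
  rw [show 2 * 3 = 6 from rfl] at h4
  simp only [map_mul, map_pow, h3, h4] at h1 h2
  have h5 := red_J_ne_zero one_pos
  refine mul_right_cancel₀ (mul_ne_zero (pow_ne_zero 3 h5)
    (pow_ne_zero 2 (red_J_ne_zero (show 0 < 3 by norm_num)))) ?_
  linear_combination h1 - red (J 1) ^ 2 * red (J 3) ^ 2 * h2

/-- The triangular series in `X⁶` is `(J 12)² / J 6 ≡ (J 6)³`, and both sides reduce to `X (J 6)³ /
(J 1)³`. -/
theorem red_psi6 : red psi6 = red (X * qDiv (J 6 ^ 3) (J 1 * J 2)) := by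
  have h1 := congrArg red (qDiv_mul_cancel (J 6 ^ 3) _ constantCoeff_psi_denom)
  have h2 := congrArg red psi6_mul
  have h6 := congrArg red (expand_triangularSeries_mul_J (m := 6) (by norm_num))
  have h3 := red_J_two_mul one_pos
  have h4 := red_J_two_mul (show 0 < 6 by norm_num)
  rw [mul_one] at h3
  rw [map_mul, map_mul _ (X * J 1), map_add, red_two_mul, add_zero] at h2
  simp only [map_mul, map_pow, h3, h4] at h1 h2 h6 ⊢
  have h5 := red_J_ne_zero one_pos
  refine mul_right_cancel₀ (mul_ne_zero (pow_ne_zero 4 h5) (red_J_ne_zero (show 0 < 6 by norm_num))) ?_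
  linear_combination red (J 6) * h2 + red X * red (J 1) * h6 - red X * red (J 1) * red (J 6) * h1

theorem exists_eq_choose_two_iff (n : ℕ) :
    (∃ k : ℕ, n = (k + 1).choose 2) ↔ ∃ k : ℤ, (n : ℤ) = k * (k + 1) / 2 := by
  have h (k : ℕ) : (((k + 1).choose 2 : ℕ) : ℤ) = k * (k + 1) / 2 := by
    rw [Nat.choose_two_right, Nat.add_sub_cancel, mul_comm]
    push_cast
    rfl
  constructor
  · rintro ⟨k, rfl⟩
    exact ⟨k, h k⟩
  · rintro ⟨k, hk⟩
    rcases le_or_gt 0 k with h0 | h0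
    · lift k to ℕ using h0
      exact ⟨k, by exact_mod_cast hk.trans (h k).symm⟩
    · obtain ⟨m, rfl⟩ : ∃ m : ℕ, k = -(m + 1) := ⟨(-k - 1).toNat, by omega⟩
      refine ⟨m, ?_⟩
      rw [show -((m : ℤ) + 1) * (-(m + 1) + 1) = m * (m + 1) by ring] at hk
      exact_mod_cast hk.trans (h m).symm

end MockTheta

theorem mainTheorem12 :
    PowerSeries.mk (fun n : ℕ => MockTheta.c MockTheta.lambda6 (2 * n)) =
        MockTheta.qDiv (MockTheta.J 2 ^ 3 * MockTheta.J 3 ^ 2)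
          (MockTheta.J 1 ^ 3 * MockTheta.J 6) ∧
    PowerSeries.mk (fun n : ℕ =>
        if 1 ≤ n then
          2 * MockTheta.c MockTheta.psi6 n - MockTheta.c MockTheta.lambda6 (2 * n - 1)
        else 0) =
        3 * PowerSeries.X *
          MockTheta.qDiv (MockTheta.J 6 ^ 3) (MockTheta.J 1 * MockTheta.J 2) ∧
    (∀ n : ℕ, 1 ≤ n →
      MockTheta.c MockTheta.lambda6 (2 * n - 1) ≡ MockTheta.c MockTheta.psi6 n [ZMOD 2]) ∧
    (∀ n : ℕ, Odd (MockTheta.c MockTheta.lambda6 (2 * n)) ↔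
      ∃ k : ℤ, (n : ℤ) = k * (k + 1) / 2) := by
  refine ⟨?_, ?_, fun n hn => ?_, fun n => ?_⟩
  · ext n
    rw [PowerSeries.coeff_mk, MockTheta.c, MockTheta.coeff_lambda6_even]
  · ext n
    rw [PowerSeries.coeff_mk]
    split_ifs with hn
    · rw [MockTheta.c, MockTheta.c, MockTheta.coeff_lambda6_odd hn, sub_sub_cancel]
    · obtain rfl : n = 0 := by omega
      simp
  -- The odd coefficient of `λ` is `2c(ψ; n)` minus three times a coefficient congruent to `c(ψ;
  -- n)`.
  · have h := MockTheta.coeff_modEq_of_red_eq MockTheta.red_psi6 n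
    have h3 (f : PowerSeries ℤ) :
        PowerSeries.coeff n (3 * PowerSeries.X * f) = 3 * PowerSeries.coeff n (PowerSeries.X * f) := by
      rw [mul_assoc, show (3 : PowerSeries ℤ) = PowerSeries.C (3 : ℤ) from (map_ofNat _ 3).symm,
        PowerSeries.coeff_C_mul]
    rw [MockTheta.c, MockTheta.c, MockTheta.coeff_lambda6_odd hn, h3]
    rw [Int.modEq_iff_dvd] at h ⊢
    omega
  · classical
    have h := MockTheta.coeff_modEq_of_red_eq MockTheta.red_lambda6_quotient n
    rw [MockTheta.c, MockTheta.coeff_lambda6_even, ← MockTheta.exists_eq_choose_two_iff, Int.odd_iff,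
      h.eq, MockTheta.coeff_triangularSeries]
    split_ifs with hk <;> simp [hk]
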